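/- Let $D\subset\mathbb R^d$ be a bounded open set, and let $\varphi,\phi:\partial D\to\mathbb R$ be restrictions to $\partial D$ of smooth functions on $\mathbb R^d$, with $c\le\varphi,\phi\le C$ on $\partial D$ for some constants $0<c\le C$. Let $0<m<|D|$. For an open set $\Omega\subset D$ such that $D\setminus\Omega$ is compact, let $u_\Omega,v_\Omega\in H^1(D)$ be the weak solutions of $$\Delta u_\Omega=0\ \text{in }\Omega,\quad u_\Omega=\varphi\ \text{on }\partial D,\quad u_\Omega=0\ \text{on }D\setminus\Omega,\qquad \Delta v_\Omega=0\ \text{in }\Omega,\quad v_\Omega=\phi\ \text{on }\partial D,\quad v_\Omega=0\ \text{on }D\setminus\Omega,$$ where the boundary conditions for $u_\Omega$ mean that $u_\Omega-g$ (extended by $0$ outside $D$) is in $H^1_0(\Omega)$ for some smooth $g:\mathbb R^d\to\mathbb R$ with $g=\varphi$ on $\partial D$ and $g=0$ near $D\setminus\Omega$, and similarly for $v_\Omega$. Set $$\mathcal F(\Omega)=\int_D\nabla u_\Omega\cdot\nabla v_\Omega\,dx,\qquad \mathcal F_\Lambda(\Omega)=\mathcal F(\Omega)+\Lambda|\Omega|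 .$$ Let $\Omega$ be a minimizer of $\mathcal F$ among all open sets $\Omega'\subset D$ such that $|\Omega'|=m$ and $D\setminus\Omega'$ is compact. For $\eta\in C^\infty_c(D;\mathbb R^d)$ with flow $\Phi_t$, the first and second variations $\delta\mathcal F_\Lambda(\Omega)[\eta]$ and $\delta^2\mathcal F_\Lambda(\Omega)[\eta]$ are the first and second derivatives of $t\mapsto\mathcal F_\Lambda(\Phi_t(\Omega))$ at $t=0$; they are given by $$\delta\mathcal F_\Lambda(\Omega)[\eta]=\int_\Omega\nabla u_\Omega\cdot(\delta A)\nabla v_\Omega\,dx+\Lambda\int_\Omega\operatorname{div}\eta\,dx,$$ $$\delta^2\mathcal F_\Lambda(\Omega)[\eta]=2\int_\Omega\big(\nabla u_\Omega\cdot(\delta^2A)\nabla v_\Omega-\nabla(\delta u)\cdot\nabla(\delta v)\big)dx+\Lambda\int_\Omega\big((\operatorname{div}\eta)^2+\eta\cdot\nabla(\operatorname{div}\eta)\big)dx,$$ where, with $D\eta$ the Jacobian matrix of $\eta$ and $\nabla\eta=(D\eta)^T$, $$\delta A=-D\eta-\nabla\eta+(\operatorname{div}\eta)\,\mathrm{Id},$$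 $$\delta^2A=(D\eta)(\nabla\eta)+\tfrac12(\nabla\eta)^2+\tfrac12(D\eta)^2-\tfrac12(\eta\cdot\nabla)[\nabla\eta+D\eta]-(\nabla\eta+D\eta)\operatorname{div}\eta+\tfrac12\big((\operatorname{div}\eta)^2+\eta\cdot\nabla(\operatorname{div}\eta)\big)\mathrm{Id},$$ and $\delta u,\delta v\in H^1_0(\Omega)$ are the weak solutions of $-\Delta(\delta u)=\operatorname{div}((\delta A)\nabla u_\Omega)$ and $-\Delta(\delta v)=\operatorname{div}((\delta A)\nabla v_\Omega)$ in $\Omega$. Then there is a constant $\Lambda\ge0$ such that: 1. for every $\eta\in C^\infty_c(D;\mathbb R^d)$, the first variation exists, is given by the formula above, and $\delta\mathcal F_\Lambda(\Omega)[\eta]=0$; 2. for all $\eta,\xi\in C^\infty_c(D;\mathbb R^d)$ with disjoint supports and $\int_\Omega\operatorname{div}\xi\,dx\ne0$, the second variation along $\eta-\frac{\int_\Omega\operatorname{div}\eta\,dx}{\int_\Omega\operatorname{div}\xi\,dx}\,\xi$ exists, is given by the formula above, and $$\delta^2\mathcal F_\Lambda(\Omega)\left[\eta-\frac{\int_\Omega\operatorname{div}\eta\,dx}{\int_\Omega\operatorname{div}\xi\,dx}\,\xi\right]\ge0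 .$$ -/

import Mathlib

open MeasureTheory Filter Topology Set
open scoped ContDiff

noncomputable section

namespace HeatShape

/-- The Euclidean space `ℝ^d`. -/
abbrev Eu (d : ℕ) : Type := EuclideanSpace ℝ (Fin d)

/-- `f ∈ C^∞_c(U; F)`: smooth, with compact support contained in `U`. -/
structure IsTest {d : ℕ} {F : Type*} [NormedAddCommGroup F] [NormedSpace ℝ F]
    (U : Set (Eu d)) (f : Eu d → F) : Prop where
  smooth : ContDiff ℝ ∞ f
  compact : HasCompactSupport f
  supp : tsupport f ⊆ U

/-- `w ∈ H^1_0(U)` with `∇w = H`, where `H^1_0(U)` is the closure of `C^∞_c(U)` for the norm of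
`H^1(ℝ^d)`: some sequence in `C^∞_c(U)` converges to `w` in `L²(ℝ^d)`, and its gradients converge
to `H` in `L²(ℝ^d; ℝ^d)` (so that `H` is the weak gradient of `w`). -/
structure MemH10 {d : ℕ} (U : Set (Eu d)) (w : Eu d → ℝ) (H : Eu d → Eu d) : Prop where
  memLp : MemLp w 2 volume
  memLp_grad : MemLp H 2 volume
  approx : ∃ ψ : ℕ → Eu d → ℝ, (∀ n, IsTest U (ψ n)) ∧
    Tendsto (fun n => eLpNorm (fun x => w x - ψ n x) 2 volume) atTop (𝓝 0) ∧
    Tendsto (fun n => eLpNorm (fun x => H x - gradient (ψ n) x) 2 volume) atTop (𝓝 0)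

/-- `u : D → ℝ` (only the values on `D` matter), with gradient `G`, is the weak solution in `H^1(D)`
of `Δu = 0` in `Ω`, `u = φ` on `∂D`, `u = 0` on `K = D \ Ω`.
The conditions on `∂D` and on `K` are expressed as usual through a smooth lifting `g` of the
data, `g = φ` on `∂D` and `g = 0` near `K`: the function `u - g`, extended by zero outside `D`,
belongs to `H^1_0(Ω)`. The harmonicity is tested with `C^∞_c(Ω)`. -/
structure IsState {d : ℕ} (D : Set (Eu d)) (φ : Eu d → ℝ) (Ω : Set (Eu d))
    (u : Eu d → ℝ) (G : Eu d → Eu d) : Prop where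
  boundary : ∃ g : Eu d → ℝ, ContDiff ℝ ∞ g ∧ (∀ x ∈ frontier D, g x = φ x) ∧
    (∀ᶠ x in 𝓝ˢ (D \ Ω), g x = 0) ∧
    MemH10 Ω (D.indicator fun x => u x - g x) (D.indicator fun x => G x - gradient g x)
  harmonic : ∀ ψ : Eu d → ℝ, IsTest Ω ψ → ∫ x in Ω, inner ℝ (G x) (gradient ψ x) = 0

open Classical in
/-- The state function `u_Ω` with boundary datum `φ`, together with its gradient `∇u_Ω` (the
solution is unique almost everywhere on `D`; by convention `0` where there is no solution, which
never happens for `D` bounded and open, `Ω ⊆ D` open, `D \ Ω` compact and `φ` smooth). -/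
def state {d : ℕ} (D : Set (Eu d)) (φ : Eu d → ℝ) (Ω : Set (Eu d)) :
    (Eu d → ℝ) × (Eu d → Eu d) :=
  if h : ∃ p : (Eu d → ℝ) × (Eu d → Eu d), IsState D φ Ω p.1 p.2 then h.choose else 0

/-- `∇u_Ω`, for the boundary datum `φ`. -/
def stateGrad {d : ℕ} (D : Set (Eu d)) (φ : Eu d → ℝ) (Ω : Set (Eu d)) : Eu d → Eu d :=
  (state D φ Ω).2

/-- `𝓕(Ω) = ∫_D ∇u_Ω · ∇v_Ω`, where `u_Ω = φ` and `v_Ω = ϕ` on `∂D`. -/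
def heat {d : ℕ} (D : Set (Eu d)) (φ ϕ : Eu d → ℝ) (Ω : Set (Eu d)) : ℝ :=
  ∫ x in D, inner ℝ (stateGrad D φ Ω x) (stateGrad D ϕ Ω x)

/-- `𝓕_Λ(Ω) = 𝓕(Ω) + Λ |Ω|`. -/
def heatPen {d : ℕ} (D : Set (Eu d)) (φ ϕ : Eu d → ℝ) (Λ : ℝ) (Ω : Set (Eu d)) : ℝ :=
  heat D φ ϕ Ω + Λ * volume.real Ω

/-- The competitors: open sets `Ω ⊆ D` with `|Ω| = m` such that `D \ Ω` is a compact subset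
of `D`. -/
structure Admissible {d : ℕ} (D : Set (Eu d)) (m : ℝ) (Ω : Set (Eu d)) : Prop where
  isOpen : IsOpen Ω
  subset : Ω ⊆ D
  measure_eq : volume.real Ω = m
  compact_compl : IsCompact (D \ Ω)

/-- `Ω` minimizes `𝓕` among the competitors. -/
def IsMinimizer {d : ℕ} (D : Set (Eu d)) (φ ϕ : Eu d → ℝ) (m : ℝ) (Ω : Set (Eu d)) : Prop :=
  Admissible D m Ω ∧ ∀ Ω' : Set (Eu d), Admissible D m Ω' → heat D φ ϕ Ω ≤ heat D φ ϕ Ω'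

/-- The divergence, as the trace of the differential. -/
def diverg {d : ℕ} (η : Eu d → Eu d) (x : Eu d) : ℝ :=
  LinearMap.trace ℝ (Eu d) (fderiv ℝ η x : Eu d →ₗ[ℝ] Eu d)

/-- The matrix `Dη`, whose rows are the differentials of the components of `η`. -/
def jac {d : ℕ} (η : Eu d → Eu d) (x : Eu d) : Eu d →L[ℝ] Eu d := fderiv ℝ η x

/-- The matrix `∇η = (Dη)ᵀ`, whose columns are the gradients of the components of `η`. -/
def jacT {d : ℕ} (η : Eu d → Eu d) (x : Eu d) : Eu d →L[ℝ] Eu d :=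
  ContinuousLinearMap.adjoint (fderiv ℝ η x)

/-- `(η · ∇)M`, the derivative of `M` in the direction `η`. -/
def along {d : ℕ} {F : Type*} [NormedAddCommGroup F] [NormedSpace ℝ F]
    (η : Eu d → Eu d) (M : Eu d → F) (x : Eu d) : F :=
  fderiv ℝ M x (η x)

/-- `δA = -Dη - ∇η + (div η) Id`. -/
def deltaA {d : ℕ} (η : Eu d → Eu d) (x : Eu d) : Eu d →L[ℝ] Eu d :=
  -jac η x - jacT η x + diverg η x • ContinuousLinearMap.id ℝ (Eu d)

/-- `δ²A = (Dη)(∇η) + ½ (∇η)² + ½ (Dη)² - ½ (η·∇)[∇η + Dη] - (∇η + Dη) div η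
  + ½ ((div η)² + η·∇(div η)) Id`. -/
def delta2A {d : ℕ} (η : Eu d → Eu d) (x : Eu d) : Eu d →L[ℝ] Eu d :=
  jac η x * jacT η x + (1 / 2 : ℝ) • (jacT η x) ^ 2 + (1 / 2 : ℝ) • (jac η x) ^ 2
    - (1 / 2 : ℝ) • along η (fun y => jacT η y + jac η y) x
    - diverg η x • (jacT η x + jac η x)
    + (((diverg η x) ^ 2 + along η (diverg η) x) / 2) • ContinuousLinearMap.id ℝ (Eu d)

/-- `w ∈ H^1_0(Ω)`, with gradient `H`, is the weak solution of `-Δw = div V` in `Ω`. -/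
structure IsDirichletSol {d : ℕ} (Ω : Set (Eu d)) (V : Eu d → Eu d)
    (w : Eu d → ℝ) (H : Eu d → Eu d) : Prop where
  memH10 : MemH10 Ω w H
  weak : ∀ ψ : Eu d → ℝ, IsTest Ω ψ →
    ∫ x in Ω, inner ℝ (H x) (gradient ψ x) = -∫ x in Ω, inner ℝ (V x) (gradient ψ x)

open Classical in
/-- The solution `w ∈ H^1_0(Ω)` of `-Δw = div V` in `Ω`, with its gradient (it exists and is unique
for `Ω` bounded and open and `V ∈ L²(Ω)`). -/
def dirichletSol {d : ℕ} (Ω : Set (Eu d)) (V : Eu d → Eu d) : (Eu d → ℝ) × (Eu d → Eu d) :=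
  if h : ∃ p : (Eu d → ℝ) × (Eu d → Eu d), IsDirichletSol Ω V p.1 p.2 then h.choose else 0

/-- `∇(δu)`, where `δu ∈ H^1_0(Ω)` solves `-Δ(δu) = div((δA) ∇u_Ω)` in `Ω`. -/
def deltaStateGrad {d : ℕ} (D : Set (Eu d)) (φ : Eu d → ℝ) (Ω : Set (Eu d))
    (η : Eu d → Eu d) : Eu d → Eu d :=
  (dirichletSol Ω fun x => deltaA η x (stateGrad D φ Ω x)).2

/-- `δ|Ω|[η] = ∫_Ω div η`. -/
def deltaVol {d : ℕ} (Ω : Set (Eu d)) (η : Eu d → Eu d) : ℝ :=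
  ∫ x in Ω, diverg η x

/-- `δ²|Ω|[η] = ∫_Ω (div η)² + η·∇(div η)`. -/
def delta2Vol {d : ℕ} (Ω : Set (Eu d)) (η : Eu d → Eu d) : ℝ :=
  ∫ x in Ω, ((diverg η x) ^ 2 + along η (diverg η) x)

/-- `δ𝓕(Ω)[η] = ∫_Ω ∇u_Ω · (δA) ∇v_Ω`. -/
def deltaHeat {d : ℕ} (D : Set (Eu d)) (φ ϕ : Eu d → ℝ) (Ω : Set (Eu d))
    (η : Eu d → Eu d) : ℝ :=
  ∫ x in Ω, inner ℝ (stateGrad D φ Ω x) (deltaA η x (stateGrad D ϕ Ω x))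

/-- `δ²𝓕(Ω)[η] = 2 ∫_Ω ∇u_Ω · (δ²A) ∇v_Ω - ∇(δu) · ∇(δv)`. -/
def delta2Heat {d : ℕ} (D : Set (Eu d)) (φ ϕ : Eu d → ℝ) (Ω : Set (Eu d))
    (η : Eu d → Eu d) : ℝ :=
  2 * ∫ x in Ω, (inner ℝ (stateGrad D φ Ω x) (delta2A η x (stateGrad D ϕ Ω x))
    - inner ℝ (deltaStateGrad D φ Ω η x) (deltaStateGrad D ϕ Ω η x))

/-- `δ𝓕_Λ(Ω)[η] = δ𝓕(Ω)[η] + Λ δ|Ω|[η]`. -/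
def deltaHeatPen {d : ℕ} (D : Set (Eu d)) (φ ϕ : Eu d → ℝ) (Λ : ℝ) (Ω : Set (Eu d))
    (η : Eu d → Eu d) : ℝ :=
  deltaHeat D φ ϕ Ω η + Λ * deltaVol Ω η

/-- `δ²𝓕_Λ(Ω)[η] = δ²𝓕(Ω)[η] + Λ δ²|Ω|[η]`. -/
def delta2HeatPen {d : ℕ} (D : Set (Eu d)) (φ ϕ : Eu d → ℝ) (Λ : ℝ) (Ω : Set (Eu d))
    (η : Eu d → Eu d) : ℝ :=
  delta2Heat D φ ϕ Ω η + Λ * delta2Vol Ω η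

/-- `Φ` is the (smooth, global) flow of the vector field `η`: `Φ_0 = Id`, `∂_t Φ_t = η(Φ_t)`.
A field in `C^∞_c(ℝ^d; ℝ^d)` has exactly one such flow. -/
structure IsFlow {d : ℕ} (η : Eu d → Eu d) (Φ : ℝ → Eu d → Eu d) : Prop where
  smooth : ContDiff ℝ ∞ fun p : ℝ × Eu d => Φ p.1 p.2
  init : ∀ x, Φ 0 x = x
  ode : ∀ t x, HasDerivAt (fun s => Φ s x) (η (Φ t x)) t

/-- `∂/∂t J(Φ_t(Ω))` at `t = 0` exists along the flow `Φ` of `η` and equals `a`. -/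
def HasFirstVariation {d : ℕ} (J : Set (Eu d) → ℝ) (Ω : Set (Eu d)) (η : Eu d → Eu d)
    (a : ℝ) : Prop :=
  ∀ Φ : ℝ → Eu d → Eu d, IsFlow η Φ → HasDerivAt (fun t => J (Φ t '' Ω)) a 0

/-- `∂²/∂t² J(Φ_t(Ω))` at `t = 0` exists along the flow `Φ` of `η` and equals `b`. -/
def HasSecondVariation {d : ℕ} (J : Set (Eu d) → ℝ) (Ω : Set (Eu d)) (η : Eu d → Eu d)
    (b : ℝ) : Prop :=
  ∀ Φ : ℝ → Eu d → Eu d, IsFlow η Φ →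
    (∀ᶠ t in 𝓝 (0 : ℝ), DifferentiableAt ℝ (fun s => J (Φ s '' Ω)) t) ∧
    HasDerivAt (deriv fun s => J (Φ s '' Ω)) b 0

/-- The volume-corrected field `η - (∫_Ω div η / ∫_Ω div ξ) ξ`. -/
def corrected {d : ℕ} (Ω : Set (Eu d)) (η ξ : Eu d → Eu d) : Eu d → Eu d :=
  fun x => η x - ((∫ y in Ω, diverg η y) / (∫ y in Ω, diverg ξ y)) • ξ x

end HeatShape

end

/-! The argument takes place in the Hilbert space L²(ℝ^d; ℝ^d). Let V = `gradSpace Ω` be the closure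
of the gradients of test functions in Ω. If g is a smooth lifting of the boundary datum and a = 1_D
∇g, then ∇u_Ω is the component of a orthogonal to V, whatever the lifting (`stateGrad_ae_eq`), so
that 𝓕(Ω) is the inner product of two such components (`heat_eq_inner`).

Variations. Let T_p be a smooth family of deformations equal to the identity outside a compact L ⊆
D. Liftings that vanish on L are invariant under T_p, and a change of variables turns 𝓕(T_p(Ω)) into
⟨A_p u_p, v_p⟩. Here A_p is multiplication by det(DT_p) DT_p⁻¹ DT_p⁻ᵀ, and u_p ∈ a + V solves A_p
u_p ⊥ V, similarly for v_p (`heat_image`). The space V no longer moves. Since u_p is obtained by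
inverting an operator close to the identity, it is smooth in A_p (`contDiffAt_pertSol`), and A_p is
smooth in p because smooth functions of (p, x) are smooth curves of continuous functions on L
(`contDiff_curryOn`). Along a one-parameter family the derivatives of u_p and v_p lie in V, so the
symmetry of A gives the first derivative ⟨A'u, v⟩ and the second ⟨A''u, v⟩ - 2⟨PA'u, PA'v⟩, with P
the projection on V (`pertEnergy_curve`). At time zero A' and A'' are multiplication by δA and 2 δ²A
(`defect_jets`), and -PA'u is ∇(δu). Only the velocity η and the acceleration (Dη)η at time zero
enter, so the flow may be replaced by its second order expansion.

Optimality. Two fields θ, ξ generate an explicit two-parameter deformation, along which volume and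
𝓕_Λ are smooth functions on a neighbourhood of 0 in the plane. Minimality of Ω says that 0 minimizes
𝓕_Λ on a level set of the volume. The Lagrange rule makes first variations of 𝓕 proportional to
those of the volume, which defines Λ. Once all first variations of 𝓕_Λ vanish, take θ preserving the
volume to first order and ξ not: the level set contains a curve with velocity (1, 0), and at a
critical point the second derivative along a curve depends only on its velocity. Hence the second
variation along θ is nonnegative (`IsMinimizer.delta2HeatPen_nonneg`).

Sign of Λ. States with positive data are subharmonic in D, and the maximum principle makes 𝓕
decrease when the domain grows (`heat_antitone`). As any smaller domain can be enlarged to volume m,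
Ω also minimizes among domains of smaller volume (`IsMinimizer.heat_le`). A field that shrinks the
volume to first order therefore cannot decrease 𝓕 to first order, which gives Λ ≥ 0. -/

namespace HeatShape

/-! ### Gradients and test functions -/

section Gradient

variable {d : ℕ}

theorem gradient_continuous {f : Eu d → ℝ} (hf : ContDiff ℝ ∞ f) : Continuous (gradient f) :=
  (InnerProductSpace.toDual ℝ (Eu d)).symm.continuous.comp (hf.continuous_fderiv (by simp))

theorem norm_gradient_eq (f : Eu d → ℝ) (x : Eu d) : ‖gradient f x‖ = ‖fderiv ℝ f x‖ := by
  simp [gradient]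

theorem gradient_eq_zero_of_notMem {f : Eu d → ℝ} {x : Eu d} (hx : x ∉ tsupport f) :
    gradient f x = 0 := by
  have : fderiv ℝ f x = 0 := by
    by_contra h
    exact hx (tsupport_fderiv_subset ℝ (subset_tsupport _ h))
  simp [gradient, this]

theorem gradient_eventuallyEq {f g : Eu d → ℝ} {x : Eu d} (h : f =ᶠ[𝓝 x] g) :
    gradient f x = gradient g x := by
  simp [gradient, h.fderiv_eq]

theorem gradient_add' {f g : Eu d → ℝ} {x : Eu d} (hf : DifferentiableAt ℝ f x)
    (hg : DifferentiableAt ℝ g x) :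
    gradient (fun y => f y + g y) x = gradient f x + gradient g x := by
  have : fderiv ℝ (fun y => f y + g y) x = fderiv ℝ f x + fderiv ℝ g x := fderiv_add hf hg
  simp [gradient, this]

theorem gradient_sub' {f g : Eu d → ℝ} {x : Eu d} (hf : DifferentiableAt ℝ f x)
    (hg : DifferentiableAt ℝ g x) :
    gradient (fun y => f y - g y) x = gradient f x - gradient g x := by
  have : fderiv ℝ (fun y => f y - g y) x = fderiv ℝ f x - fderiv ℝ g x := fderiv_sub hf hg
  simp [gradient, this]

theorem gradient_const_mul' {f : Eu d → ℝ} {x : Eu d} (c : ℝ) (hf : DifferentiableAt ℝ f x) :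
    gradient (fun y => c * f y) x = c • gradient f x := by
  have : fderiv ℝ (fun y => c * f y) x = c • fderiv ℝ f x := by
    simpa using fderiv_const_mul hf c
  simp [gradient, this]

theorem gradient_real_comp {f : Eu d → ℝ} {x : Eu d} {θ : ℝ → ℝ} (hθ : DifferentiableAt ℝ θ (f x))
    (hf : DifferentiableAt ℝ f x) :
    gradient (fun y => θ (f y)) x = deriv θ (f x) • gradient f x := by
  have : fderiv ℝ (fun y => θ (f y)) x = deriv θ (f x) • fderiv ℝ f x := by
    have := (hθ.hasDerivAt.comp_hasFDerivAt x hf.hasFDerivAt).fderiv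
    simpa [Function.comp_def] using this
  simp [gradient, this]

end Gradient

namespace IsTest

variable {d : ℕ} {F : Type*} [NormedAddCommGroup F] [NormedSpace ℝ F] {U U' : Set (Eu d)}

theorem mono {f : Eu d → F} (hf : IsTest U f) (h : U ⊆ U') : IsTest U' f :=
  ⟨hf.smooth, hf.compact, hf.supp.trans h⟩

theorem of_eq_zero {f : Eu d → F} (hf : ContDiff ℝ ∞ f) {K : Set (Eu d)} (hK : IsCompact K)
    (hKU : K ⊆ U) (h : ∀ x ∉ K, f x = 0) : IsTest U f := by
  have hs : tsupport f ⊆ K :=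
    closure_minimal (fun x hx => by by_contra h'; exact hx (h x h')) hK.isClosed
  exact ⟨hf, HasCompactSupport.intro hK h, hs.trans hKU⟩

theorem zero : IsTest U (fun _ : Eu d => (0 : F)) :=
  of_eq_zero contDiff_const isCompact_empty (empty_subset _) (fun _ _ => rfl)

theorem comp_zero {G : Type*} [NormedAddCommGroup G] [NormedSpace ℝ G] {f : Eu d → F}
    (hf : IsTest U f) {g : F → G} (hg : ContDiff ℝ ∞ g) (h0 : g 0 = 0) :
    IsTest U (fun x => g (f x)) :=
  of_eq_zero (hg.comp hf.smooth) hf.compact.isCompact hf.supp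
    (fun x hx => by simp [image_eq_zero_of_notMem_tsupport hx, h0])

theorem add {f g : Eu d → F} (hf : IsTest U f) (hg : IsTest U g) :
    IsTest U (fun x => f x + g x) :=
  of_eq_zero (hf.smooth.add hg.smooth) (hf.compact.isCompact.union hg.compact.isCompact)
    (union_subset hf.supp hg.supp) (fun x hx => by
      rw [mem_union, not_or] at hx
      simp [image_eq_zero_of_notMem_tsupport hx.1, image_eq_zero_of_notMem_tsupport hx.2])

theorem const_smul {f : Eu d → F} (hf : IsTest U f) (c : ℝ) : IsTest U (fun x => c • f x) :=
  hf.comp_zero (contDiff_const_smul c) (by simp)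

theorem sub {f g : Eu d → F} (hf : IsTest U f) (hg : IsTest U g) :
    IsTest U (fun x => f x - g x) := by
  simpa [sub_eq_add_neg] using hf.add (hg.const_smul (-1))

theorem memLp {f : Eu d → F} (hf : IsTest U f) : MemLp f 2 volume :=
  hf.smooth.continuous.memLp_of_hasCompactSupport hf.compact

theorem hasCompactSupport_gradient {f : Eu d → ℝ} (hf : IsTest U f) :
    HasCompactSupport (gradient f) :=
  HasCompactSupport.intro hf.compact.isCompact fun _ hx => gradient_eq_zero_of_notMem hx

theorem memLp_gradient {f : Eu d → ℝ} (hf : IsTest U f) : MemLp (gradient f) 2 volume :=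
  (gradient_continuous hf.smooth).memLp_of_hasCompactSupport hf.hasCompactSupport_gradient

theorem differentiable {f : Eu d → F} (hf : IsTest U f) : Differentiable ℝ f :=
  hf.smooth.differentiable (by simp)

end IsTest

/-! ### The closed space of gradients of H¹₀ functions in L² -/

section L2

variable {d : ℕ}

/-- The space `L²(ℝ^d; ℝ^d)`. -/
abbrev L2 (d : ℕ) : Type := Lp (Eu d) 2 (volume : Measure (Eu d))

theorem inner_toLp {F : Type*} [NormedAddCommGroup F] [InnerProductSpace ℝ F] {f g : Eu d → F}
    (hf : MemLp f 2 volume) (hg : MemLp g 2 volume) :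
    inner ℝ (hf.toLp f) (hg.toLp g) = ∫ x, inner ℝ (f x) (g x) := by
  rw [L2.inner_def]
  refine integral_congr_ae ?_
  filter_upwards [hf.coeFn_toLp, hg.coeFn_toLp] with x h1 h2
  rw [h1, h2]

theorem inner_L2_eq {f g : L2 d} {f' g' : Eu d → Eu d} (hf : f =ᵐ[volume] f')
    (hg : g =ᵐ[volume] g') : inner ℝ f g = ∫ x, inner ℝ (f' x) (g' x) := by
  rw [L2.inner_def]
  refine integral_congr_ae ?_
  filter_upwards [hf, hg] with x h1 h2
  rw [h1, h2]

/-- The closure in `L²` of the gradients of test functions in `U`, that is, the gradients of the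
functions of `H^1_0(U)` when `U` is bounded. -/
noncomputable def gradSpace (U : Set (Eu d)) : Submodule ℝ (L2 d) :=
  Submodule.topologicalClosure
    { carrier := {f | ∃ ψ : Eu d → ℝ, IsTest U ψ ∧ f =ᵐ[volume] gradient ψ}
      zero_mem' := ⟨fun _ => 0, IsTest.zero, by
        filter_upwards [Lp.coeFn_zero (Eu d) 2 (volume : Measure (Eu d))] with x hx
        rw [hx]; simp [gradient]⟩
      add_mem' := by
        rintro f g ⟨ψ, hψ, hf⟩ ⟨χ, hχ, hg⟩
        refine ⟨_, hψ.add hχ, ?_⟩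
        filter_upwards [Lp.coeFn_add f g, hf, hg] with x hx h1 h2
        rw [hx, Pi.add_apply, h1, h2, gradient_add' (hψ.differentiable x) (hχ.differentiable x)]
      smul_mem' := by
        rintro c f ⟨ψ, hψ, hf⟩
        refine ⟨_, hψ.const_smul c, ?_⟩
        filter_upwards [Lp.coeFn_smul c f, hf] with x hx h1
        rw [hx, Pi.smul_apply, h1]
        exact (gradient_const_mul' c (hψ.differentiable x)).symm }

instance (U : Set (Eu d)) : CompleteSpace (gradSpace U) :=
  (Submodule.isClosed_topologicalClosure _).completeSpace_coe

theorem isClosed_gradSpace (U : Set (Eu d)) : IsClosed (gradSpace U : Set (L2 d)) :=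
  Submodule.isClosed_topologicalClosure _

/-- The gradient of a test function, as an element of `L²`. -/
noncomputable def testGrad {U : Set (Eu d)} {ψ : Eu d → ℝ} (hψ : IsTest U ψ) : L2 d :=
  hψ.memLp_gradient.toLp (gradient ψ)

theorem coeFn_testGrad {U : Set (Eu d)} {ψ : Eu d → ℝ} (hψ : IsTest U ψ) :
    testGrad hψ =ᵐ[volume] gradient ψ := MemLp.coeFn_toLp _

theorem testGrad_mem {U : Set (Eu d)} {ψ : Eu d → ℝ} (hψ : IsTest U ψ) :
    testGrad hψ ∈ gradSpace U :=
  Submodule.le_topologicalClosure _ ⟨ψ, hψ, coeFn_testGrad hψ⟩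

theorem mem_gradSpace_iff_seq {U : Set (Eu d)} {f : L2 d} :
    f ∈ gradSpace U ↔ ∃ ψ : ℕ → Eu d → ℝ, ∃ hψ : ∀ n, IsTest U (ψ n),
      Tendsto (fun n => testGrad (hψ n)) atTop (𝓝 f) := by
  constructor
  · intro hf
    have hf' : f ∈ closure {f : L2 d | ∃ ψ : Eu d → ℝ, IsTest U ψ ∧ f =ᵐ[volume] gradient ψ} := hf
    obtain ⟨s, hs, hlim⟩ := mem_closure_iff_seq_limit.1 hf'
    choose ψ hψ hsψ using hs
    refine ⟨ψ, hψ, ?_⟩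
    have : (fun n => testGrad (hψ n)) = s := by
      funext n
      exact Lp.ext ((coeFn_testGrad (hψ n)).trans (hsψ n).symm)
    rwa [this]
  · rintro ⟨ψ, hψ, hlim⟩
    exact (isClosed_gradSpace U).mem_of_tendsto hlim
      (Eventually.of_forall fun n => testGrad_mem (hψ n))

theorem gradSpace_mono {U U' : Set (Eu d)} (h : U ⊆ U') : gradSpace U ≤ gradSpace U' := by
  intro f hf
  obtain ⟨ψ, hψ, hlim⟩ := mem_gradSpace_iff_seq.1 hf
  exact mem_gradSpace_iff_seq.2 ⟨ψ, fun n => (hψ n).mono h, hlim⟩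

/-- An element of `L²` orthogonal to the gradients of the test functions is orthogonal to their
closure. -/
theorem inner_eq_zero_of_test {U : Set (Eu d)} {f : L2 d}
    (h : ∀ ψ : Eu d → ℝ, ∀ hψ : IsTest U ψ, inner ℝ f (testGrad hψ) = 0) {g : L2 d}
    (hg : g ∈ gradSpace U) : inner ℝ f g = 0 := by
  obtain ⟨ψ, hψ, hlim⟩ := mem_gradSpace_iff_seq.1 hg
  have h1 : Tendsto (fun n => inner ℝ f (testGrad (hψ n))) atTop (𝓝 (inner ℝ f g)) :=
    tendsto_const_nhds.inner hlim
  simp only [h] at h1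
  exact (tendsto_nhds_unique tendsto_const_nhds h1).symm

theorem testGrad_ae_zero {U : Set (Eu d)} {ψ : Eu d → ℝ} (hψ : IsTest U ψ) :
    ∀ᵐ x, x ∉ U → testGrad hψ x = 0 := by
  filter_upwards [coeFn_testGrad hψ] with x hx hxU
  rw [hx, gradient_eq_zero_of_notMem fun h => hxU (hψ.supp h)]

/-- Elements of `L²` that vanish outside a set form a closed set. -/
theorem ae_zero_of_tendsto {U : Set (Eu d)} {f : ℕ → L2 d} {g : L2 d}
    (h : ∀ n, ∀ᵐ x, x ∉ U → f n x = 0) (hlim : Tendsto f atTop (𝓝 g)) :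
    ∀ᵐ x, x ∉ U → g x = 0 := by
  have h1 := tendstoInMeasure_of_tendsto_Lp hlim
  obtain ⟨ns, -, hns⟩ := h1.exists_seq_tendsto_ae
  filter_upwards [hns, ae_all_iff.2 h] with x hx h0 hxU
  have : Tendsto (fun _ : ℕ => (0 : Eu d)) atTop (𝓝 (g x)) := by
    refine hx.congr fun n => ?_
    exact h0 _ hxU
  exact (tendsto_nhds_unique tendsto_const_nhds this).symm

theorem ae_zero_of_mem_gradSpace {U : Set (Eu d)} {f : L2 d} (hf : f ∈ gradSpace U) :
    ∀ᵐ x, x ∉ U → f x = 0 := by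
  obtain ⟨ψ, hψ, hlim⟩ := mem_gradSpace_iff_seq.1 hf
  exact ae_zero_of_tendsto (fun n => testGrad_ae_zero (hψ n)) hlim

end L2

/-! ### Poincaré inequality and the passage from gradients to functions -/

section Poincare

variable {d : ℕ}

/-- Take a linear form l with ∂_e l = 1 for a unit vector e. Integrating by parts gives ∫ ψ² = -∫ 2
l ψ ∂_eψ, and |l| ≤ R on the support of ψ; Young's inequality bounds this by ½ ∫ ψ² + 2R² ∫ |∇ψ|²,
and half of the left side absorbs the first term. -/
theorem integral_sq_le_of_test {R : ℝ} (hd : 0 < d) {U : Set (Eu d)}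
    (hU : U ⊆ Metric.closedBall 0 R) {ψ : Eu d → ℝ} (hψ : IsTest U ψ) :
    ∫ x, ψ x ^ 2 ≤ 4 * R ^ 2 * ∫ x, ‖gradient ψ x‖ ^ 2 := by
  obtain ⟨e, he⟩ : ∃ e : Eu d, ‖e‖ = 1 := ⟨EuclideanSpace.single ⟨0, hd⟩ 1, by simp⟩
  obtain ⟨l, hle, hlb⟩ : ∃ l : Eu d →L[ℝ] ℝ, l e = 1 ∧ ∀ x, |l x| ≤ ‖x‖ := by
    refine ⟨innerSL ℝ e, by simp [he], fun x => ?_⟩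
    simpa [he] using abs_real_inner_le_norm e x
  have hs := hψ.smooth
  have hsq : ContDiff ℝ ∞ (fun x => ψ x * ψ x) := hs.mul hs
  have hcs : HasCompactSupport (fun x => ψ x * ψ x) := hψ.compact.mul_left
  have hfd : ∀ x, fderiv ℝ (fun x => ψ x * ψ x) x e = 2 * ψ x * fderiv ℝ ψ x e := by
    intro x
    have := fderiv_mul (hψ.differentiable x) (hψ.differentiable x)
    have h2 : fderiv ℝ (fun x => ψ x * ψ x) x = ψ x • fderiv ℝ ψ x + ψ x • fderiv ℝ ψ x := this
    rw [h2]; simp; ring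
  have hcd : Continuous fun x => fderiv ℝ ψ x e :=
    (hs.continuous_fderiv (by simp)).clm_apply continuous_const
  have hpsi2 : Integrable (fun x => ψ x * ψ x) :=
    hsq.continuous.integrable_of_hasCompactSupport hcs
  have hcg : Integrable (fun x => ‖gradient ψ x‖ ^ 2) := by
    refine ((gradient_continuous hs).norm.pow 2).integrable_of_hasCompactSupport ?_
    refine HasCompactSupport.intro hψ.compact.isCompact fun x hx => ?_
    simp [gradient_eq_zero_of_notMem hx]
  have hl : ∀ x, fderiv ℝ (fun y => l y) x e = 1 := by
    intro x; rw [ContinuousLinearMap.fderiv]; exact hle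
  have key := integral_mul_fderiv_eq_neg_fderiv_mul_of_integrable (μ := (volume : Measure (Eu d)))
    (f := fun x => l x) (g := fun x => ψ x * ψ x) (v := e) ?_ ?_ ?_
    (fun x _ => l.differentiableAt) (fun x _ => hsq.differentiable (by simp) x)
  · simp only [hl, one_mul, hfd] at key
    have h1 : ∫ x, ψ x ^ 2 = ∫ x, -(l x * (2 * ψ x * fderiv ℝ ψ x e)) := by
      rw [integral_neg, key, neg_neg]
      simp [sq]
    have h2 : ∫ x, -(l x * (2 * ψ x * fderiv ℝ ψ x e))
        ≤ ∫ x, ((1 / 2) * (ψ x * ψ x) + 2 * R ^ 2 * ‖gradient ψ x‖ ^ 2) := by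
      refine integral_mono ?_ ?_ ?_
      · refine Continuous.integrable_of_hasCompactSupport ?_ ?_
        · exact (l.continuous.mul ((continuous_const.mul hs.continuous).mul hcd)).neg
        · refine HasCompactSupport.intro hψ.compact.isCompact fun x hx => ?_
          simp [image_eq_zero_of_notMem_tsupport hx]
      · exact (hpsi2.const_mul _).add (hcg.const_mul _)
      · intro x
        simp only
        by_cases hx : x ∈ tsupport ψ
        · have hx1 : ‖x‖ ≤ R := by simpa using hU (hψ.supp hx)
          have hlx : |l x| ≤ R := (hlb x).trans hx1
          have hg : |fderiv ℝ ψ x e| ≤ ‖gradient ψ x‖ := by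
            rw [norm_gradient_eq]
            have := (fderiv ℝ ψ x).le_opNorm e
            rwa [he, mul_one] at this
          have h3 : (l x * fderiv ℝ ψ x e) ^ 2 ≤ (R * ‖gradient ψ x‖) ^ 2 := by
            rw [sq_le_sq, abs_mul, abs_of_nonneg (mul_nonneg ((norm_nonneg x).trans hx1)
              (norm_nonneg _))]
            exact mul_le_mul hlx hg (abs_nonneg _) ((norm_nonneg x).trans hx1)
          nlinarith [sq_nonneg (ψ x + 2 * (l x * fderiv ℝ ψ x e))]
        · simp [image_eq_zero_of_notMem_tsupport hx]
          positivity
    rw [integral_add (hpsi2.const_mul _) (hcg.const_mul _), integral_const_mul,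
      integral_const_mul] at h2
    have h3 : ∫ x, ψ x * ψ x = ∫ x, ψ x ^ 2 := by simp [sq]
    rw [h3, ← h1] at h2
    linarith
  · simpa only [hl, one_mul] using hpsi2
  · simp only [hfd]
    refine Continuous.integrable_of_hasCompactSupport ?_ ?_
    · exact l.continuous.mul ((continuous_const.mul hs.continuous).mul hcd)
    · refine HasCompactSupport.intro hψ.compact.isCompact fun x hx => ?_
      simp [image_eq_zero_of_notMem_tsupport hx]
  · exact (l.continuous.mul hsq.continuous).integrable_of_hasCompactSupport hcs.mul_left

theorem norm_test_le {R : ℝ} (hd : 0 < d) (hR : 0 ≤ R) {U : Set (Eu d)}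
    (hU : U ⊆ Metric.closedBall 0 R) {ψ : Eu d → ℝ} (hψ : IsTest U ψ) :
    ‖hψ.memLp.toLp ψ‖ ≤ 2 * R * ‖testGrad hψ‖ := by
  have h := integral_sq_le_of_test hd hU hψ
  have h1 : ‖hψ.memLp.toLp ψ‖ ^ 2 = ∫ x, ψ x ^ 2 := by
    rw [← real_inner_self_eq_norm_sq, inner_toLp]
    simp
  have h2 : ‖testGrad hψ‖ ^ 2 = ∫ x, ‖gradient ψ x‖ ^ 2 := by
    rw [← real_inner_self_eq_norm_sq, testGrad, inner_toLp]
    simp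
  rw [← h1, ← h2] at h
  refine (sq_le_sq₀ (norm_nonneg _) (by positivity)).1 ?_
  calc _ ≤ _ := h
    _ = _ := by ring

/-- The elements of `gradSpace U` are the gradients of the functions of `H^1_0(U)`. -/
theorem exists_memH10 (hd : 0 < d) {U : Set (Eu d)} (hU : Bornology.IsBounded U) {f : L2 d}
    (hf : f ∈ gradSpace U) : ∃ w : Eu d → ℝ, MemH10 U w f := by
  obtain ⟨R, hR0, hR⟩ : ∃ R : ℝ, 0 ≤ R ∧ U ⊆ Metric.closedBall 0 R := by
    obtain ⟨R, hR⟩ := hU.subset_closedBall 0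
    exact ⟨max R 0, le_max_right _ _, hR.trans (Metric.closedBall_subset_closedBall (le_max_left _ _))⟩
  obtain ⟨ψ, hψ, hlim⟩ := mem_gradSpace_iff_seq.1 hf
  have hsub : ∀ n m, (hψ n).memLp.toLp (ψ n) - (hψ m).memLp.toLp (ψ m)
      = ((hψ n).sub (hψ m)).memLp.toLp _ := fun n m => rfl
  have hsub' : ∀ n m, testGrad (hψ n) - testGrad (hψ m) = testGrad ((hψ n).sub (hψ m)) := by
    intro n m
    apply Lp.ext
    filter_upwards [coeFn_testGrad ((hψ n).sub (hψ m)), coeFn_testGrad (hψ n),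
      coeFn_testGrad (hψ m), Lp.coeFn_sub (testGrad (hψ n)) (testGrad (hψ m))] with x h1 h2 h3 h4
    rw [h1, h4, Pi.sub_apply, h2, h3,
      gradient_sub' ((hψ n).differentiable x) ((hψ m).differentiable x)]
  -- Poincaré applied to the differences transfers the Cauchy property from the gradients to the
  -- functions; the limit is the required function.
  have hc : CauchySeq fun n => (hψ n).memLp.toLp (ψ n) := by
    rw [Metric.cauchySeq_iff']
    intro ε hε
    obtain ⟨N, hN⟩ := Metric.cauchySeq_iff'.1 hlim.cauchySeq (ε / (2 * R + 1)) (by positivity)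
    refine ⟨N, fun n hn => ?_⟩
    rw [dist_eq_norm, hsub]
    have h1 := hN n hn
    rw [dist_eq_norm, hsub', lt_div_iff₀ (by positivity)] at h1
    have h2 := norm_test_le hd hR0 hR ((hψ n).sub (hψ N))
    nlinarith [norm_nonneg (testGrad ((hψ n).sub (hψ N)))]
  obtain ⟨w, hw⟩ := cauchySeq_tendsto_of_complete hc
  refine ⟨w, ⟨Lp.memLp w, Lp.memLp f, ψ, hψ, ?_, ?_⟩⟩
  · have := (Lp.tendsto_Lp_iff_tendsto_eLpNorm' _ _).1 hw
    refine this.congr fun n => ?_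
    rw [eLpNorm_sub_comm]
    refine eLpNorm_congr_ae ?_
    filter_upwards [(hψ n).memLp.coeFn_toLp] with x hx
    simp [hx]
  · have := (Lp.tendsto_Lp_iff_tendsto_eLpNorm' _ _).1 hlim
    refine this.congr fun n => ?_
    rw [eLpNorm_sub_comm]
    refine eLpNorm_congr_ae ?_
    filter_upwards [coeFn_testGrad (hψ n)] with x hx
    simp [hx]

theorem MemH10.toLp_mem {U : Set (Eu d)} {w : Eu d → ℝ} {H : Eu d → Eu d} (h : MemH10 U w H) :
    h.memLp_grad.toLp H ∈ gradSpace U := by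
  obtain ⟨ψ, hψ, -, hlim⟩ := h.approx
  refine mem_gradSpace_iff_seq.2 ⟨ψ, hψ, ?_⟩
  refine (Lp.tendsto_Lp_iff_tendsto_eLpNorm'' _ _ _ _).2 ?_
  refine hlim.congr fun n => ?_
  rw [← eLpNorm_sub_comm]
  rfl

theorem MemH10.congr {U : Set (Eu d)} {w w' : Eu d → ℝ} {H H' : Eu d → Eu d} (h : MemH10 U w H)
    (hw : w =ᵐ[volume] w') (hH : H =ᵐ[volume] H') : MemH10 U w' H' := by
  obtain ⟨ψ, hψ, h1, h2⟩ := h.approx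
  refine ⟨h.memLp.ae_eq hw, h.memLp_grad.ae_eq hH, ψ, hψ, ?_, ?_⟩
  · refine h1.congr fun n => eLpNorm_congr_ae ?_
    filter_upwards [hw] with x hx
    rw [hx]
  · refine h2.congr fun n => eLpNorm_congr_ae ?_
    filter_upwards [hH] with x hx
    rw [hx]

end Poincare

end HeatShape

namespace HeatShape

/-! ### Cutoffs, liftings of the boundary data and smooth truncations -/

section Cutoff

variable {d : ℕ}

theorem exists_cutoff {D K : Set (Eu d)} (hDo : IsOpen D) (hDb : Bornology.IsBounded D)
    (hK : IsCompact K) (hKD : K ⊆ D) :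
    ∃ χ : Eu d → ℝ, IsTest D χ ∧ (∀ᶠ x in 𝓝ˢ K, χ x = 1) ∧ ∀ x, χ x ∈ Icc (0 : ℝ) 1 := by
  obtain ⟨f, h0, h1, h2⟩ := exists_contMDiffMap_zero_one_nhds_of_isClosed (n := ⊤)
    (modelWithCornersSelf ℝ (Eu d)) hDo.isClosed_compl hK.isClosed
    (disjoint_compl_left_iff_subset.2 hKD)
  have hsub : tsupport f ⊆ D := by
    intro x hx
    by_contra hxD
    have : ∀ᶠ y in 𝓝 x, f y = 0 := h0.filter_mono (nhds_le_nhdsSet hxD)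
    exact (notMem_tsupport_iff_eventuallyEq.2 this) hx
  refine ⟨f, ⟨?_, ?_, hsub⟩, h1, h2⟩
  · exact f.contMDiff.contDiff
  · exact Metric.isCompact_of_isClosed_isBounded (isClosed_tsupport _) (hDb.subset hsub)

/-- A smooth function vanishing near a compact part of `D` and agreeing with `φ` near the
complement of `D`. -/
theorem exists_lifting {D K : Set (Eu d)} (hDo : IsOpen D) (hDb : Bornology.IsBounded D)
    (hK : IsCompact K) (hKD : K ⊆ D) {φ : Eu d → ℝ} (hφ : ContDiff ℝ ∞ φ) :
    ∃ g : Eu d → ℝ, ContDiff ℝ ∞ g ∧ (∃ C, IsCompact C ∧ C ⊆ D ∧ ∀ x ∉ C, g x = φ x) ∧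
      (∀ᶠ x in 𝓝ˢ K, g x = 0) ∧ ∃ χ : Eu d → ℝ, (∀ x, χ x ∈ Icc (0 : ℝ) 1) ∧
        ∀ x, g x = φ x * χ x := by
  obtain ⟨χ, hχ, h1, h2⟩ := exists_cutoff hDo hDb hK hKD
  refine ⟨fun x => φ x * (1 - χ x), hφ.mul (contDiff_const.sub hχ.smooth),
    ⟨tsupport χ, hχ.compact, hχ.supp, fun x hx => ?_⟩, ?_, fun x => 1 - χ x, fun x => ?_,
    fun x => rfl⟩
  · simp [image_eq_zero_of_notMem_tsupport hx]
  · filter_upwards [h1] with x hx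
    simp [hx]
  · obtain ⟨ha, hb⟩ := h2 x
    exact ⟨by simp only; linarith, by simp only; linarith⟩

/-- On its zero set, h is approximated by the zero linear map with error constant 0, which forces
the derivative to vanish at almost every point of that set. Multiplication by a unit vector e turns
h into a self-map of the space, the setting of `ApproximatesLinearOn.norm_fderiv_sub_le`. -/
theorem ae_gradient_eq_zero {h : Eu d → ℝ} (hh : ContDiff ℝ ∞ h) :
    ∀ᵐ x, h x = 0 → gradient h x = 0 := by
  rcases Nat.eq_zero_or_pos d with rfl | hd
  · exact Eventually.of_forall fun x _ => Subsingleton.elim _ _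
  obtain ⟨e, he⟩ : ∃ e : Eu d, ‖e‖ = 1 := ⟨EuclideanSpace.single ⟨0, hd⟩ 1, by simp⟩
  have hms : MeasurableSet {x | h x = 0} := (isClosed_eq hh.continuous continuous_const).measurableSet
  have ha : ApproximatesLinearOn (fun x => h x • e) (0 : Eu d →L[ℝ] Eu d) {x | h x = 0} 0 := by
    intro x hx y hy
    rw [mem_ofPred_eq] at hx hy
    simp [hx, hy]
  have hf : ∀ x ∈ {x | h x = 0}, HasFDerivWithinAt (fun x => h x • e)
      ((fderiv ℝ h x).smulRight e) {x | h x = 0} x := fun x _ =>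
    (((hh.differentiable (by simp)) x).hasFDerivAt.smul_const e).hasFDerivWithinAt
  have := ha.norm_fderiv_sub_le volume hms _ hf
  rw [ae_restrict_iff' hms] at this
  filter_upwards [this] with x hx h0
  have h1 := hx h0
  rw [sub_zero, nonpos_iff_eq_zero, nnnorm_eq_zero] at h1
  have h2 : fderiv ℝ h x = 0 := by
    ext v
    have h3 := congrArg (fun A : Eu d →L[ℝ] Eu d => ‖A v‖) h1
    simpa [norm_smul, he] using h3
  simp [gradient, h2]

end Cutoff

section Truncation

/-- A smooth approximation of the positive part. -/
noncomputable def softPos (κ s : ℝ) : ℝ := ∫ x in (0 : ℝ)..s, Real.smoothTransition (x / κ)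

theorem softPos_hasDerivAt (κ s : ℝ) :
    HasDerivAt (softPos κ) (Real.smoothTransition (s / κ)) s := by
  have hc : Continuous fun x : ℝ => Real.smoothTransition (x / κ) :=
    Real.smoothTransition.continuous.comp (continuous_id.div_const κ)
  exact intervalIntegral.integral_hasDerivAt_right (hc.intervalIntegrable _ _)
    (hc.stronglyMeasurableAtFilter _ _) hc.continuousAt

theorem softPos_contDiff (κ : ℝ) : ContDiff ℝ ∞ (softPos κ) := by
  refine contDiff_infty_iff_deriv.2 ⟨fun s => (softPos_hasDerivAt κ s).differentiableAt, ?_⟩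
  have : deriv (softPos κ) = fun s => Real.smoothTransition (s / κ) :=
    funext fun s => (softPos_hasDerivAt κ s).deriv
  rw [this]
  exact Real.smoothTransition.contDiff.comp (contDiff_id.div_const κ)

theorem softPos_of_nonpos {κ s : ℝ} (hκ : 0 < κ) (hs : s ≤ 0) : softPos κ s = 0 := by
  rw [softPos, intervalIntegral.integral_symm, neg_eq_zero, intervalIntegral.integral_of_le hs]
  refine setIntegral_eq_zero_of_forall_eq_zero fun x hx => ?_
  exact Real.smoothTransition.zero_of_nonpos (div_nonpos_of_nonpos_of_nonneg hx.2 hκ.le)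

theorem softPos_nonneg {κ s : ℝ} (hκ : 0 < κ) : 0 ≤ softPos κ s := by
  rcases le_total s 0 with hs | hs
  · rw [softPos_of_nonpos hκ hs]
  · exact intervalIntegral.integral_nonneg hs fun x _ => Real.smoothTransition.nonneg _

/-- The slope is one beyond κ, so the truncation acts there as a shift by the constant `κ - softPos
κ κ`. This constant lies between 0 and κ, hence is negligible as κ tends to 0. -/
theorem softPos_of_ge {κ s : ℝ} (hκ : 0 < κ) (hs : κ ≤ s) :
    softPos κ s = softPos κ κ - κ + s := by
  have hc : Continuous fun x : ℝ => Real.smoothTransition (x / κ) :=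
    Real.smoothTransition.continuous.comp (continuous_id.div_const κ)
  have h := intervalIntegral.integral_add_adjacent_intervals (hc.intervalIntegrable (μ := volume) 0 κ)
    (hc.intervalIntegrable κ s)
  have h1 : ∫ x in κ..s, Real.smoothTransition (x / κ) = ∫ x in κ..s, (1 : ℝ) := by
    refine intervalIntegral.integral_congr fun x hx => ?_
    rw [uIcc_of_le hs] at hx
    exact Real.smoothTransition.one_of_one_le ((one_le_div hκ).2 hx.1)
  rw [h1, intervalIntegral.integral_const, smul_eq_mul, mul_one] at h
  rw [softPos, ← h, softPos]
  ring

theorem softPos_self_mem {κ : ℝ} (hκ : 0 < κ) : softPos κ κ ∈ Icc 0 κ := by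
  refine ⟨softPos_nonneg hκ, ?_⟩
  have hc : Continuous fun x : ℝ => Real.smoothTransition (x / κ) :=
    Real.smoothTransition.continuous.comp (continuous_id.div_const κ)
  have h : softPos κ κ ≤ ∫ x in (0 : ℝ)..κ, (1 : ℝ) :=
    intervalIntegral.integral_mono hκ.le (hc.intervalIntegrable _ _)
      (continuous_const.intervalIntegrable _ _) fun x => Real.smoothTransition.le_one _
  simpa using h

/-- Multiplying by bounded factors that tend to zero gives convergence to zero in `L²`. -/
theorem tendsto_toLp_smul_zero {d : ℕ} {G : Eu d → Eu d} (hG : MemLp G 2 volume)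
    {c : ℕ → Eu d → ℝ} (hc1 : ∀ n x, |c n x| ≤ 1)
    (hc : ∀ n, MemLp (fun x => c n x • G x) 2 volume)
    (hlim : ∀ᵐ x, G x ≠ 0 → Tendsto (fun n => c n x) atTop (𝓝 0)) :
    Tendsto (fun n => (hc n).toLp _) atTop (𝓝 0) := by
  rw [tendsto_zero_iff_norm_tendsto_zero]
  have h1 : Tendsto (fun n => ‖(hc n).toLp _‖ ^ 2) atTop (𝓝 0) := by
    have h2 : ∀ n, ‖(hc n).toLp _‖ ^ 2 = ∫ x, ‖c n x • G x‖ ^ 2 := by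
      intro n
      rw [← real_inner_self_eq_norm_sq, inner_toLp]
      simp
    simp only [h2]
    have h3 : (0 : ℝ) = ∫ _ : Eu d, (0 : ℝ) := by simp
    rw [h3]
    refine tendsto_integral_of_dominated_convergence (fun x => ‖G x‖ ^ 2)
      (fun n => ((hc n).1.norm.pow 2)) ?_ ?_ ?_
    · exact (memLp_two_iff_integrable_sq_norm hG.1).1 hG
    · intro n
      refine Eventually.of_forall fun x => ?_
      rw [norm_pow, norm_norm, norm_smul, Real.norm_eq_abs]
      gcongr
      exact mul_le_of_le_one_left (norm_nonneg _) (hc1 n x)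
    · filter_upwards [hlim] with x hx
      by_cases h0 : G x = 0
      · simp [h0]
      · have := ((hx h0).smul_const (G x)).norm.pow 2
        simpa using this
  have h4 := h1.sqrt
  simpa using h4

end Truncation

/-! ### Smooth functions with zero boundary values belong to H¹₀ -/

section Boundary

variable {d : ℕ} {D : Set (Eu d)}

theorem memLp_indicator_continuous (hDo : IsOpen D) (hDb : Bornology.IsBounded D)
    {f : Eu d → Eu d} (hf : Continuous f) : MemLp (D.indicator f) 2 volume := by
  have hc : IsCompact (closure D) := hDb.isCompact_closure
  obtain ⟨C, hC⟩ := hc.exists_bound_of_continuousOn hf.continuousOn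
  refine HasCompactSupport.memLp_of_bound (HasCompactSupport.intro hc fun x hx => ?_)
    (hf.aestronglyMeasurable.indicator hDo.measurableSet) (max C 0) (Eventually.of_forall fun x => ?_)
  · exact indicator_of_notMem (fun h => hx (subset_closure h)) _
  · by_cases hx : x ∈ D
    · rw [indicator_of_mem hx]
      exact (hC x (subset_closure hx)).trans (le_max_left _ _)
    · simp [indicator_of_notMem hx]

/-- `1_D ∇g` as an element of `L²`. -/
noncomputable def liftGrad (hDo : IsOpen D) (hDb : Bornology.IsBounded D) {g : Eu d → ℝ}
    (hg : ContDiff ℝ ∞ g) : L2 d :=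
  (memLp_indicator_continuous hDo hDb (gradient_continuous hg)).toLp _

theorem coeFn_liftGrad (hDo : IsOpen D) (hDb : Bornology.IsBounded D) {g : Eu d → ℝ}
    (hg : ContDiff ℝ ∞ g) : liftGrad hDo hDb hg =ᵐ[volume] D.indicator (gradient g) :=
  MemLp.coeFn_toLp _

theorem isTest_indicator (hDo : IsOpen D) {Ω K : Set (Eu d)} {f : Eu d → ℝ}
    (hf : ContDiff ℝ ∞ f) (hK : IsCompact K) (hKΩ : K ⊆ Ω) (hΩD : Ω ⊆ D)
    (h : ∀ x ∈ D, x ∉ K → f x = 0) : IsTest Ω (D.indicator f) := by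
  refine IsTest.of_eq_zero (contDiff_iff_contDiffAt.2 fun x => ?_) hK hKΩ fun x hx => ?_
  · by_cases hx : x ∈ D
    · refine hf.contDiffAt.congr_of_eventuallyEq ?_
      filter_upwards [hDo.mem_nhds hx] with y hy
      exact indicator_of_mem hy f
    · refine (contDiffAt_const (c := (0 : ℝ))).congr_of_eventuallyEq ?_
      have hxK : x ∉ K := fun h' => hx (hΩD (hKΩ h'))
      filter_upwards [hK.isClosed.isOpen_compl.mem_nhds hxK] with y hy
      by_cases hyD : y ∈ D
      · rw [indicator_of_mem hyD, h y hyD hy]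
      · exact indicator_of_notMem hyD f
  · by_cases hxD : x ∈ D
    · rw [indicator_of_mem hxD, h x hxD hx]
    · exact indicator_of_notMem hxD f

theorem gradient_indicator (hDo : IsOpen D) {Ω : Set (Eu d)} (hΩD : Ω ⊆ D) {f : Eu d → ℝ}
    (h : IsTest Ω (D.indicator f)) : gradient (D.indicator f) = D.indicator (gradient f) := by
  funext x
  by_cases hx : x ∈ D
  · rw [indicator_of_mem hx]
    refine gradient_eventuallyEq ?_
    filter_upwards [hDo.mem_nhds hx] with y hy
    exact indicator_of_mem hy f
  · rw [indicator_of_notMem hx]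
    exact gradient_eq_zero_of_notMem fun h' => hx (hΩD (h.supp h'))

theorem testGrad_eq_of_gradient {U : Set (Eu d)} {ψ : Eu d → ℝ} (hψ : IsTest U ψ) {f : L2 d}
    (h : f =ᵐ[volume] gradient ψ) : testGrad hψ = f :=
  Lp.ext ((coeFn_testGrad hψ).trans h.symm)

/-- A smooth function that vanishes on `∂D` and on `D \ Ω` belongs to `H^1_0(Ω)`, after extension
by zero outside `D`. -/
theorem liftGrad_mem (hDo : IsOpen D) (hDb : Bornology.IsBounded D) {Ω : Set (Eu d)}
    (hΩD : Ω ⊆ D) {h : Eu d → ℝ} (hh : ContDiff ℝ ∞ h)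
    (h0 : ∀ x ∈ frontier D, h x = 0) (h1 : ∀ x ∈ D \ Ω, h x = 0) :
    liftGrad hDo hDb hh ∈ gradSpace Ω := by
  let κ : ℕ → ℝ := fun n => 1 / ((n : ℝ) + 1)
  have hκ : ∀ n, 0 < κ n := fun n => by positivity
  -- An odd function, zero on [-κ, κ], with slope in [0, 1] that equals 1 for |s| ≥ 2κ. Composing h
  -- with it produces a compact support inside Ω.
  let θ : ℕ → ℝ → ℝ := fun n s => softPos (κ n) (s - κ n) - softPos (κ n) (-s - κ n)
  let θ' : ℕ → ℝ → ℝ := fun n s =>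
    Real.smoothTransition ((s - κ n) / κ n) + Real.smoothTransition ((-s - κ n) / κ n)
  have hθ' : ∀ n s, HasDerivAt (θ n) (θ' n s) s := by
    intro n s
    have e1 : HasDerivAt (fun s => softPos (κ n) (s - κ n))
        (Real.smoothTransition ((s - κ n) / κ n)) s := by
      have := (softPos_hasDerivAt (κ n) (s - κ n)).comp s ((hasDerivAt_id s).sub_const (κ n))
      rw [mul_one] at this
      exact this
    have e2 : HasDerivAt (fun s => softPos (κ n) (-s - κ n))
        (-Real.smoothTransition ((-s - κ n) / κ n)) s := by
      have := (softPos_hasDerivAt (κ n) (-s - κ n)).comp s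
        ((hasDerivAt_id s).neg.sub_const (κ n))
      rw [mul_neg, mul_one] at this
      exact this
    have e3 := e1.sub e2
    rw [sub_neg_eq_add] at e3
    exact e3
  have hθs : ∀ n, ContDiff ℝ ∞ (θ n) := fun n =>
    ((softPos_contDiff (κ n)).comp (contDiff_id.sub contDiff_const)).sub
      ((softPos_contDiff (κ n)).comp (contDiff_neg.sub contDiff_const))
  have hθ0 : ∀ n s, |s| ≤ κ n → θ n s = 0 := by
    intro n s hs
    have := abs_le.1 hs
    simp only [θ]
    rw [softPos_of_nonpos (hκ n) (by linarith), softPos_of_nonpos (hκ n) (by linarith), sub_zero]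
  have hT : ∀ n, IsTest Ω (D.indicator fun x => θ n (h x)) := by
    intro n
    have hK : IsCompact {x | x ∈ closure D ∧ κ n ≤ |h x|} :=
      hDb.isCompact_closure.inter_right (isClosed_le continuous_const hh.continuous.abs)
    refine isTest_indicator hDo ((hθs n).comp hh) hK ?_ hΩD ?_
    -- On the closure of D, the function h vanishes on ∂D and on D \ Ω, so |h| ≥ κ is only possible
    -- inside Ω.
    · rintro x ⟨hx, hxκ⟩
      have hne : h x ≠ 0 := fun h' => by
        rw [h', abs_zero] at hxκ
        exact absurd hxκ (not_le.2 (hκ n))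
      have hxD : x ∈ D := by
        by_contra hxD
        exact hne (h0 x (by rw [hDo.frontier_eq]; exact ⟨hx, hxD⟩))
      by_contra hxΩ
      exact hne (h1 x ⟨hxD, hxΩ⟩)
    · intro x hxD hxK
      refine hθ0 n _ ?_
      by_contra hlt
      exact hxK ⟨subset_closure hxD, (not_le.1 hlt).le⟩
  have hG : MemLp (D.indicator (gradient h)) 2 volume :=
    memLp_indicator_continuous hDo hDb (gradient_continuous hh)
  have hgrad : ∀ n, gradient (D.indicator fun x => θ n (h x))
      = fun x => θ' n (h x) • D.indicator (gradient h) x := by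
    intro n
    rw [gradient_indicator hDo hΩD (hT n)]
    funext x
    by_cases hx : x ∈ D
    · rw [indicator_of_mem hx, indicator_of_mem hx,
        gradient_real_comp (hθ' n _).differentiableAt (hh.differentiable (by simp) x),
        (hθ' n _).deriv]
    · simp [indicator_of_notMem hx]
  have hθb : ∀ n s, |θ' n s - 1| ≤ 1 := by
    intro n s
    have n1 := Real.smoothTransition.nonneg ((s - κ n) / κ n)
    have n2 := Real.smoothTransition.nonneg ((-s - κ n) / κ n)
    have n3 := Real.smoothTransition.le_one ((s - κ n) / κ n)
    have n4 := Real.smoothTransition.le_one ((-s - κ n) / κ n)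
    simp only [θ']
    rw [abs_le]
    rcases le_total s 0 with hs | hs
    · have : Real.smoothTransition ((s - κ n) / κ n) = 0 :=
        Real.smoothTransition.zero_of_nonpos
          (div_nonpos_of_nonpos_of_nonneg (by linarith [hκ n]) (hκ n).le)
      constructor <;> linarith
    · have : Real.smoothTransition ((-s - κ n) / κ n) = 0 :=
        Real.smoothTransition.zero_of_nonpos
          (div_nonpos_of_nonpos_of_nonneg (by linarith [hκ n]) (hκ n).le)
      constructor <;> linarith
  have hcm : ∀ n, MemLp (fun x => (θ' n (h x) - 1) • D.indicator (gradient h) x) 2 volume := by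
    intro n
    have := (hT n).memLp_gradient.sub hG
    rw [hgrad n] at this
    refine this.ae_eq (Eventually.of_forall fun x => ?_)
    simp [sub_smul]
  have hκ0 : Tendsto κ atTop (𝓝 0) := tendsto_one_div_add_atTop_nhds_zero_nat
  -- The slopes are eventually 1 where h ≠ 0, and where h = 0 the gradient of h vanishes almost
  -- everywhere, so the truncated gradients converge to 1_D ∇h.
  have hlim := tendsto_toLp_smul_zero hG (c := fun n x => θ' n (h x) - 1)
    (fun n x => hθb n _) hcm (by
      filter_upwards [ae_gradient_eq_zero hh] with x hx hne
      have hxh : h x ≠ 0 := fun h' => hne (by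
        by_cases hxD : x ∈ D
        · rw [indicator_of_mem hxD, hx h']
        · rw [indicator_of_notMem hxD])
      refine tendsto_const_nhds.congr' ?_
      have hev : ∀ᶠ n in atTop, κ n < |h x| / 2 := hκ0.eventually_lt_const (by positivity)
      filter_upwards [hev] with n hn
      simp only [θ']
      rcases le_total (h x) 0 with hs | hs
      · rw [abs_of_nonpos hs] at hn
        rw [Real.smoothTransition.zero_of_nonpos
          (div_nonpos_of_nonpos_of_nonneg (by linarith [hκ n]) (hκ n).le),
          Real.smoothTransition.one_of_one_le ((one_le_div (hκ n)).2 (by linarith))]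
        norm_num
      · rw [abs_of_nonneg hs] at hn
        rw [Real.smoothTransition.one_of_one_le ((one_le_div (hκ n)).2 (by linarith)),
          Real.smoothTransition.zero_of_nonpos
          (div_nonpos_of_nonpos_of_nonneg (by linarith [hκ n]) (hκ n).le)]
        norm_num)
  refine mem_gradSpace_iff_seq.2 ⟨_, hT, ?_⟩
  have hsum : ∀ n, testGrad (hT n) = (hcm n).toLp _ + liftGrad hDo hDb hh := by
    intro n
    refine testGrad_eq_of_gradient (hT n) ?_
    filter_upwards [Lp.coeFn_add ((hcm n).toLp _) (liftGrad hDo hDb hh), (hcm n).coeFn_toLp,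
      coeFn_liftGrad hDo hDb hh] with x e1 e2 e3
    rw [e1, Pi.add_apply, e2, e3, hgrad n, sub_smul, one_smul, sub_add_cancel]
  simp only [hsum]
  simpa using hlim.add_const (liftGrad hDo hDb hh)

end Boundary

end HeatShape

namespace HeatShape

/-! ### States and Dirichlet solutions as orthogonal projections -/

section Projection

variable {d : ℕ}

/-- The component of `a` orthogonal to `gradSpace Ω`: for `a = 1_D ∇g` this is the gradient of the
state with boundary datum `g`. -/
noncomputable def harmonicPart (Ω : Set (Eu d)) (a : L2 d) : L2 d :=
  a - (gradSpace Ω).starProjection a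

theorem harmonicPart_sub_mem (Ω : Set (Eu d)) (a : L2 d) :
    harmonicPart Ω a - a ∈ gradSpace Ω := by
  have : harmonicPart Ω a - a = -(gradSpace Ω).starProjection a := by
    simp [harmonicPart]
  rw [this]
  exact neg_mem (Submodule.starProjection_apply_mem _ _)

theorem inner_harmonicPart {Ω : Set (Eu d)} (a : L2 d) {v : L2 d} (hv : v ∈ gradSpace Ω) :
    inner ℝ (harmonicPart Ω a) v = 0 :=
  (gradSpace Ω).starProjection_inner_eq_zero a v hv

/-- Uniqueness for the weak problem: the difference of two solutions lies both in `gradSpace Ω` and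
in its orthogonal. -/
theorem eq_harmonicPart {Ω : Set (Eu d)} {a f : L2 d} (h1 : f - a ∈ gradSpace Ω)
    (h2 : ∀ v ∈ gradSpace Ω, inner ℝ f v = 0) : f = harmonicPart Ω a := by
  have h3 : f - harmonicPart Ω a ∈ gradSpace Ω := by
    have := sub_mem h1 (harmonicPart_sub_mem Ω a)
    simpa using this
  have h4 : inner ℝ (f - harmonicPart Ω a) (f - harmonicPart Ω a) = 0 := by
    rw [inner_sub_left, h2 _ h3, inner_harmonicPart a h3, sub_zero]
  exact sub_eq_zero.1 (inner_self_eq_zero.1 h4)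

end Projection

section State

variable {d : ℕ} {D Ω : Set (Eu d)} {φ : Eu d → ℝ}

theorem MemH10.indicator {U : Set (Eu d)} (hDm : MeasurableSet D) (hUD : U ⊆ D) {w : Eu d → ℝ}
    {H : Eu d → Eu d} (h : MemH10 U w H) : MemH10 U (D.indicator w) (D.indicator H) := by
  obtain ⟨ψ, hψ, h1, h2⟩ := h.approx
  refine ⟨h.memLp.indicator hDm, h.memLp_grad.indicator hDm, ψ, hψ, ?_, ?_⟩
  · refine tendsto_of_tendsto_of_tendsto_of_le_of_le tendsto_const_nhds h1 (fun _ => zero_le)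
      fun n => eLpNorm_mono fun x => ?_
    by_cases hx : x ∈ D
    · rw [indicator_of_mem hx]
    · rw [indicator_of_notMem hx, image_eq_zero_of_notMem_tsupport fun h => hx (hUD ((hψ n).supp h))]
      simp
  · refine tendsto_of_tendsto_of_tendsto_of_le_of_le tendsto_const_nhds h2 (fun _ => zero_le)
      fun n => eLpNorm_mono fun x => ?_
    by_cases hx : x ∈ D
    · rw [indicator_of_mem hx]
    · rw [indicator_of_notMem hx, gradient_eq_zero_of_notMem fun h => hx (hUD ((hψ n).supp h))]
      simp

theorem inner_testGrad_eq {U : Set (Eu d)} (hUm : MeasurableSet U) {f : L2 d} {G : Eu d → Eu d}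
    {D : Set (Eu d)} (hUD : U ⊆ D)
    (hf : f =ᵐ[volume] D.indicator G) {ψ : Eu d → ℝ} (hψ : IsTest U ψ) :
    inner ℝ f (testGrad hψ) = ∫ x in U, inner ℝ (G x) (gradient ψ x) := by
  rw [inner_L2_eq hf (coeFn_testGrad hψ), ← integral_indicator hUm]
  refine integral_congr_ae (Eventually.of_forall fun x => ?_)
  by_cases hx : x ∈ U
  · simp only [indicator_of_mem hx, indicator_of_mem (hUD hx)]
  · simp only [indicator_of_notMem hx, gradient_eq_zero_of_notMem fun h => hx (hψ.supp h),
      inner_zero_right]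

/-- The lifting g is arbitrary, not the one that witnesses `h.boundary`. Two liftings differ by a
smooth function vanishing on ∂D and on D \ Ω, whose gradient is in `gradSpace Ω` by `liftGrad_mem`.
This freedom later allows one lifting to serve several domains at once. -/
theorem IsState.eq_harmonicPart (hDo : IsOpen D) (hDb : Bornology.IsBounded D)
    (hΩo : IsOpen Ω) (hΩD : Ω ⊆ D) {u : Eu d → ℝ} {G : Eu d → Eu d} (h : IsState D φ Ω u G)
    {g : Eu d → ℝ} (hg : ContDiff ℝ ∞ g) (hgφ : ∀ x ∈ frontier D, g x = φ x)
    (hg0 : ∀ x ∈ D \ Ω, g x = 0) :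
    D.indicator G =ᵐ[volume] harmonicPart Ω (liftGrad hDo hDb hg) := by
  obtain ⟨g', hg', hgφ', hg0', hH⟩ := h.boundary
  have hsub := liftGrad_mem hDo hDb hΩD (hg'.sub hg)
    (fun x hx => by rw [hgφ x hx, hgφ' x hx, sub_self])
    (fun x hx => by rw [hg0 x hx, hg0'.self_of_nhdsSet x hx, sub_zero])
  have hmem := hH.toLp_mem
  have hGm : MemLp (D.indicator G) 2 volume := by
    have := hH.memLp_grad.add (memLp_indicator_continuous hDo hDb (gradient_continuous hg'))
    refine this.ae_eq (Eventually.of_forall fun x => ?_)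
    by_cases hx : x ∈ D
    · simp [indicator_of_mem hx]
    · simp [indicator_of_notMem hx]
  have key : hGm.toLp _ = harmonicPart Ω (liftGrad hDo hDb hg) := by
    refine HeatShape.eq_harmonicPart ?_ fun v hv => inner_eq_zero_of_test (fun ψ hψ => ?_) hv
    · have heq : hGm.toLp _ - liftGrad hDo hDb hg
          = hH.memLp_grad.toLp _ + liftGrad hDo hDb (hg'.sub hg) := by
        apply Lp.ext
        filter_upwards [Lp.coeFn_sub (hGm.toLp _) (liftGrad hDo hDb hg),
          Lp.coeFn_add (hH.memLp_grad.toLp _) (liftGrad hDo hDb (hg'.sub hg)), hGm.coeFn_toLp,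
          hH.memLp_grad.coeFn_toLp, coeFn_liftGrad hDo hDb hg,
          coeFn_liftGrad hDo hDb (hg'.sub hg)] with x e1 e2 e3 e4 e5 e6
        rw [e1, e2, Pi.sub_apply, Pi.add_apply, e3, e4, e5, e6]
        by_cases hx : x ∈ D
        · simp only [indicator_of_mem hx]
          rw [gradient_sub' (hg'.differentiable (by simp) x) (hg.differentiable (by simp) x)]
          abel
        · simp [indicator_of_notMem hx]
      rw [heq]
      exact add_mem hmem hsub
    · rw [inner_testGrad_eq hΩo.measurableSet hΩD hGm.coeFn_toLp hψ]
      exact h.harmonic ψ hψ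
  rw [← key]
  exact hGm.coeFn_toLp.symm

theorem exists_isState (hd : 0 < d) (hDo : IsOpen D) (hDb : Bornology.IsBounded D)
    (hΩo : IsOpen Ω) (hΩD : Ω ⊆ D) (hK : IsCompact (D \ Ω)) (hφ : ContDiff ℝ ∞ φ) :
    ∃ p : (Eu d → ℝ) × (Eu d → Eu d), IsState D φ Ω p.1 p.2 := by
  obtain ⟨g, hg, ⟨C, hC, hCD, hgC⟩, hg0, -⟩ := exists_lifting hDo hDb hK sdiff_subset hφ
  obtain ⟨w, hw⟩ := exists_memH10 hd (hDb.subset hΩD)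
    (harmonicPart_sub_mem Ω (liftGrad hDo hDb hg))
  set H : L2 d := harmonicPart Ω (liftGrad hDo hDb hg) - liftGrad hDo hDb hg with hHdef
  refine ⟨(fun x => g x + w x, fun x => gradient g x + H x),
    ⟨g, hg, fun x hx => hgC x fun h => ?_, hg0, ?_⟩, fun ψ hψ => ?_⟩
  · rw [hDo.frontier_eq] at hx
    exact hx.2 (hCD h)
  · refine (hw.indicator hDo.measurableSet hΩD).congr ?_ ?_
    · refine Eventually.of_forall fun x => ?_
      simp
    · refine Eventually.of_forall fun x => ?_
      simp
  · have : harmonicPart Ω (liftGrad hDo hDb hg)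
        =ᵐ[volume] D.indicator (fun x => gradient g x + H x) := by
      have e0 : harmonicPart Ω (liftGrad hDo hDb hg) = liftGrad hDo hDb hg + H := by
        rw [hHdef]; abel
      filter_upwards [Lp.coeFn_add (liftGrad hDo hDb hg) H, coeFn_liftGrad hDo hDb hg,
        ae_zero_of_mem_gradSpace (harmonicPart_sub_mem Ω (liftGrad hDo hDb hg))] with x e1 e2 e3
      rw [e0, e1, Pi.add_apply, e2]
      by_cases hx : x ∈ D
      · simp [indicator_of_mem hx]
      · rw [indicator_of_notMem hx, indicator_of_notMem hx, e3 fun h => hx (hΩD h), add_zero]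
    rw [← inner_testGrad_eq hΩo.measurableSet hΩD this hψ]
    exact inner_harmonicPart _ (testGrad_mem hψ)

theorem stateGrad_ae_eq (hd : 0 < d) (hDo : IsOpen D) (hDb : Bornology.IsBounded D)
    (hΩo : IsOpen Ω) (hΩD : Ω ⊆ D) (hK : IsCompact (D \ Ω)) (hφ : ContDiff ℝ ∞ φ)
    {g : Eu d → ℝ} (hg : ContDiff ℝ ∞ g) (hgφ : ∀ x ∈ frontier D, g x = φ x)
    (hg0 : ∀ x ∈ D \ Ω, g x = 0) :
    D.indicator (stateGrad D φ Ω) =ᵐ[volume] harmonicPart Ω (liftGrad hDo hDb hg) := by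
  have hex := exists_isState hd hDo hDb hΩo hΩD hK hφ
  have hs : IsState D φ Ω (state D φ Ω).1 (state D φ Ω).2 := by
    rw [state, dif_pos hex]
    exact hex.choose_spec
  exact hs.eq_harmonicPart hDo hDb hΩo hΩD hg hgφ hg0

/-- The bridge from the functional, defined through chosen weak solutions, to Hilbert space
geometry. -/
theorem heat_eq_inner {ϕ : Eu d → ℝ} (hd : 0 < d) (hDo : IsOpen D) (hDb : Bornology.IsBounded D)
    (hΩo : IsOpen Ω) (hΩD : Ω ⊆ D) (hK : IsCompact (D \ Ω)) (hφ : ContDiff ℝ ∞ φ)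
    (hϕ : ContDiff ℝ ∞ ϕ) {g k : Eu d → ℝ} (hg : ContDiff ℝ ∞ g) (hk : ContDiff ℝ ∞ k)
    (hgφ : ∀ x ∈ frontier D, g x = φ x) (hkϕ : ∀ x ∈ frontier D, k x = ϕ x)
    (hg0 : ∀ x ∈ D \ Ω, g x = 0) (hk0 : ∀ x ∈ D \ Ω, k x = 0) :
    heat D φ ϕ Ω = inner ℝ (harmonicPart Ω (liftGrad hDo hDb hg))
      (harmonicPart Ω (liftGrad hDo hDb hk)) := by
  rw [inner_L2_eq (stateGrad_ae_eq hd hDo hDb hΩo hΩD hK hφ hg hgφ hg0).symm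
    (stateGrad_ae_eq hd hDo hDb hΩo hΩD hK hϕ hk hkϕ hk0).symm, heat,
    ← integral_indicator hDo.measurableSet]
  refine integral_congr_ae (Eventually.of_forall fun x => ?_)
  by_cases hx : x ∈ D
  · simp only [indicator_of_mem hx]
  · simp [indicator_of_notMem hx]

/-- The gradient of a state vanishes almost everywhere outside `Ω`. -/
theorem harmonicPart_ae_zero (hDo : IsOpen D) (hDb : Bornology.IsBounded D)
    {g : Eu d → ℝ} (hg : ContDiff ℝ ∞ g) (hg0 : ∀ x ∈ D \ Ω, g x = 0) :
    ∀ᵐ x, x ∉ Ω → harmonicPart Ω (liftGrad hDo hDb hg) x = 0 := by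
  have e0 : harmonicPart Ω (liftGrad hDo hDb hg) = liftGrad hDo hDb hg
      + (harmonicPart Ω (liftGrad hDo hDb hg) - liftGrad hDo hDb hg) := by abel
  filter_upwards [Lp.coeFn_add (liftGrad hDo hDb hg)
      (harmonicPart Ω (liftGrad hDo hDb hg) - liftGrad hDo hDb hg), coeFn_liftGrad hDo hDb hg,
    ae_zero_of_mem_gradSpace (harmonicPart_sub_mem Ω (liftGrad hDo hDb hg)),
    ae_gradient_eq_zero hg] with x e1 e2 e3 e4 hx
  rw [e0, e1, Pi.add_apply, e2, e3 hx, add_zero]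
  by_cases hxD : x ∈ D
  · rw [indicator_of_mem hxD, e4 (hg0 x ⟨hxD, hx⟩)]
  · rw [indicator_of_notMem hxD]

/-- The solution of `-Δw = div V` is minus the projection of `V`. -/
theorem dirichletSol_ae_eq (hd : 0 < d) (hΩb : Bornology.IsBounded Ω) (hΩo : IsOpen Ω)
    {V : Eu d → Eu d} {X : L2 d} (hX : X =ᵐ[volume] Ω.indicator V) :
    (dirichletSol Ω V).2 =ᵐ[volume] (-(gradSpace Ω).starProjection X : L2 d) := by
  have hmem : -(gradSpace Ω).starProjection X ∈ gradSpace Ω :=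
    neg_mem (Submodule.starProjection_apply_mem _ _)
  have hex : ∃ p : (Eu d → ℝ) × (Eu d → Eu d), IsDirichletSol Ω V p.1 p.2 := by
    obtain ⟨w, hw⟩ := exists_memH10 hd hΩb hmem
    refine ⟨(w, ((-(gradSpace Ω).starProjection X : L2 d) : Eu d → Eu d)), hw, fun ψ hψ => ?_⟩
    have h1 : (-(gradSpace Ω).starProjection X : L2 d)
        =ᵐ[volume] univ.indicator (-(gradSpace Ω).starProjection X : L2 d) := by
      rw [indicator_univ]
    rw [← inner_testGrad_eq hΩo.measurableSet (subset_univ _) h1 hψ,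
      ← inner_testGrad_eq hΩo.measurableSet subset_rfl hX hψ, inner_neg_left]
    -- The weak equation says that the gradient of the solution plus V is orthogonal to `gradSpace
    -- Ω`, which characterizes minus the projection.
    have := (gradSpace Ω).starProjection_inner_eq_zero X _ (testGrad_mem hψ)
    rw [inner_sub_left] at this
    linarith
  have hs : IsDirichletSol Ω V (dirichletSol Ω V).1 (dirichletSol Ω V).2 := by
    rw [dirichletSol, dif_pos hex]
    exact hex.choose_spec
  have hH := hs.memH10
  have hHm := hH.toLp_mem
  have key : hH.memLp_grad.toLp _ = -(gradSpace Ω).starProjection X := by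
    have h2 : ∀ v ∈ gradSpace Ω,
        inner ℝ (hH.memLp_grad.toLp _ + X) v = 0 := fun v hv =>
      inner_eq_zero_of_test (fun ψ hψ => by
        have h1 : hH.memLp_grad.toLp _ =ᵐ[volume] univ.indicator (dirichletSol Ω V).2 := by
          rw [indicator_univ]; exact hH.memLp_grad.coeFn_toLp
        rw [inner_add_left, inner_testGrad_eq hΩo.measurableSet (subset_univ _) h1 hψ,
          inner_testGrad_eq hΩo.measurableSet subset_rfl hX hψ, hs.weak ψ hψ, neg_add_cancel]) hv
    have h3 := HeatShape.eq_harmonicPart (Ω := Ω) (a := X) (f := hH.memLp_grad.toLp _ + X)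
      (by simpa using hHm) h2
    rw [harmonicPart] at h3
    calc hH.memLp_grad.toLp _ = (hH.memLp_grad.toLp _ + X) - X := by abel
      _ = _ := by rw [h3]; abel
  rw [← key]
  exact hH.memLp_grad.coeFn_toLp.symm

end State

end HeatShape

namespace HeatShape

/-! ### Maximum principle and monotonicity of the heat -/

section Monotone

variable {d : ℕ} {D Ω : Set (Eu d)}

/-- Dirichlet's principle, from Pythagoras: the state is orthogonal to its difference with any
competitor. -/
theorem norm_harmonicPart_le (Ω : Set (Eu d)) (a : L2 d) {v : L2 d} (hv : v ∈ gradSpace Ω) :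
    ‖harmonicPart Ω a‖ ≤ ‖a + v‖ := by
  set u := harmonicPart Ω a with hu
  have h1 : a + v - u ∈ gradSpace Ω := by
    have := sub_mem hv (harmonicPart_sub_mem Ω a)
    convert this using 1
    rw [← hu]; abel
  have h2 : inner ℝ u (a + v - u) = 0 := inner_harmonicPart a h1
  have h3 : ‖a + v‖ * ‖a + v‖ = ‖u‖ * ‖u‖ + ‖a + v - u‖ * ‖a + v - u‖ := by
    rw [← norm_add_sq_eq_norm_sq_add_norm_sq_of_inner_eq_zero _ _ h2]
    congr 2 <;> abel_nf
  nlinarith [norm_nonneg u, norm_nonneg (a + v), norm_nonneg (a + v - u)]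

/-- Truncating a competitor from below does not increase the energy by much. -/
theorem norm_harmonicPart_le_of_test (hDo : IsOpen D) (hDb : Bornology.IsBounded D)
    (hΩD : Ω ⊆ D) (hK : IsCompact (D \ Ω)) {g : Eu d → ℝ} (hg : ContDiff ℝ ∞ g) {c : ℝ}
    (hc : 0 < c) (hgc : ∀ x ∈ frontier D, c ≤ g x) (hg0 : ∀ᶠ x in 𝓝ˢ (D \ Ω), g x = 0)
    {ψ ζ : Eu d → ℝ} (hψ : IsTest Ω ψ) (hζ : IsTest D ζ) (hζ0 : ∀ x, 0 ≤ ζ x) {ε : ℝ}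
    (hε : 0 ≤ ε) :
    ‖harmonicPart Ω (liftGrad hDo hDb hg)‖
      ≤ ‖liftGrad hDo hDb hg + testGrad hψ - ε • testGrad hζ‖ := by
  obtain ⟨g₁, hg₁, ⟨C, hC, hCD, hgC⟩, hg₁0, -⟩ := exists_lifting hDo hDb hK sdiff_subset
    (contDiff_const (c := (1 : ℝ)))
  set p := liftGrad hDo hDb hg + testGrad hψ - ε • testGrad hζ with hp
  have main : ∀ κ, 0 < κ → κ ≤ c / 2 →
      ‖harmonicPart Ω (liftGrad hDo hDb hg)‖ ≤ ‖p‖ + κ * ‖liftGrad hDo hDb hg₁‖ := by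
    intro κ hκ hκc
    -- The truncation lowers the boundary values by exactly this constant. Adding `k₀ * g₁`, with g₁
    -- equal to 1 near ∂D and 0 near D \ Ω, restores them at an energy cost that vanishes with κ.
    set k₀ := κ - softPos κ κ with hk₀
    have hk₀m : 0 ≤ k₀ ∧ k₀ ≤ κ := by
      obtain ⟨h1, h2⟩ := softPos_self_mem hκ
      constructor <;> linarith
    let s : Eu d → ℝ := fun x => g x + ψ x - ε * ζ x
    have hs : ContDiff ℝ ∞ s := (hg.add hψ.smooth).sub (contDiff_const.mul hζ.smooth)
    let f : Eu d → ℝ := fun x => softPos κ (s x) + k₀ * g₁ x - g x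
    have hf : ContDiff ℝ ∞ f :=
      (((softPos_contDiff κ).comp hs).add (contDiff_const.mul hg₁)).sub hg
    -- On this neighbourhood of D \ Ω the function s reduces to -εζ ≤ 0, so its truncation vanishes
    -- and so does f.
    let N : Set (Eu d) := interior {x | g x = 0 ∧ g₁ x = 0} ∩ (tsupport ψ)ᶜ
    have hNo : IsOpen N := isOpen_interior.inter (isClosed_tsupport ψ).isOpen_compl
    have hN : D \ Ω ⊆ N := by
      refine subset_inter ?_ fun x hx h => hx.2 (hψ.supp h)
      rw [subset_interior_iff_mem_nhdsSet]
      filter_upwards [hg0, hg₁0] with x h1 h2 using ⟨h1, h2⟩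
    -- In D and off this compact set, s = g > c/2 ≥ κ and g₁ = 1, so f vanishes there too. It is
    -- contained in D because g ≥ c on ∂D, which is where the positivity of the data is used.
    let C' : Set (Eu d) := (tsupport ψ ∪ tsupport ζ ∪ C) ∪ {x | x ∈ closure D ∧ g x ≤ c / 2}
    have hC' : IsCompact C' := ((hψ.compact.isCompact.union hζ.compact.isCompact).union hC).union
      (hDb.isCompact_closure.inter_right (isClosed_le hg.continuous continuous_const))
    have hC'D : C' ⊆ D := by
      refine union_subset (union_subset (union_subset (hψ.supp.trans hΩD) hζ.supp) hCD) ?_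
      rintro x ⟨hx, hxg⟩
      by_contra hxD
      have := hgc x (by rw [hDo.frontier_eq]; exact ⟨hx, hxD⟩)
      linarith
    have hT : IsTest Ω (D.indicator f) := by
      refine isTest_indicator hDo hf (hC'.diff hNo) ?_ hΩD ?_
      · intro x hx
        by_contra hxΩ
        exact hx.2 (hN ⟨hC'D hx.1, hxΩ⟩)
      · intro x hxD hx
        by_cases hxN : x ∈ N
        · have hxi := interior_subset hxN.1
          rw [mem_ofPred_eq] at hxi
          obtain ⟨h1, h2⟩ := hxi
          have h3 : ψ x = 0 := image_eq_zero_of_notMem_tsupport hxN.2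
          have h4 : softPos κ (s x) = 0 := softPos_of_nonpos hκ (by
            simp only [s, h1, h3]
            nlinarith [hζ0 x])
          simp only [f, h1, h2, h4]
          ring
        · have hxC : x ∉ C' := fun h => hx ⟨h, hxN⟩
          simp only [C', mem_union, not_or] at hxC
          obtain ⟨⟨⟨h1, h2⟩, h3⟩, h4⟩ := hxC
          have h5 : c / 2 < g x := by
            by_contra h
            exact h4 ⟨subset_closure hxD, not_lt.1 h⟩
          have h6 : s x = g x := by
            simp only [s, image_eq_zero_of_notMem_tsupport h1, image_eq_zero_of_notMem_tsupport h2]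
            ring
          simp only [f, h6, hgC x h3]
          rw [softPos_of_ge hκ (by linarith)]
          ring
    have h1 := norm_harmonicPart_le Ω (liftGrad hDo hDb hg) (testGrad_mem hT)
    set q := liftGrad hDo hDb hg + testGrad hT - k₀ • liftGrad hDo hDb hg₁ with hq
    -- Truncation multiplies the gradient of s by a factor in [0, 1], hence does not increase the
    -- norm.
    have h2 : ‖q‖ ≤ ‖p‖ := by
      refine Lp.norm_le_norm_of_ae_le ?_
      filter_upwards [Lp.coeFn_sub (liftGrad hDo hDb hg + testGrad hT)
          (k₀ • liftGrad hDo hDb hg₁), Lp.coeFn_add (liftGrad hDo hDb hg) (testGrad hT),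
        Lp.coeFn_smul k₀ (liftGrad hDo hDb hg₁), coeFn_liftGrad hDo hDb hg,
        coeFn_liftGrad hDo hDb hg₁, coeFn_testGrad hT,
        Lp.coeFn_sub (liftGrad hDo hDb hg + testGrad hψ) (ε • testGrad hζ),
        Lp.coeFn_add (liftGrad hDo hDb hg) (testGrad hψ), Lp.coeFn_smul ε (testGrad hζ),
        coeFn_testGrad hψ, coeFn_testGrad hζ] with x e1 e2 e3 e4 e5 e6 e7 e8 e9 e10 e11
      rw [e1, e7, Pi.sub_apply, Pi.sub_apply, e2, e8, e3, e9, Pi.add_apply, Pi.add_apply,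
        Pi.smul_apply, Pi.smul_apply, e4, e5, e6, e10, e11, gradient_indicator hDo hΩD hT]
      by_cases hx : x ∈ D
      · simp only [indicator_of_mem hx]
        have dg : DifferentiableAt ℝ g x := hg.differentiable (by simp) x
        have dg₁ : DifferentiableAt ℝ g₁ x := hg₁.differentiable (by simp) x
        have dψ := hψ.differentiable x
        have dζ := hζ.differentiable x
        have ds : DifferentiableAt ℝ s x := hs.differentiable (by simp) x
        have dp : DifferentiableAt ℝ (fun y => softPos κ (s y)) x :=
          ((softPos_contDiff κ).comp hs).differentiable (by simp) x
        have gs : gradient s x = gradient g x + gradient ψ x - ε • gradient ζ x := by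
          simp only [s]
          rw [gradient_sub' (f := fun y => g y + ψ y) (dg.add dψ) (dζ.const_mul ε),
            gradient_add' dg dψ, gradient_const_mul' ε dζ]
        have gf : gradient f x = Real.smoothTransition (s x / κ) • gradient s x
            + k₀ • gradient g₁ x - gradient g x := by
          simp only [f]
          rw [gradient_sub' (f := fun y => softPos κ (s y) + k₀ * g₁ y)
            (dp.add (dg₁.const_mul k₀)) dg, gradient_add' dp (dg₁.const_mul k₀),
            gradient_const_mul' k₀ dg₁,
            gradient_real_comp (softPos_hasDerivAt κ (s x)).differentiableAt ds,
            (softPos_hasDerivAt κ (s x)).deriv]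
        rw [gf, ← gs]
        have : gradient g x + (Real.smoothTransition (s x / κ) • gradient s x
            + k₀ • gradient g₁ x - gradient g x) - k₀ • gradient g₁ x
            = Real.smoothTransition (s x / κ) • gradient s x := by abel
        rw [this, norm_smul, Real.norm_eq_abs, abs_of_nonneg (Real.smoothTransition.nonneg _)]
        exact mul_le_of_le_one_left (norm_nonneg _) (Real.smoothTransition.le_one _)
      · simp [indicator_of_notMem hx]
    calc _ ≤ _ := h1
      _ = ‖q + k₀ • liftGrad hDo hDb hg₁‖ := by rw [hq, sub_add_cancel]
      _ ≤ ‖q‖ + ‖k₀ • liftGrad hDo hDb hg₁‖ := norm_add_le _ _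
      _ ≤ ‖p‖ + κ * ‖liftGrad hDo hDb hg₁‖ := by
        rw [norm_smul, Real.norm_eq_abs, abs_of_nonneg hk₀m.1]
        gcongr
        exact hk₀m.2
  have hlim : Tendsto (fun κ : ℝ => ‖p‖ + κ * ‖liftGrad hDo hDb hg₁‖) (𝓝[>] 0)
      (𝓝 (‖p‖ + 0 * ‖liftGrad hDo hDb hg₁‖)) :=
    ((tendsto_id.mono_left nhdsWithin_le_nhds).mul_const _).const_add _
  rw [zero_mul, add_zero] at hlim
  refine ge_of_tendsto hlim ?_
  have hev : ∀ᶠ κ : ℝ in 𝓝[>] 0, κ < c / 2 :=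
    (tendsto_id.mono_left nhdsWithin_le_nhds).eventually_lt_const (by positivity)
  filter_upwards [self_mem_nhdsWithin, hev] with κ h1 h2 using main κ h1 h2.le

/-- States with positive boundary data are subharmonic in `D`. -/
theorem inner_harmonicPart_nonpos (hDo : IsOpen D) (hDb : Bornology.IsBounded D)
    (hΩD : Ω ⊆ D) (hK : IsCompact (D \ Ω)) {g : Eu d → ℝ} (hg : ContDiff ℝ ∞ g) {c : ℝ}
    (hc : 0 < c) (hgc : ∀ x ∈ frontier D, c ≤ g x) (hg0 : ∀ᶠ x in 𝓝ˢ (D \ Ω), g x = 0)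
    {ζ : Eu d → ℝ} (hζ : IsTest D ζ) (hζ0 : ∀ x, 0 ≤ ζ x) :
    inner ℝ (harmonicPart Ω (liftGrad hDo hDb hg)) (testGrad hζ) ≤ 0 := by
  set u := harmonicPart Ω (liftGrad hDo hDb hg) with hu
  obtain ⟨ψ, hψ, hlim⟩ := mem_gradSpace_iff_seq.1
    (harmonicPart_sub_mem Ω (liftGrad hDo hDb hg))
  -- Lowering the state by εζ with ζ ≥ 0 does not reduce its energy. Expanding the square and
  -- letting ε tend to 0 gives the sign of the first order term.
  have h1 : ∀ ε : ℝ, 0 ≤ ε → ‖u‖ ≤ ‖u - ε • testGrad hζ‖ := by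
    intro ε hε
    have h2 : Tendsto (fun n => ‖liftGrad hDo hDb hg + testGrad (hψ n) - ε • testGrad hζ‖) atTop
        (𝓝 ‖liftGrad hDo hDb hg + (u - liftGrad hDo hDb hg) - ε • testGrad hζ‖) :=
      ((hlim.const_add _).sub_const _).norm
    rw [add_sub_cancel] at h2
    exact ge_of_tendsto' h2 fun n =>
      norm_harmonicPart_le_of_test hDo hDb hΩD hK hg hc hgc hg0 (hψ n) hζ hζ0 hε
  have h2 : ∀ ε : ℝ, 0 < ε → 2 * inner ℝ u (testGrad hζ) ≤ ε * ‖testGrad hζ‖ ^ 2 := by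
    intro ε hε
    have h3 := h1 ε hε.le
    have h4 : ‖u‖ ^ 2 ≤ ‖u - ε • testGrad hζ‖ ^ 2 := by gcongr
    rw [norm_sub_sq_real, inner_smul_right, norm_smul, mul_pow, Real.norm_eq_abs, sq_abs] at h4
    have h5 : ε * (2 * inner ℝ u (testGrad hζ)) ≤ ε * (ε * ‖testGrad hζ‖ ^ 2) := by linarith
    exact le_of_mul_le_mul_left h5 hε
  have hlim2 : Tendsto (fun ε : ℝ => ε * ‖testGrad hζ‖ ^ 2) (𝓝[>] 0)
      (𝓝 (0 * ‖testGrad hζ‖ ^ 2)) :=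
    (tendsto_id.mono_left nhdsWithin_le_nhds).mul_const _
  rw [zero_mul] at hlim2
  have := ge_of_tendsto hlim2 (eventually_nhdsWithin_of_forall (s := Ioi (0 : ℝ)) h2)
  linarith

/-- Smooth versions h, k of the positive and negative parts of ψ: the gradients of h and k are
nonzero only on ψ > 0 and ψ < 0 respectively, hence orthogonal. The error in ψ ≈ h - k is small in
energy because ∇ψ vanishes almost everywhere on ψ = 0. -/
theorem exists_softPos_test {ψ : Eu d → ℝ} (hψ : IsTest Ω ψ) {δ : ℝ} (hδ : 0 < δ) :
    ∃ (h k : Eu d → ℝ) (hh : IsTest Ω h) (hk : IsTest Ω k), (∀ x, 0 ≤ h x) ∧ (∀ x, 0 ≤ k x) ∧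
      inner ℝ (testGrad hk) (testGrad hh) = 0 ∧
      ‖testGrad hψ - testGrad hh + testGrad hk‖ ≤ δ := by
  let κ : ℕ → ℝ := fun n => 1 / ((n : ℝ) + 1)
  have hκ : ∀ n, 0 < κ n := fun n => by positivity
  have hκ0 : Tendsto κ atTop (𝓝 0) := tendsto_one_div_add_atTop_nhds_zero_nat
  have hh : ∀ n, IsTest Ω fun x => softPos (κ n) (ψ x) := fun n =>
    hψ.comp_zero (softPos_contDiff _) (softPos_of_nonpos (hκ n) le_rfl)
  have hk : ∀ n, IsTest Ω fun x => softPos (κ n) (-ψ x) := fun n =>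
    hψ.comp_zero (g := fun s => softPos (κ n) (-s)) ((softPos_contDiff _).comp contDiff_neg)
      (by simpa using softPos_of_nonpos (hκ n) le_rfl)
  have gh : ∀ n x, gradient (fun x => softPos (κ n) (ψ x)) x
      = Real.smoothTransition (ψ x / κ n) • gradient ψ x := by
    intro n x
    rw [gradient_real_comp (softPos_hasDerivAt _ _).differentiableAt (hψ.differentiable x),
      (softPos_hasDerivAt _ _).deriv]
  have gk : ∀ n x, gradient (fun x => softPos (κ n) (-ψ x)) x
      = -(Real.smoothTransition (-ψ x / κ n) • gradient ψ x) := by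
    intro n x
    have : HasDerivAt (fun s => softPos (κ n) (-s)) (-Real.smoothTransition (-ψ x / κ n)) (ψ x) := by
      have := (softPos_hasDerivAt (κ n) (-ψ x)).comp (ψ x) (hasDerivAt_neg (ψ x))
      rw [mul_neg, mul_one] at this
      exact this
    rw [gradient_real_comp (θ := fun s => softPos (κ n) (-s)) this.differentiableAt
      (hψ.differentiable x), this.deriv, neg_smul]
  have hz : ∀ n s, 0 ≤ s → Real.smoothTransition (-s / κ n) = 0 := fun n s hs =>
    Real.smoothTransition.zero_of_nonpos
      (div_nonpos_of_nonpos_of_nonneg (by linarith) (hκ n).le)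
  have hz' : ∀ n s, s ≤ 0 → Real.smoothTransition (s / κ n) = 0 := fun n s hs =>
    Real.smoothTransition.zero_of_nonpos
      (div_nonpos_of_nonpos_of_nonneg hs (hκ n).le)
  let c : ℕ → Eu d → ℝ := fun n x =>
    1 - Real.smoothTransition (ψ x / κ n) - Real.smoothTransition (-ψ x / κ n)
  have hcb : ∀ n x, |c n x| ≤ 1 := by
    intro n x
    have n1 := Real.smoothTransition.nonneg (ψ x / κ n)
    have n2 := Real.smoothTransition.nonneg (-ψ x / κ n)
    have n3 := Real.smoothTransition.le_one (ψ x / κ n)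
    have n4 := Real.smoothTransition.le_one (-ψ x / κ n)
    simp only [c]
    rw [abs_le]
    rcases le_total (ψ x) 0 with hs | hs
    · rw [hz' n _ hs]
      constructor <;> linarith
    · rw [hz n _ hs]
      constructor <;> linarith
  have hcg : ∀ n, MemLp (fun x => c n x • gradient ψ x) 2 volume := by
    intro n
    refine ((hψ.memLp_gradient.sub (hh n).memLp_gradient).add (hk n).memLp_gradient).ae_eq
      (Eventually.of_forall fun x => ?_)
    simp only [Pi.add_apply, Pi.sub_apply, gh, gk, c, sub_smul, one_smul]
    abel
  have hlim := tendsto_toLp_smul_zero hψ.memLp_gradient hcb hcg (by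
    filter_upwards [ae_gradient_eq_zero hψ.smooth] with x hx hne
    have hxψ : ψ x ≠ 0 := fun h' => hne (hx h')
    have hev : ∀ᶠ n in atTop, κ n < |ψ x| := hκ0.eventually_lt_const (by positivity)
    refine tendsto_const_nhds.congr' ?_
    filter_upwards [hev] with n hn
    simp only [c]
    rcases le_total (ψ x) 0 with hs | hs
    · rw [abs_of_nonpos hs] at hn
      rw [hz' n _ hs, Real.smoothTransition.one_of_one_le ((one_le_div (hκ n)).2 hn.le)]
      norm_num
    · rw [abs_of_nonneg hs] at hn
      rw [hz n _ hs, Real.smoothTransition.one_of_one_le ((one_le_div (hκ n)).2 hn.le)]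
      norm_num)
  rw [tendsto_zero_iff_norm_tendsto_zero] at hlim
  obtain ⟨n, hn⟩ := (hlim.eventually_lt_const hδ).exists
  refine ⟨_, _, hh n, hk n, fun x => softPos_nonneg (hκ n), fun x => softPos_nonneg (hκ n), ?_, ?_⟩
  · rw [inner_L2_eq (coeFn_testGrad (hk n)) (coeFn_testGrad (hh n))]
    refine integral_eq_zero_of_ae (Eventually.of_forall fun x => ?_)
    simp only [gh, gk, Pi.zero_apply]
    rcases le_total (ψ x) 0 with hs | hs
    · rw [hz' n _ hs]; simp
    · rw [hz n _ hs]; simp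
  · have : testGrad hψ - testGrad (hh n) + testGrad (hk n) = (hcg n).toLp _ := by
      apply Lp.ext
      filter_upwards [Lp.coeFn_add (testGrad hψ - testGrad (hh n)) (testGrad (hk n)),
        Lp.coeFn_sub (testGrad hψ) (testGrad (hh n)), coeFn_testGrad hψ, coeFn_testGrad (hh n),
        coeFn_testGrad (hk n), (hcg n).coeFn_toLp] with x e1 e2 e3 e4 e5 e6
      rw [e1, Pi.add_apply, e2, Pi.sub_apply, e3, e4, e5, e6, gh, gk]
      simp only [c, sub_smul, one_smul]
      abel
    rw [this]
    exact hn.le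

/-- A superharmonic element of `H^1_0(Ω)` is a limit of nonnegative test functions. -/
theorem inner_nonpos_of_superharmonic {f q : L2 d} (hq : q ∈ gradSpace Ω)
    (hqs : ∀ ζ : Eu d → ℝ, ∀ hζ : IsTest Ω ζ, (∀ x, 0 ≤ ζ x) → 0 ≤ inner ℝ q (testGrad hζ))
    (hf : ∀ ζ : Eu d → ℝ, ∀ hζ : IsTest Ω ζ, (∀ x, 0 ≤ ζ x) → inner ℝ f (testGrad hζ) ≤ 0) :
    inner ℝ f q ≤ 0 := by
  obtain ⟨ψ, hψ, hlim⟩ := mem_gradSpace_iff_seq.1 hq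
  have hδ : ∀ n : ℕ, (0 : ℝ) < 1 / ((n : ℝ) + 1) := fun n => by positivity
  choose h k hh hk h0 k0 horth hr using fun n => exists_softPos_test (hψ n) (hδ n)
  have hkb : ∀ n, ‖testGrad (hh n) - q‖ ≤ 2 * (1 / ((n : ℝ) + 1) + ‖testGrad (hψ n) - q‖) := by
    intro n
    set r := testGrad (hψ n) - testGrad (hh n) + testGrad (hk n) with hrdef
    set e := testGrad (hψ n) - q with he
    set K := testGrad (hk n) with hK
    have h1 : K = r - e - q + testGrad (hh n) := by rw [hrdef, he]; abel
    -- The negative part is tested against itself: it is orthogonal to the positive part, and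
    -- superharmonicity makes its product with q nonnegative. Its norm is therefore bounded by those
    -- of the two error terms r and e, so the positive parts alone converge to q.
    have h2 : ‖K‖ * ‖K‖ = inner ℝ K r - inner ℝ K e - inner ℝ K q := by
      have hor : inner ℝ K (testGrad (hh n)) = 0 := horth n
      have h2' : inner ℝ K K = inner ℝ K (r - e - q + testGrad (hh n)) := congrArg (inner ℝ K) h1
      rw [← real_inner_self_eq_norm_mul_norm, h2', inner_add_right, hor, inner_sub_right,
        inner_sub_right, add_zero]
    have h3 : 0 ≤ inner ℝ K q := by
      rw [real_inner_comm]
      exact hqs _ (hk n) (k0 n)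
    have h4 := real_inner_le_norm K r
    have h5 := (abs_le.1 (abs_real_inner_le_norm K e)).1
    have h6 : ‖K‖ ≤ ‖r‖ + ‖e‖ := by
      by_contra hlt
      push Not at hlt
      nlinarith [norm_nonneg K, norm_nonneg r, norm_nonneg e]
    have h7 : testGrad (hh n) - q = e + (K - r) := by rw [h1]; abel
    have h8 := hr n
    rw [h7]
    have h9 := norm_add_le e (K - r)
    have h10 := norm_sub_le K r
    linarith
  have hlim' : Tendsto (fun n => testGrad (hh n)) atTop (𝓝 q) := by
    rw [tendsto_iff_norm_sub_tendsto_zero]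
    have h1 : Tendsto (fun n : ℕ => 2 * (1 / ((n : ℝ) + 1) + ‖testGrad (hψ n) - q‖)) atTop
        (𝓝 (2 * (0 + 0))) :=
      (tendsto_one_div_add_atTop_nhds_zero_nat.add
        (tendsto_iff_norm_sub_tendsto_zero.1 hlim)).const_mul 2
    rw [add_zero, mul_zero] at h1
    exact squeeze_zero (fun n => norm_nonneg _) hkb h1
  have h2 : Tendsto (fun n => inner ℝ f (testGrad (hh n))) atTop (𝓝 (inner ℝ f q)) :=
    tendsto_const_nhds.inner hlim'
  exact le_of_tendsto' h2 fun n => hf _ (hh n) (h0 n)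

/-- The heat decreases when the domain grows. -/
theorem heat_antitone {Ω' : Set (Eu d)} (hd : 0 < d) (hDo : IsOpen D)
    (hDb : Bornology.IsBounded D) {φ ϕ : Eu d → ℝ} (hφ : ContDiff ℝ ∞ φ) (hϕ : ContDiff ℝ ∞ ϕ)
    {c : ℝ} (hc : 0 < c) (hφc : ∀ x ∈ frontier D, c ≤ φ x) (hϕc : ∀ x ∈ frontier D, c ≤ ϕ x)
    (hΩo : IsOpen Ω) (hΩD : Ω ⊆ D) (hK : IsCompact (D \ Ω)) (hΩo' : IsOpen Ω') (hΩD' : Ω' ⊆ D)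
    (hK' : IsCompact (D \ Ω')) (h : Ω ⊆ Ω') :
    heat D φ ϕ Ω' ≤ heat D φ ϕ Ω := by
  obtain ⟨g, hg, ⟨C, hC, hCD, hgC⟩, hg0, -⟩ := exists_lifting hDo hDb hK sdiff_subset hφ
  obtain ⟨k, hk, ⟨C', hC', hCD', hkC⟩, hk0, -⟩ := exists_lifting hDo hDb hK sdiff_subset hϕ
  have hgφ : ∀ x ∈ frontier D, g x = φ x := fun x hx => hgC x fun h => by
    rw [hDo.frontier_eq] at hx; exact hx.2 (hCD h)
  have hkϕ : ∀ x ∈ frontier D, k x = ϕ x := fun x hx => hkC x fun h => by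
    rw [hDo.frontier_eq] at hx; exact hx.2 (hCD' h)
  have hg0' : ∀ x ∈ D \ Ω, g x = 0 := fun x hx => hg0.self_of_nhdsSet x hx
  have hk0' : ∀ x ∈ D \ Ω, k x = 0 := fun x hx => hk0.self_of_nhdsSet x hx
  rw [heat_eq_inner hd hDo hDb hΩo hΩD hK hφ hϕ hg hk hgφ hkϕ hg0' hk0',
    heat_eq_inner hd hDo hDb hΩo' hΩD' hK' hφ hϕ hg hk hgφ hkϕ
      (fun x hx => hg0' x ⟨hx.1, fun h' => hx.2 (h h')⟩)
      (fun x hx => hk0' x ⟨hx.1, fun h' => hx.2 (h h')⟩)]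
  set a := liftGrad hDo hDb hg
  set b := liftGrad hDo hDb hk
  set u := harmonicPart Ω a
  set v := harmonicPart Ω b
  set u' := harmonicPart Ω' a
  set v' := harmonicPart Ω' b
  have hu : u - u' ∈ gradSpace Ω' := by
    have := sub_mem (gradSpace_mono h (harmonicPart_sub_mem Ω a)) (harmonicPart_sub_mem Ω' a)
    simpa using this
  have hv : v' - v ∈ gradSpace Ω' := by
    have := sub_mem (harmonicPart_sub_mem Ω' b) (gradSpace_mono h (harmonicPart_sub_mem Ω b))
    simpa using this
  have h1 : inner ℝ v' (u - u') = 0 := inner_harmonicPart b hu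
  have h2 : inner ℝ u' (v' - v) = 0 := inner_harmonicPart a hv
  -- By the orthogonality `h1` the inner product of u' and v' is that of u and v', so this sign is
  -- the whole claim. The difference v' - v is in H¹₀(Ω') and superharmonic there, as v' is harmonic
  -- in Ω' and v subharmonic in D; it pairs nonpositively with the subharmonic u.
  have h3 : inner ℝ u (v' - v) ≤ 0 := by
    refine inner_nonpos_of_superharmonic hv (fun ζ hζ hζ0 => ?_) fun ζ hζ hζ0 => ?_
    · rw [inner_sub_left, inner_harmonicPart b (testGrad_mem hζ)]
      have := inner_harmonicPart_nonpos hDo hDb hΩD hK hk hc (fun x hx => by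
        rw [hkϕ x hx]; exact hϕc x hx) hk0 (hζ.mono hΩD') hζ0
      have e : testGrad (hζ.mono hΩD') = testGrad hζ := rfl
      rw [e] at this
      linarith
    · exact inner_harmonicPart_nonpos hDo hDb hΩD hK hg hc (fun x hx => by
        rw [hgφ x hx]; exact hφc x hx) hg0 (hζ.mono hΩD') hζ0
  rw [inner_sub_right] at h1 h2 h3
  have h4 : inner ℝ u v' = inner ℝ v' u := real_inner_comm _ _
  have h5 : inner ℝ u' v' = inner ℝ v' u' := real_inner_comm _ _
  linarith

end Monotone

end HeatShape

namespace HeatShape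

/-! ### Abstract perturbation of the variational problem in a Hilbert space -/

section Perturbation

variable {H : Type*} [NormedAddCommGroup H] [InnerProductSpace ℝ H]
  (V : Submodule ℝ H) [CompleteSpace V]

/-- The compression of `A` to `V`, completed by the identity on the orthogonal of `V`. -/
noncomputable def compression (A : H →L[ℝ] H) : H →L[ℝ] H :=
  1 + V.starProjection * (A - 1) * V.starProjection

/-- The solution `u ∈ a + V` of `A u ⊥ V`. -/
noncomputable def pertSol (a : H) (A : H →L[ℝ] H) : H :=
  a - Ring.inverse (compression V A) (V.starProjection (A a))

theorem compression_one : compression V (1 : H →L[ℝ] H) = 1 := by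
  simp [compression]

theorem contDiff_compression : ContDiff ℝ ∞ (compression V) := by
  unfold compression
  fun_prop

variable {V}

theorem inner_starProjection_eq {x v : H} (hv : v ∈ V) :
    inner ℝ (V.starProjection x) v = inner ℝ x v := by
  have := V.starProjection_inner_eq_zero x v hv
  rw [inner_sub_left] at this
  linarith

theorem starProjection_eq_zero_of_inner {x : H} (h : ∀ v ∈ V, inner ℝ x v = 0) :
    V.starProjection x = 0 := by
  have h1 : V.starProjection x ∈ V := Submodule.starProjection_apply_mem _ _
  refine inner_self_eq_zero (𝕜 := ℝ).1 ?_
  rw [inner_starProjection_eq h1, h _ h1]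

theorem pertSol_sub_mem {a : H} {A : H →L[ℝ] H} (hA : IsUnit (compression V A)) :
    pertSol V a A - a ∈ V := by
  set w := Ring.inverse (compression V A) (V.starProjection (A a)) with hw
  have h1 : compression V A w = V.starProjection (A a) := by
    rw [hw, ← mul_apply_eq_comp, Ring.mul_inverse_cancel _ hA]
    rfl
  have h2 : w = V.starProjection (A a - (A - 1) (V.starProjection w)) := by
    have : w + V.starProjection ((A - 1) (V.starProjection w)) = V.starProjection (A a) := h1
    rw [map_sub, ← this]
    abel
  have h3 : w ∈ V := by
    rw [h2]
    exact Submodule.starProjection_apply_mem _ _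
  have : pertSol V a A - a = -w := by
    rw [pertSol, ← hw]; abel
  rw [this]
  exact neg_mem h3

/-- With w = a - u in V, the compression acts on w as PA, P being the projection on V, so the
defining equation of w reads PAw = PAa, that is PAu = 0. -/
theorem inner_pertSol {a : H} {A : H →L[ℝ] H} (hA : IsUnit (compression V A)) {v : H}
    (hv : v ∈ V) : inner ℝ (A (pertSol V a A)) v = 0 := by
  set w := Ring.inverse (compression V A) (V.starProjection (A a)) with hw
  have h1 : compression V A w = V.starProjection (A a) := by
    rw [hw, ← mul_apply_eq_comp, Ring.mul_inverse_cancel _ hA]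
    rfl
  have h0 : pertSol V a A = a - w := rfl
  have h3 : V.starProjection w = w := by
    have := neg_mem (pertSol_sub_mem (a := a) hA)
    rw [h0] at this
    exact Submodule.starProjection_eq_self_iff.2 (by simpa using this)
  have h4 : w + V.starProjection ((A - 1) (V.starProjection w)) = V.starProjection (A a) := h1
  rw [← inner_starProjection_eq hv, h0, map_sub, map_sub, ← h4, h3]
  simp [h3]

theorem eq_pertSol {a u : H} {A : H →L[ℝ] H} (hA : IsUnit (compression V A)) (hu : u - a ∈ V)
    (h : ∀ v ∈ V, inner ℝ (A u) v = 0) : u = pertSol V a A := by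
  set w := pertSol V a A - u with hw
  have hwV : w ∈ V := by
    have := sub_mem (pertSol_sub_mem (a := a) hA) hu
    simpa [hw] using this
  have h1 : V.starProjection (A w) = 0 := starProjection_eq_zero_of_inner fun v hv => by
    rw [hw, map_sub, inner_sub_left, h v hv, inner_pertSol hA hv, sub_zero]
  have h2 : V.starProjection w = w := Submodule.starProjection_eq_self_iff.2 hwV
  have h3 : compression V A w = 0 := by
    change w + V.starProjection ((A - 1) (V.starProjection w)) = 0
    rw [h2]
    simp [h1, h2]
  have h4 : w = 0 := by
    have : (Ring.inverse (compression V A) * compression V A) w = 0 := by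
      rw [mul_apply_eq_comp, h3, map_zero]
    rwa [Ring.inverse_mul_cancel _ hA] at this
  exact (sub_eq_zero.1 (hw ▸ h4)).symm

theorem eventually_hasDerivAt_of_contDiffAt {F : Type*} [NormedAddCommGroup F] [NormedSpace ℝ F]
    {f : ℝ → F} {t : ℝ} (hf : ContDiffAt ℝ ∞ f t) : ∀ᶠ s in 𝓝 t, HasDerivAt f (deriv f s) s := by
  have h1 : ∀ᶠ s in 𝓝 t, ContDiffAt ℝ 1 f s :=
    (hf.of_le (by exact_mod_cast le_top)).eventually (by simp)
  filter_upwards [h1] with s hs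
  exact (hs.differentiableAt (by simp)).hasDerivAt

theorem contDiffAt_deriv {F : Type*} [NormedAddCommGroup F] [NormedSpace ℝ F]
    {f : ℝ → F} {t : ℝ} (hf : ContDiffAt ℝ ∞ f t) : ContDiffAt ℝ ∞ (deriv f) t := by
  have h := (hf.fderiv_right (m := ∞) (by simp)).clm_apply
    (contDiffAt_const (c := (1 : ℝ)))
  exact h

/-- Differentiate the identity f - a = P(f - a). -/
theorem deriv_mem_of_eventually {f : ℝ → H} {a : H} {t : ℝ} (hf : DifferentiableAt ℝ f t)
    (h : ∀ᶠ s in 𝓝 t, f s - a ∈ V) : deriv f t ∈ V := by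
  have h1 : HasDerivAt (fun s => f s - a) (deriv f t) t := hf.hasDerivAt.sub_const a
  have h2 := ((V.starProjection).hasFDerivAt (x := f t - a)).comp_hasDerivAt t h1
  have h3 : (V.starProjection ∘ fun s => f s - a) =ᶠ[𝓝 t] fun s => f s - a := by
    filter_upwards [h] with s hs
    exact Submodule.starProjection_eq_self_iff.2 hs
  have h4 := h2.unique (h1.congr_of_eventuallyEq h3)
  exact Submodule.starProjection_eq_self_iff.1 h4

variable (V) [CompleteSpace H]

theorem eventually_isUnit_compression : ∀ᶠ A in 𝓝 (1 : H →L[ℝ] H), IsUnit (compression V A) := by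
  have h1 : ContinuousAt (compression V) 1 := (contDiff_compression V).continuous.continuousAt
  have h2 : {x : H →L[ℝ] H | IsUnit x} ∈ 𝓝 (compression V 1) := by
    rw [compression_one]
    exact Units.isOpen.mem_nhds isUnit_one
  exact h1 h2

/-- Working with the compression on all of H, rather than with an operator on V, leaves a single
ring inversion, smooth near the unit `compression V 1 = 1`. -/
theorem contDiffAt_pertSol (a : H) : ContDiffAt ℝ ∞ (pertSol V a) 1 := by
  unfold pertSol
  have h1 : ContDiffAt ℝ ∞ (fun A : H →L[ℝ] H => Ring.inverse (compression V A)) 1 := by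
    refine ContDiffAt.comp (g := Ring.inverse) 1 ?_ (contDiff_compression V).contDiffAt
    rw [compression_one]
    exact contDiffAt_ringInverse ℝ (1 : (H →L[ℝ] H)ˣ)
  have h2 : ContDiff ℝ ∞ (fun A : H →L[ℝ] H => V.starProjection (A a)) := by fun_prop
  exact contDiffAt_const.sub (h1.clm_apply h2.contDiffAt)

variable {V}

/-- The energy `⟨A u, v⟩` of the solutions associated with `a` and `b`. -/
noncomputable def pertEnergy (V : Submodule ℝ H) [CompleteSpace V] (a b : H) (A : H →L[ℝ] H) : ℝ :=
  inner ℝ (A (pertSol V a A)) (pertSol V b A)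

theorem contDiffAt_pertEnergy (a b : H) : ContDiffAt ℝ ∞ (pertEnergy V a b) 1 :=
  (contDiffAt_id.clm_apply (contDiffAt_pertSol V a)).inner ℝ (contDiffAt_pertSol V b)

section Curve

variable {A A₁ : ℝ → H →L[ℝ] H}

theorem pertSol_curve (hA : ContDiffAt ℝ ∞ A 0) (h0 : A 0 = 1) (a : H) :
    ContDiffAt ℝ ∞ (fun t => pertSol V a (A t)) 0 :=
  ContDiffAt.comp (g := pertSol V a) 0 (by rw [h0]; exact contDiffAt_pertSol V a) hA

variable (V) in
/-- First and second derivative of the energy along a curve of symmetric operators. -/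
theorem pertEnergy_curve (hA : ContDiffAt ℝ ∞ A 0) (h0 : A 0 = 1)
    (hsym : ∀ᶠ t in 𝓝 0, ∀ x y, inner ℝ (A t x) y = inner ℝ x (A t y)) (a b : H) :
    HasDerivAt (fun t => pertEnergy V a b (A t))
      (inner ℝ (deriv A 0 (pertSol V a 1)) (pertSol V b 1)) 0 ∧
    HasDerivAt (deriv fun t => pertEnergy V a b (A t))
      (inner ℝ (deriv (deriv A) 0 (pertSol V a 1)) (pertSol V b 1)
        - 2 * inner ℝ (V.starProjection (deriv A 0 (pertSol V a 1)))
          (V.starProjection (deriv A 0 (pertSol V b 1)))) 0 := by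
  have hcont : ContinuousAt A 0 := hA.continuousAt
  have hunit : ∀ᶠ t in 𝓝 0, IsUnit (compression V (A t)) := by
    have : Tendsto A (𝓝 0) (𝓝 1) := h0 ▸ hcont
    exact this (eventually_isUnit_compression V)
  have key : ∀ a : H, ∀ᶠ t in 𝓝 (0 : ℝ),
      HasDerivAt (fun t => pertSol V a (A t)) (deriv (fun t => pertSol V a (A t)) t) t ∧
      deriv (fun t => pertSol V a (A t)) t ∈ V := by
    intro a
    filter_upwards [eventually_hasDerivAt_of_contDiffAt (pertSol_curve (V := V) hA h0 a),
      hunit.eventually_nhds] with t h1 h2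
    refine ⟨h1, deriv_mem_of_eventually (a := a) h1.differentiableAt ?_⟩
    filter_upwards [h2] with s hs using pertSol_sub_mem hs
  have hAd := eventually_hasDerivAt_of_contDiffAt hA
  have hE : ∀ᶠ t in 𝓝 (0 : ℝ), HasDerivAt (fun t => pertEnergy V a b (A t))
      (inner ℝ (deriv A t (pertSol V a (A t))) (pertSol V b (A t))) t := by
    filter_upwards [key a, key b, hAd, hunit, hsym] with t ha hb hA' hu hs
    have h1 := (hA'.clm_apply ha.1).inner ℝ hb.1
    refine h1.congr_deriv ?_
    -- The derivatives of the two solutions lie in V, to which Au and, by symmetry, Av are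
    -- orthogonal; only the derivative of A survives.
    have h2 : inner ℝ (deriv (fun t => pertSol V a (A t)) t) (A t (pertSol V b (A t))) = 0 := by
      rw [real_inner_comm]
      exact inner_pertSol hu ha.2
    rw [inner_pertSol hu hb.2, zero_add, inner_add_left, hs (deriv _ t), h2, add_zero]
  refine ⟨by simpa [h0] using hE.self_of_nhds, ?_⟩
  have hder : deriv (fun t => pertEnergy V a b (A t)) =ᶠ[𝓝 0] fun t =>
      inner ℝ (deriv A t (pertSol V a (A t))) (pertSol V b (A t)) := by
    filter_upwards [hE] with t ht using ht.deriv
  refine HasDerivAt.congr_of_eventuallyEq ?_ hder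
  obtain ⟨ha1, ha2⟩ := (key a).self_of_nhds
  obtain ⟨hb1, hb2⟩ := (key b).self_of_nhds
  have hA1 := hAd.self_of_nhds
  have hA2 := (eventually_hasDerivAt_of_contDiffAt (contDiffAt_deriv hA)).self_of_nhds
  have hsym1 : ∀ x y, inner ℝ (deriv A 0 x) y = inner ℝ x (deriv A 0 y) := by
    intro x y
    have h1 : HasDerivAt (fun t => inner ℝ (A t x) y) (inner ℝ (deriv A 0 x) y) 0 := by
      have := (hA1.clm_apply (hasDerivAt_const 0 x)).inner ℝ (hasDerivAt_const 0 y)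
      simpa using this
    have h2 : HasDerivAt (fun t => inner ℝ x (A t y)) (inner ℝ x (deriv A 0 y)) 0 := by
      have := (hasDerivAt_const (0 : ℝ) x).inner ℝ (hA1.clm_apply (hasDerivAt_const 0 y))
      simpa using this
    refine h1.unique (h2.congr_of_eventuallyEq ?_)
    filter_upwards [hsym] with t ht using ht x y
  -- Differentiating ⟨A u, v⟩ = 0 for fixed v in V at time zero, where A = 1, shows that A'u + u' is
  -- orthogonal to V; as u' is in V, it equals -PA'u.
  have hproj : ∀ c : H, HasDerivAt (fun t => pertSol V c (A t))
        (deriv (fun t => pertSol V c (A t)) 0) 0 → deriv (fun t => pertSol V c (A t)) 0 ∈ V →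
      deriv (fun t => pertSol V c (A t)) 0
        = -V.starProjection (deriv A 0 (pertSol V c 1)) := by
    intro c hc1 hc2
    have h1 : ∀ v ∈ V, inner ℝ (deriv A 0 (pertSol V c 1)
        + deriv (fun t => pertSol V c (A t)) 0) v = 0 := by
      intro v hv
      have h2 := (hA1.clm_apply hc1).inner ℝ (hasDerivAt_const (0 : ℝ) v)
      have h3 : (fun t => inner ℝ (A t (pertSol V c (A t))) v) =ᶠ[𝓝 0] fun _ => (0 : ℝ) := by
        filter_upwards [hunit] with t ht using inner_pertSol ht hv
      have h4 := h2.unique ((hasDerivAt_const (0 : ℝ) (0 : ℝ)).congr_of_eventuallyEq h3)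
      simpa [h0] using h4
    have h5 := starProjection_eq_zero_of_inner h1
    rw [map_add, Submodule.starProjection_eq_self_iff.2 hc2] at h5
    exact (eq_neg_of_add_eq_zero_right h5)
  have h1 := (hA2.clm_apply ha1).inner ℝ hb1
  refine h1.congr_deriv ?_
  rw [hproj a ha1 ha2, hproj b hb1 hb2, h0]
  set u := pertSol V a 1
  set v := pertSol V b 1
  have hm : ∀ x, V.starProjection x ∈ V := fun x => Submodule.starProjection_apply_mem _ _
  have e1 : inner ℝ (deriv A 0 u) (V.starProjection (deriv A 0 v))
      = inner ℝ (V.starProjection (deriv A 0 u)) (V.starProjection (deriv A 0 v)) :=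
    (inner_starProjection_eq (hm _)).symm
  have e2 : inner ℝ (deriv A 0 (V.starProjection (deriv A 0 u))) v
      = inner ℝ (V.starProjection (deriv A 0 u)) (V.starProjection (deriv A 0 v)) := by
    rw [hsym1, real_inner_comm, ← inner_starProjection_eq (hm _), real_inner_comm]
  rw [inner_neg_right, inner_add_left, map_neg, inner_neg_left, e1, e2]
  ring

end Curve

end Perturbation

end HeatShape

/-! ### Smooth parameter dependence in spaces of continuous functions, and multiplication operators
-/

namespace HeatShape

/-- A bilinear map of norm at most one. -/
noncomputable def bilinOfBound {X Y Z : Type*} [NormedAddCommGroup X] [NormedSpace ℝ X]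
    [NormedAddCommGroup Y] [NormedSpace ℝ Y] [NormedAddCommGroup Z] [NormedSpace ℝ Z]
    (f : X → Y → Z) (h1 : ∀ x x' y, f (x + x') y = f x y + f x' y)
    (h2 : ∀ (c : ℝ) x y, f (c • x) y = c • f x y) (h3 : ∀ x y y', f x (y + y') = f x y + f x y')
    (h4 : ∀ (c : ℝ) x y, f x (c • y) = c • f x y) (h : ∀ x y, ‖f x y‖ ≤ ‖x‖ * ‖y‖) :
    X →L[ℝ] Y →L[ℝ] Z :=
  LinearMap.mkContinuous₂ (LinearMap.mk₂ ℝ f h1 h2 h3 h4) 1 fun x y => by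
    rw [one_mul]
    exact h x y

section Curry

variable {P : Type} [NormedAddCommGroup P] {E : Type} [NormedAddCommGroup E] {L : Set E}

/-- A function of a parameter and of a point, seen as a function of the parameter with values in
the continuous functions on `L`. -/
def curryOn (L : Set E) {F : Type*} [TopologicalSpace F] {N : P × E → F} (hN : Continuous N)
    (p : P) : C(L, F) :=
  ⟨fun x => N (p, x), by fun_prop⟩

theorem continuous_curryOn {F : Type*} [TopologicalSpace F] {N : P × E → F} (hN : Continuous N) :
    Continuous (curryOn L hN) := by
  refine ContinuousMap.continuous_of_continuous_uncurry _ ?_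
  change Continuous fun q : P × L => N (q.1, q.2)
  fun_prop

section

variable [NormedSpace ℝ P] [CompactSpace L]

/-- A continuous family of linear maps as a linear map with values in continuous functions. -/
noncomputable def familyToLinear (L : Set E) [CompactSpace L] (P F : Type) [NormedAddCommGroup P]
    [NormedSpace ℝ P] [NormedAddCommGroup F] [NormedSpace ℝ F] :
    C(L, P →L[ℝ] F) →L[ℝ] P →L[ℝ] C(L, F) :=
  LinearMap.mkContinuous₂
    (LinearMap.mk₂ ℝ (fun (f : C(L, P →L[ℝ] F)) (v : P) => (⟨fun x => f x v, by fun_prop⟩ : C(L, F)))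
      (fun _ _ _ => by ext; simp) (fun _ _ _ => by ext; simp) (fun _ _ _ => by ext; simp)
      (fun _ _ _ => by ext; simp)) 1 (fun f v => by
        rw [one_mul]
        refine (ContinuousMap.norm_le _ (mul_nonneg (norm_nonneg f) (norm_nonneg v))).2 fun x => ?_
        exact ((f x).le_opNorm v).trans (by gcongr; exact f.norm_coe_le_norm x))

/-- Pointwise differentiability becomes differentiability for the uniform norm. By compactness of L,
the derivative stays within ε of its value at p on a ball around p, uniformly in x, and the mean
value inequality then bounds the remainder uniformly in x. -/
theorem hasFDerivAt_curryOn {F : Type} [NormedAddCommGroup F] [NormedSpace ℝ F] {N : P × E → F}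
    (hN : Continuous N) {N' : P × E → P →L[ℝ] F} (hN' : Continuous N')
    (h : ∀ p x, HasFDerivAt (fun q => N (q, x)) (N' (p, x)) p) (p : P) :
    HasFDerivAt (curryOn L hN) (familyToLinear L P F (curryOn L hN' p)) p := by
  rw [hasFDerivAt_iff_isLittleO, Asymptotics.isLittleO_iff]
  intro ε hε
  have hc := (continuous_curryOn (L := L) hN').tendsto p
  rw [ContinuousMap.tendsto_iff_tendstoUniformly, Metric.tendstoUniformly_iff] at hc
  obtain ⟨δ, hδ, hball⟩ := Metric.eventually_nhds_iff_ball.1 (hc ε hε)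
  filter_upwards [Metric.ball_mem_nhds p hδ] with q hq
  refine (ContinuousMap.norm_le _ (by positivity)).2 fun x => ?_
  have := (convex_ball p δ).norm_image_sub_le_of_norm_hasFDerivWithin_le'
    (f := fun q => N (q, (x : E))) (f' := fun q => N' (q, x)) (φ := N' (p, x)) (C := ε)
    (fun r _ => (h r x).hasFDerivWithinAt) (fun r hr => ?_) (Metric.mem_ball_self hδ) hq
  · exact this
  · have h1 := hball r hr
    have h2 := h1 x
    rw [dist_comm, dist_eq_norm] at h2
    exact h2.le

variable [NormedSpace ℝ E]

/-- The target F is quantified inside the induction, because the derivative is again a curried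
family, now with values in `P →L[ℝ] F`. -/
theorem contDiff_curryOn_nat (n : ℕ) : ∀ {F : Type} [NormedAddCommGroup F] [NormedSpace ℝ F]
    {N : P × E → F} (hN : ContDiff ℝ ∞ N), ContDiff ℝ n (curryOn L hN.continuous) := by
  induction n with
  | zero => intro F _ _ N hN; exact contDiff_zero.2 (continuous_curryOn _)
  | succ n ih =>
    intro F _ _ N hN
    have hN' : ContDiff ℝ ∞ fun q : P × E =>
        (fderiv ℝ N q).comp (ContinuousLinearMap.inl ℝ P E) :=
      (hN.fderiv_right (m := ∞) (by simp)).clm_comp contDiff_const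
    refine contDiff_succ_iff_hasFDerivAt.2 ⟨fun p => familyToLinear L P F
      (curryOn L hN'.continuous p), (ih hN').continuousLinearMap_comp (familyToLinear L P F), fun p => ?_⟩
    refine hasFDerivAt_curryOn hN.continuous hN'.continuous (fun p x => ?_) p
    have h1 : HasFDerivAt N (fderiv ℝ N (p, x)) (p, x) :=
      (hN.differentiable (by simp) _).hasFDerivAt
    have h2 : HasFDerivAt (fun q : P => (q, x)) (ContinuousLinearMap.inl ℝ P E) p :=
      hasFDerivAt_prodMk_left p x
    exact h1.comp p h2

theorem contDiff_curryOn {F : Type} [NormedAddCommGroup F] [NormedSpace ℝ F]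
    {N : P × E → F} (hN : ContDiff ℝ ∞ N) : ContDiff ℝ ∞ (curryOn L hN.continuous) :=
  contDiff_infty.2 fun n => contDiff_curryOn_nat n hN

end

end Curry

section Multiplication

variable {d : ℕ} {L : Set (Eu d)}

/-- Extension by zero of a function on `L`. -/
noncomputable def extendZero {F : Type*} [Zero F] (N : L → F) : Eu d → F :=
  Function.extend Subtype.val N 0

theorem extendZero_mem {F : Type*} [Zero F] (N : L → F) {x : Eu d} (hx : x ∈ L) :
    extendZero N x = N ⟨x, hx⟩ :=
  Subtype.val_injective.extend_apply N 0 ⟨x, hx⟩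

theorem extendZero_notMem {F : Type*} [Zero F] (N : L → F) {x : Eu d} (hx : x ∉ L) :
    extendZero N x = 0 :=
  Function.extend_apply' _ _ _ (by rintro ⟨y, rfl⟩; exact hx y.2)

theorem extendZero_eq {F : Type*} [Zero F] {N : L → F} {M : Eu d → F} (h1 : ∀ x : L, N x = M x)
    (h2 : ∀ x ∉ L, M x = 0) : extendZero N = M := by
  funext x
  by_cases hx : x ∈ L
  · rw [extendZero_mem N hx, h1]
  · rw [extendZero_notMem N hx, h2 x hx]

theorem extendZero_add {F : Type*} [NormedAddCommGroup F] (N M : C(L, F)) (x : Eu d) :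
    extendZero (N + M) x = extendZero N x + extendZero M x := by
  by_cases hx : x ∈ L
  · simp [extendZero_mem _ hx]
  · simp [extendZero_notMem _ hx]

theorem extendZero_smul {F : Type*} [NormedAddCommGroup F] [NormedSpace ℝ F] (c : ℝ) (N : C(L, F))
    (x : Eu d) : extendZero (c • N) x = c • extendZero N x := by
  by_cases hx : x ∈ L
  · simp [extendZero_mem _ hx]
  · simp [extendZero_notMem _ hx]

variable [CompactSpace L]

theorem isCompact_of_compactSpace : IsCompact L := isCompact_iff_compactSpace.2 ‹_›

theorem stronglyMeasurable_extendZero {F : Type*} [NormedAddCommGroup F] (N : C(L, F)) :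
    StronglyMeasurable (extendZero N) := by
  refine (MeasurableEmbedding.subtype_coe
    (isCompact_of_compactSpace (L := L)).isClosed.measurableSet).stronglyMeasurable_extend ?_
    stronglyMeasurable_zero
  exact N.continuous.stronglyMeasurable

theorem norm_extendZero_le {F : Type*} [NormedAddCommGroup F] (N : C(L, F)) (x : Eu d) :
    ‖extendZero N x‖ ≤ ‖N‖ := by
  by_cases hx : x ∈ L
  · rw [extendZero_mem N hx]; exact N.norm_coe_le_norm _
  · rw [extendZero_notMem N hx, norm_zero]; exact norm_nonneg _

theorem memLp_mul (N : C(L, Eu d →L[ℝ] Eu d)) (f : L2 d) :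
    MemLp (fun x => extendZero N x (f x)) 2 volume := by
  refine MemLp.of_le_mul (c := ‖N‖) (Lp.memLp f) ?_ (Eventually.of_forall fun x => ?_)
  · exact (ContinuousLinearMap.apply ℝ (Eu d)).flip.aestronglyMeasurable_comp₂
      (stronglyMeasurable_extendZero N).aestronglyMeasurable (Lp.aestronglyMeasurable f)
  · exact ((extendZero N x).le_opNorm _).trans (by gcongr; exact norm_extendZero_le N x)

/-- The product of a matrix field supported in `L` and of an element of `L²`. -/
noncomputable def mulL2 (N : C(L, Eu d →L[ℝ] Eu d)) (f : L2 d) : L2 d := (memLp_mul N f).toLp _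

theorem coeFn_mulL2 (N : C(L, Eu d →L[ℝ] Eu d)) (f : L2 d) :
    mulL2 N f =ᵐ[volume] fun x => extendZero N x (f x) :=
  (memLp_mul N f).coeFn_toLp

theorem mulL2_add_left (N M : C(L, Eu d →L[ℝ] Eu d)) (f : L2 d) :
    mulL2 (N + M) f = mulL2 N f + mulL2 M f := by
  apply Lp.ext
  filter_upwards [coeFn_mulL2 (N + M) f, coeFn_mulL2 N f, coeFn_mulL2 M f,
    Lp.coeFn_add (mulL2 N f) (mulL2 M f)] with x e1 e2 e3 e4
  rw [e1, e4, Pi.add_apply, e2, e3, extendZero_add, add_apply]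

theorem mulL2_smul_left (c : ℝ) (N : C(L, Eu d →L[ℝ] Eu d)) (f : L2 d) :
    mulL2 (c • N) f = c • mulL2 N f := by
  apply Lp.ext
  filter_upwards [coeFn_mulL2 (c • N) f, coeFn_mulL2 N f,
    Lp.coeFn_smul c (mulL2 N f)] with x e1 e2 e3
  rw [e1, e3, Pi.smul_apply, e2, extendZero_smul, smul_apply]

theorem mulL2_add_right (N : C(L, Eu d →L[ℝ] Eu d)) (f g : L2 d) :
    mulL2 N (f + g) = mulL2 N f + mulL2 N g := by
  apply Lp.ext
  filter_upwards [coeFn_mulL2 N (f + g), coeFn_mulL2 N f, coeFn_mulL2 N g, Lp.coeFn_add f g,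
    Lp.coeFn_add (mulL2 N f) (mulL2 N g)] with x e1 e2 e3 e4 e5
  rw [e1, e5, Pi.add_apply, e2, e3, e4, Pi.add_apply, map_add]

theorem mulL2_smul_right (c : ℝ) (N : C(L, Eu d →L[ℝ] Eu d)) (f : L2 d) :
    mulL2 N (c • f) = c • mulL2 N f := by
  apply Lp.ext
  filter_upwards [coeFn_mulL2 N (c • f), coeFn_mulL2 N f, Lp.coeFn_smul c f,
    Lp.coeFn_smul c (mulL2 N f)] with x e1 e2 e3 e4
  rw [e1, e4, Pi.smul_apply, e2, e3, Pi.smul_apply, map_smul]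

theorem norm_mulL2_le (N : C(L, Eu d →L[ℝ] Eu d)) (f : L2 d) : ‖mulL2 N f‖ ≤ ‖N‖ * ‖f‖ := by
  refine Lp.norm_le_mul_norm_of_ae_le_mul ?_
  filter_upwards [coeFn_mulL2 N f] with x e1
  rw [e1]
  exact ((extendZero N x).le_opNorm _).trans (by gcongr; exact norm_extendZero_le N x)

/-- Pointwise multiplication by a matrix field supported in `L`, as an operator on `L²`. -/
noncomputable def mulOp (L : Set (Eu d)) [CompactSpace L] :
    C(L, Eu d →L[ℝ] Eu d) →L[ℝ] L2 d →L[ℝ] L2 d :=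
  bilinOfBound (X := C(L, Eu d →L[ℝ] Eu d)) (Y := L2 d) (Z := L2 d) (mulL2 (L := L))
    (fun N M f => mulL2_add_left N M f) (fun c N f => mulL2_smul_left c N f)
    (fun N f g => mulL2_add_right N f g) (fun c N f => mulL2_smul_right c N f)
    (fun N f => norm_mulL2_le N f)

theorem coeFn_mulOp (N : C(L, Eu d →L[ℝ] Eu d)) (f : L2 d) :
    mulOp L N f =ᵐ[volume] fun x => extendZero N x (f x) := coeFn_mulL2 N f

theorem integrable_extendZero (N : C(L, ℝ)) : Integrable (extendZero N) := by
  have hL := isCompact_of_compactSpace (L := L)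
  have h1 : MemLp (extendZero N) 1 volume :=
    HasCompactSupport.memLp_of_bound
      (HasCompactSupport.intro hL fun x hx => extendZero_notMem _ hx)
      (stronglyMeasurable_extendZero N).aestronglyMeasurable ‖N‖
      (Eventually.of_forall (norm_extendZero_le N))
  exact memLp_one_iff_integrable.1 h1

/-- Integration over `Ω` of the functions supported in `L`. -/
noncomputable def integralOn (L Ω : Set (Eu d)) [CompactSpace L] : C(L, ℝ) →L[ℝ] ℝ :=
  LinearMap.mkContinuous
    { toFun := fun N => ∫ x in Ω, extendZero N x
      map_add' := fun N M => by
        rw [← integral_add (integrable_extendZero N).integrableOn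
          (integrable_extendZero M).integrableOn]
        exact integral_congr_ae (Eventually.of_forall fun x => extendZero_add N M x)
      map_smul' := fun c N => by
        rw [RingHom.id_apply, ← integral_smul]
        exact integral_congr_ae (Eventually.of_forall fun x => extendZero_smul c N x) }
    (volume.real L) (fun N => by
      have hL := isCompact_of_compactSpace (L := L)
      have hind : ∀ x, ‖extendZero N x‖ ≤ L.indicator (fun _ => ‖N‖) x := by
        intro x
        by_cases hx : x ∈ L
        · rw [indicator_of_mem hx]; exact norm_extendZero_le N x
        · rw [extendZero_notMem _ hx, indicator_of_notMem hx, norm_zero]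
      have hi : Integrable (L.indicator fun _ => ‖N‖) (volume : Measure (Eu d)) :=
        (integrable_indicator_iff hL.isClosed.measurableSet).2
          (integrableOn_const hL.measure_lt_top.ne)
      calc ‖∫ x in Ω, extendZero N x‖ ≤ ∫ x in Ω, ‖extendZero N x‖ :=
            norm_integral_le_integral_norm _
        _ ≤ ∫ x, ‖extendZero N x‖ :=
            setIntegral_le_integral (integrable_extendZero N).norm
              (Eventually.of_forall fun _ => norm_nonneg _)
        _ ≤ ∫ x, L.indicator (fun _ => ‖N‖) x :=
            integral_mono (integrable_extendZero N).norm hi hind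
        _ = volume.real L * ‖N‖ := by
            rw [integral_indicator hL.isClosed.measurableSet, setIntegral_const, smul_eq_mul])

theorem integralOn_apply (Ω : Set (Eu d)) (N : C(L, ℝ)) :
    integralOn L Ω N = ∫ x in Ω, extendZero N x := rfl

end Multiplication

end HeatShape

namespace HeatShape

/-! ### Second order expansion of the determinant and of the pullback matrix -/

section Det

variable {d : ℕ}

/-- The trace of an endomorphism, as a continuous linear form. -/
noncomputable def traceL (d : ℕ) : (Eu d →L[ℝ] Eu d) →L[ℝ] ℝ :=
  LinearMap.toContinuousLinearMap
    ((LinearMap.trace ℝ (Eu d)).comp (ContinuousLinearMap.coeLM ℝ))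

theorem traceL_apply (A : Eu d →L[ℝ] Eu d) :
    traceL d A = LinearMap.trace ℝ (Eu d) (A : Eu d →ₗ[ℝ] Eu d) := rfl

theorem contDiff_det : ContDiff ℝ ∞ fun A : Eu d →L[ℝ] Eu d => A.det := by
  let b := (EuclideanSpace.basisFun (Fin d) ℝ).toBasis
  have h : (fun A : Eu d →L[ℝ] Eu d => A.det) = fun A : Eu d →L[ℝ] Eu d =>
      ∑ σ : Equiv.Perm (Fin d), (Equiv.Perm.sign σ : ℤ) •
        ∏ i, LinearMap.toMatrix b b (A : Eu d →ₗ[ℝ] Eu d) (σ i) i := by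
    funext A
    rw [ContinuousLinearMap.det, ← LinearMap.det_toMatrix b, Matrix.det_apply]
    rfl
  rw [h]
  refine ContDiff.sum fun σ _ => ContDiff.const_smul _ (contDiff_prod fun i _ => ?_)
  have : (fun A : Eu d →L[ℝ] Eu d => LinearMap.toMatrix b b (A : Eu d →ₗ[ℝ] Eu d) (σ i) i)
      = fun A : Eu d →L[ℝ] Eu d => (A (b i)) (σ i) := by
    funext A
    simp [LinearMap.toMatrix_apply, b]
  rw [this]
  have h2 : ContDiff ℝ ∞ fun A : Eu d →L[ℝ] Eu d => A (b i) := by fun_prop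
  exact (EuclideanSpace.proj (σ i) : Eu d →L[ℝ] ℝ).contDiff.comp h2

theorem det_mul' (A B : Eu d →L[ℝ] Eu d) : (A * B).det = A.det * B.det := by
  simp only [ContinuousLinearMap.det]
  rw [← LinearMap.det_comp]
  rfl

theorem det_one' : (1 : Eu d →L[ℝ] Eu d).det = 1 := by
  simp only [ContinuousLinearMap.det]
  exact LinearMap.det_id

theorem hasFDerivAt_det_one : HasFDerivAt (fun A : Eu d →L[ℝ] Eu d => A.det) (traceL d) 1 := by
  have hd : HasFDerivAt (fun A : Eu d →L[ℝ] Eu d => A.det)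
      (fderiv ℝ (fun A : Eu d →L[ℝ] Eu d => A.det) 1) 1 :=
    (contDiff_det.differentiable (by simp) _).hasFDerivAt
  convert hd
  ext M
  have hline : HasDerivAt (fun r : ℝ => (1 : Eu d →L[ℝ] Eu d) + r • M) M 0 := by
    simpa using ((hasDerivAt_id (0 : ℝ)).smul_const M).const_add 1
  have h1 : HasDerivAt (fun r : ℝ => ((1 : Eu d →L[ℝ] Eu d) + r • M).det)
      (fderiv ℝ (fun A : Eu d →L[ℝ] Eu d => A.det) 1 M) 0 := by
    have h0 : HasFDerivAt (fun A : Eu d →L[ℝ] Eu d => A.det)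
        (fderiv ℝ (fun A : Eu d →L[ℝ] Eu d => A.det) 1) ((1 : Eu d →L[ℝ] Eu d) + (0 : ℝ) • M) := by
      have e : (1 : Eu d →L[ℝ] Eu d) + (0 : ℝ) • M = 1 := by
        ext1 v
        rw [add_apply, smul_apply, zero_smul, add_zero]
      rw [e]
      exact hd
    exact h0.comp_hasDerivAt 0 hline
  let b := (EuclideanSpace.basisFun (Fin d) ℝ).toBasis
  set m := LinearMap.toMatrix b b (M : Eu d →ₗ[ℝ] Eu d) with hm
  -- The remainder of second order in r of det(1 + r m), in the form given by
  -- `Matrix.det_one_add_smul`.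
  set q : Polynomial ℝ :=
    (1 + (Polynomial.X : Polynomial ℝ) • m.map ⇑Polynomial.C).det.divX.divX
  have h2 : (fun r : ℝ => ((1 : Eu d →L[ℝ] Eu d) + r • M).det)
      = fun r => 1 + m.trace * r + Polynomial.eval r q * r ^ 2 := by
    funext r
    rw [← Matrix.det_one_add_smul r m, ContinuousLinearMap.det, ← LinearMap.det_toMatrix b]
    congr 1
    have : (((1 : Eu d →L[ℝ] Eu d) + r • M : Eu d →L[ℝ] Eu d) : Eu d →ₗ[ℝ] Eu d)
        = LinearMap.id + r • (M : Eu d →ₗ[ℝ] Eu d) := rfl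
    rw [this, map_add, map_smul, LinearMap.toMatrix_id]
  have h3 : HasDerivAt (fun r : ℝ => 1 + m.trace * r + Polynomial.eval r q * r ^ 2)
      m.trace 0 := by
    have e1 := ((hasDerivAt_id (0 : ℝ)).const_mul m.trace).const_add 1
    have e2 := (q.hasDerivAt 0).mul ((hasDerivAt_id (0 : ℝ)).pow 2)
    have e3 := e1.add e2
    refine e3.congr_deriv ?_
    simp
  rw [h2] at h1
  rw [h1.unique h3, traceL_apply, LinearMap.trace_eq_matrix_trace ℝ b]

/-- Jacobi's formula: factoring det b(s) = det b(t) · det(b(t)⁻¹ b(s)) reduces it to the derivative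
of the determinant at the identity. -/
theorem hasDerivAt_det {b : ℝ → Eu d →L[ℝ] Eu d} {b' : Eu d →L[ℝ] Eu d} {t : ℝ}
    (hb : HasDerivAt b b' t) (hu : IsUnit (b t)) :
    HasDerivAt (fun s => (b s).det) ((b t).det * traceL d (Ring.inverse (b t) * b')) t := by
  have h1 : HasDerivAt (fun s => Ring.inverse (b t) * b s) (Ring.inverse (b t) * b') t :=
    hb.const_mul _
  have h2 : HasFDerivAt (fun A : Eu d →L[ℝ] Eu d => A.det) (traceL d)
      (Ring.inverse (b t) * b t) := by
    rw [Ring.inverse_mul_cancel _ hu]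
    exact hasFDerivAt_det_one
  have h3 := (h2.comp_hasDerivAt t h1).const_mul (b t).det
  refine h3.congr_of_eventuallyEq (Eventually.of_forall fun s => ?_)
  simp only [Function.comp_def]
  rw [← det_mul', ← mul_assoc, Ring.mul_inverse_cancel _ hu, one_mul]

theorem hasDerivAt_inverse {R : Type*} [NormedRing R] [NormedAlgebra ℝ R] [CompleteSpace R]
    {b : ℝ → R} {b' : R} {t : ℝ} (hb : HasDerivAt b b' t) (hu : IsUnit (b t)) :
    HasDerivAt (fun s => Ring.inverse (b s))
      (-(Ring.inverse (b t) * b' * Ring.inverse (b t))) t := by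
  obtain ⟨u, hu⟩ := hu
  have h1 : HasFDerivAt Ring.inverse (-ContinuousLinearMap.mulLeftRight ℝ R ↑u⁻¹ ↑u⁻¹) (b t) := by
    rw [← hu]; exact hasFDerivAt_ringInverse u
  have h2 := h1.comp_hasDerivAt t hb
  refine h2.congr_deriv ?_
  rw [← hu, Ring.inverse_unit]
  simp

theorem eventually_isUnit {R : Type*} [NormedRing R] [CompleteSpace R] {X : Type*}
    [TopologicalSpace X] {b : X → R} {x : X} (hb : ContinuousAt b x) (hu : IsUnit (b x)) :
    ∀ᶠ y in 𝓝 x, IsUnit (b y) :=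
  hb (Units.isOpen.mem_nhds hu)

section StarAlgebra

variable {R : Type*} [NormedRing R] [NormedAlgebra ℝ R] {b b₁ : ℝ → R} {j k : R}

section

variable [CompleteSpace R]

theorem hasDerivAt_inverse_mul (h0 : b 0 = 1) (hb : HasDerivAt b (b₁ 0) 0) (h1 : b₁ 0 = j)
    (hb₁ : HasDerivAt b₁ k 0) :
    HasDerivAt (fun t => Ring.inverse (b t) * b₁ t) (k - j * j) 0 := by
  have h2 := hasDerivAt_inverse hb (by rw [h0]; exact isUnit_one)
  refine (h2.mul hb₁).congr_deriv ?_
  simp only [h0, h1, Ring.inverse_one, one_mul, mul_one]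
  noncomm_ring

theorem hasDerivAt_inverse_deriv (h0 : b 0 = 1) (hb : HasDerivAt b (b₁ 0) 0) (h1 : b₁ 0 = j)
    (hb₁ : HasDerivAt b₁ k 0) :
    HasDerivAt (fun t => -(Ring.inverse (b t) * b₁ t * Ring.inverse (b t)))
      (j * j + j * j - k) 0 := by
  have h2 := hasDerivAt_inverse hb (by rw [h0]; exact isUnit_one)
  refine ((hasDerivAt_inverse_mul h0 hb h1 hb₁).mul h2).neg.congr_deriv ?_
  simp only [h0, h1, Ring.inverse_one, one_mul, mul_one]
  noncomm_ring

end

variable [StarRing R] [NormedStarGroup R] [StarModule ℝ R] {c c₁ : ℝ → R} {c₂ : R}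
  {δ δ₁ : ℝ → ℝ} {τ σ : ℝ}

theorem hasDerivAt_smul_mul_star {t : ℝ} (hc : HasDerivAt c (c₁ t) t)
    (hδ : HasDerivAt δ (δ₁ t) t) :
    HasDerivAt (fun t => δ t • (c t * star (c t)))
      (δ t • (c t * star (c₁ t) + c₁ t * star (c t)) + δ₁ t • (c t * star (c t))) t := by
  refine (hδ.smul (hc.mul hc.star)).congr_deriv ?_
  rw [add_comm (c₁ t * _)]
  rfl

/-- The product rule for δ c c*, to be used with c the inverse and δ the determinant of the Jacobian
matrix. The computation is noncommutative but purely algebraic, hence its abstract setting. -/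
theorem smul_mul_star_jets (hc : ∀ᶠ t in 𝓝 0, HasDerivAt c (c₁ t) t) (hc0 : c 0 = 1)
    (hc10 : c₁ 0 = -j) (hc2 : HasDerivAt c₁ c₂ 0) (hδ : ∀ᶠ t in 𝓝 0, HasDerivAt δ (δ₁ t) t)
    (hδ0 : δ 0 = 1) (hδ10 : δ₁ 0 = τ) (hδ2 : HasDerivAt δ₁ σ 0) :
    HasDerivAt (fun t => δ t • (c t * star (c t))) (-j - star j + τ • 1) 0 ∧
    HasDerivAt (deriv fun t => δ t • (c t * star (c t)))
      (j * star j + j * star j + c₂ + star c₂ - (2 * τ) • (j + star j) + σ • 1) 0 := by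
  have hA : ∀ᶠ t in 𝓝 0, HasDerivAt (fun t => δ t • (c t * star (c t)))
      (δ t • (c t * star (c₁ t) + c₁ t * star (c t)) + δ₁ t • (c t * star (c t))) t := by
    filter_upwards [hc, hδ] with t e1 e2 using hasDerivAt_smul_mul_star e1 e2
  refine ⟨?_, ?_⟩
  · refine hA.self_of_nhds.congr_deriv ?_
    rw [hc0, hc10, hδ0, hδ10]
    simp only [star_neg, star_one, one_mul, mul_one, one_smul]
    abel
  · have hder : deriv (fun t => δ t • (c t * star (c t))) =ᶠ[𝓝 0] fun t =>
        δ t • (c t * star (c₁ t) + c₁ t * star (c t)) + δ₁ t • (c t * star (c t)) := by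
      filter_upwards [hA] with t ht using ht.deriv
    refine HasDerivAt.congr_of_eventuallyEq ?_ hder
    have hc' := hc.self_of_nhds
    have hδ' := hδ.self_of_nhds
    have h3 := (hδ'.smul ((hc'.mul hc2.star).add (hc2.mul hc'.star))).add
      (hδ2.smul (hc'.mul hc'.star))
    refine h3.congr_deriv ?_
    simp only [Pi.mul_apply, Pi.add_apply, hc0, hc10, hδ0, hδ10, star_neg, star_one, one_mul,
      mul_one, one_smul, neg_mul, mul_neg, neg_neg, smul_add, smul_neg, mul_smul, two_smul]
    abel

end StarAlgebra

/-- The matrix `|det B| B⁻¹ B⁻ᵀ` by which the Dirichlet integral is pulled back (`det B > 0`). -/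
noncomputable def pullMatrix (B : Eu d →L[ℝ] Eu d) : Eu d →L[ℝ] Eu d :=
  B.det • (Ring.inverse B * star (Ring.inverse B))

theorem pullMatrix_one : pullMatrix (1 : Eu d →L[ℝ] Eu d) = 1 := by
  simp [pullMatrix, det_one']

theorem inner_pullMatrix (B : Eu d →L[ℝ] Eu d) (x y : Eu d) :
    inner ℝ (pullMatrix B x) y
      = B.det * inner ℝ (star (Ring.inverse B) x) (star (Ring.inverse B) y) := by
  simp only [pullMatrix, smul_apply, inner_smul_left, mul_apply_eq_comp]
  rw [ContinuousLinearMap.star_eq_adjoint, ContinuousLinearMap.adjoint_inner_right]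
  simp

theorem inner_pullMatrix_symm (B : Eu d →L[ℝ] Eu d) (x y : Eu d) :
    inner ℝ (pullMatrix B x) y = inner ℝ x (pullMatrix B y) := by
  rw [inner_pullMatrix, real_inner_comm (pullMatrix B y) x, inner_pullMatrix, real_inner_comm]

section Jets

variable {b b₁ : ℝ → Eu d →L[ℝ] Eu d} {j k : Eu d →L[ℝ] Eu d}

theorem det_jets (h0 : b 0 = 1) (hb : ∀ᶠ t in 𝓝 0, HasDerivAt b (b₁ t) t) (h1 : b₁ 0 = j)
    (hb₁ : HasDerivAt b₁ k 0) :
    HasDerivAt (fun t => (b t).det) (traceL d j) 0 ∧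
    HasDerivAt (deriv fun t => (b t).det)
      (traceL d j ^ 2 - traceL d (j * j) + traceL d k) 0 := by
  have hu : ∀ᶠ t in 𝓝 0, IsUnit (b t) :=
    eventually_isUnit hb.self_of_nhds.continuousAt (by rw [h0]; exact isUnit_one)
  have hdet : ∀ᶠ t in 𝓝 0, HasDerivAt (fun t => (b t).det)
      ((b t).det * traceL d (Ring.inverse (b t) * b₁ t)) t := by
    filter_upwards [hb, hu] with t e1 e2 using hasDerivAt_det e1 e2
  have hd0 := hdet.self_of_nhds
  rw [h0, det_one', one_mul, h1, Ring.inverse_one, one_mul] at hd0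
  refine ⟨hd0, ?_⟩
  have hder : deriv (fun t => (b t).det) =ᶠ[𝓝 0]
      fun t => (b t).det * traceL d (Ring.inverse (b t) * b₁ t) := by
    filter_upwards [hdet] with t ht using ht.deriv
  refine HasDerivAt.congr_of_eventuallyEq ?_ hder
  have hinv := hasDerivAt_inverse_mul h0 hb.self_of_nhds h1 hb₁
  have h2 := (traceL d).hasFDerivAt.comp_hasDerivAt (0 : ℝ) hinv
  refine (hd0.mul h2).congr_deriv ?_
  simp only [h0, h1, Ring.inverse_one, one_mul, det_one', Function.comp_def, map_sub]
  ring

/-- Here k is the second derivative of b. Nothing is assumed about it yet; for a flow it will be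
(η·∇)Dη + (Dη)², which makes the terms j * j partly cancel. -/
theorem pullMatrix_jets (h0 : b 0 = 1) (hb : ∀ᶠ t in 𝓝 0, HasDerivAt b (b₁ t) t) (h1 : b₁ 0 = j)
    (hb₁ : HasDerivAt b₁ k 0) :
    HasDerivAt (fun t => pullMatrix (b t)) (-j - star j + traceL d j • 1) 0 ∧
    HasDerivAt (deriv fun t => pullMatrix (b t))
      (j * star j + j * star j + (j * j + j * j - k) + star (j * j + j * j - k)
        - (2 * traceL d j) • (j + star j)
        + (traceL d j ^ 2 - traceL d (j * j) + traceL d k) • 1) 0 := by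
  have hu : ∀ᶠ t in 𝓝 0, IsUnit (b t) :=
    eventually_isUnit hb.self_of_nhds.continuousAt (by rw [h0]; exact isUnit_one)
  have hδd : ∀ᶠ t in 𝓝 0, HasDerivAt (fun t => (b t).det)
      ((b t).det * traceL d (Ring.inverse (b t) * b₁ t)) t := by
    filter_upwards [hb, hu] with t e1 e2 using hasDerivAt_det e1 e2
  refine smul_mul_star_jets (c := fun t => Ring.inverse (b t))
    (c₁ := fun t => -(Ring.inverse (b t) * b₁ t * Ring.inverse (b t)))
    (δ₁ := fun t => (b t).det * traceL d (Ring.inverse (b t) * b₁ t)) ?_ (by simp [h0])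
    (by simp [h0, h1]) (hasDerivAt_inverse_deriv h0 hb.self_of_nhds h1 hb₁) hδd
    (by simp [h0, det_one']) (by simp [h0, h1, det_one']) ?_
  · filter_upwards [hb, hu] with t e1 e2 using hasDerivAt_inverse e1 e2
  · refine (det_jets h0 hb h1 hb₁).2.congr_of_eventuallyEq ?_
    filter_upwards [hδd] with t ht using ht.deriv.symm

end Jets

end Det

/-! ### Partial derivatives in time and space -/

section Flow

variable {d : ℕ} {P : Type} [NormedAddCommGroup P] [NormedSpace ℝ P]

/-- The differential in the space variable. -/
noncomputable def spaceDeriv {F : Type} [NormedAddCommGroup F] [NormedSpace ℝ F]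
    (T : P × Eu d → F) (q : P × Eu d) : Eu d →L[ℝ] F :=
  (fderiv ℝ T q).comp (ContinuousLinearMap.inr ℝ P (Eu d))

theorem contDiff_spaceDeriv {F : Type} [NormedAddCommGroup F] [NormedSpace ℝ F]
    {T : P × Eu d → F} (hT : ContDiff ℝ ∞ T) : ContDiff ℝ ∞ (spaceDeriv T) :=
  (hT.fderiv_right (m := ∞) (by simp)).clm_comp contDiff_const

theorem hasFDerivAt_slice {F : Type} [NormedAddCommGroup F] [NormedSpace ℝ F]
    {T : P × Eu d → F} (hT : ContDiff ℝ ∞ T) (p : P) (x : Eu d) :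
    HasFDerivAt (fun y => T (p, y)) (spaceDeriv T (p, x)) x :=
  (hT.differentiable (by simp) (p, x)).hasFDerivAt.comp x (hasFDerivAt_prodMk_right p x)

/-- The derivative in the time variable. -/
noncomputable def timeDeriv {F : Type} [NormedAddCommGroup F] [NormedSpace ℝ F]
    (T : ℝ × Eu d → F) (q : ℝ × Eu d) : F :=
  fderiv ℝ T q (1, 0)

theorem contDiff_timeDeriv {F : Type} [NormedAddCommGroup F] [NormedSpace ℝ F]
    {T : ℝ × Eu d → F} (hT : ContDiff ℝ ∞ T) : ContDiff ℝ ∞ (timeDeriv T) :=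
  (hT.fderiv_right (m := ∞) (by simp)).clm_apply contDiff_const

theorem hasDerivAt_time {F : Type} [NormedAddCommGroup F] [NormedSpace ℝ F]
    {T : ℝ × Eu d → F} (hT : ContDiff ℝ ∞ T) (t : ℝ) (x : Eu d) :
    HasDerivAt (fun s => T (s, x)) (timeDeriv T (t, x)) t := by
  have h := (hT.differentiable (by simp) (t, x)).hasFDerivAt.comp_hasDerivAt t
    ((hasDerivAt_id t).prodMk (hasDerivAt_const t x))
  exact h

/-- The derivatives in time and in space commute. -/
theorem hasDerivAt_spaceDeriv {T : ℝ × Eu d → Eu d} (hT : ContDiff ℝ ∞ T) (t : ℝ) (x : Eu d) :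
    HasDerivAt (fun s => spaceDeriv T (s, x)) (spaceDeriv (timeDeriv T) (t, x)) t := by
  have h1 := hasDerivAt_time (contDiff_spaceDeriv hT) t x
  refine h1.congr_deriv ?_
  have hd : DifferentiableAt ℝ (fderiv ℝ T) (t, x) :=
    (hT.fderiv_right (m := ∞) (by simp)).differentiable (by simp) _
  ext1 v
  have e1 : timeDeriv (spaceDeriv T) (t, x) v = fderiv ℝ (fderiv ℝ T) (t, x) (1, 0) (0, v) := by
    have h2 : HasFDerivAt (spaceDeriv T)
        ((ContinuousLinearMap.compL ℝ (Eu d) (ℝ × Eu d) (Eu d)).flip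
          (ContinuousLinearMap.inr ℝ ℝ (Eu d)) ∘L fderiv ℝ (fderiv ℝ T) (t, x)) (t, x) :=
      ((ContinuousLinearMap.compL ℝ (Eu d) (ℝ × Eu d) (Eu d)).flip
          (ContinuousLinearMap.inr ℝ ℝ (Eu d))).hasFDerivAt.comp (t, x) hd.hasFDerivAt
    rw [timeDeriv, h2.fderiv]
    rfl
  have e2 : spaceDeriv (timeDeriv T) (t, x) v = fderiv ℝ (fderiv ℝ T) (t, x) (0, v) (1, 0) := by
    have h2 : HasFDerivAt (timeDeriv T)
        ((ContinuousLinearMap.apply ℝ (Eu d) ((1, 0) : ℝ × Eu d)) ∘L fderiv ℝ (fderiv ℝ T) (t, x))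
        (t, x) :=
      (ContinuousLinearMap.apply ℝ (Eu d) ((1, 0) : ℝ × Eu d)).hasFDerivAt.comp (t, x)
        hd.hasFDerivAt
    rw [spaceDeriv, h2.fderiv]
    rfl
  rw [e1, e2]
  have hsym : IsSymmSndFDerivAt ℝ T (t, x) :=
    hT.contDiffAt.isSymmSndFDerivAt (by
      rw [minSmoothness_of_isRCLikeNormedField]
      exact WithTop.coe_le_coe.2 (le_top : (2 : ℕ∞) ≤ ⊤))
  exact hsym _ _

end Flow

end HeatShape

namespace HeatShape

/-! ### Transport of the state problem by a diffeomorphism -/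

section Diffeo

variable {d : ℕ} {L D Ω : Set (Eu d)} {S R : Eu d → Eu d}

/-- `S` is an orientation preserving diffeomorphism with inverse `R`, equal to the identity
outside `L`. -/
structure IsDiffeo (L : Set (Eu d)) (S R : Eu d → Eu d) : Prop where
  smooth : ContDiff ℝ ∞ S
  smooth_inv : ContDiff ℝ ∞ R
  left_inv : ∀ x, R (S x) = x
  right_inv : ∀ x, S (R x) = x
  eq_of_notMem : ∀ x ∉ L, S x = x
  det_pos : ∀ x, 0 < (fderiv ℝ S x).det

namespace IsDiffeo

theorem injective (h : IsDiffeo L S R) : Function.Injective S :=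
  Function.LeftInverse.injective h.left_inv

theorem map_mem (h : IsDiffeo L S R) {x : Eu d} (hx : x ∈ L) : S x ∈ L := by
  by_contra hS
  have := h.injective (h.eq_of_notMem _ hS)
  rw [this] at hS
  exact hS hx

theorem image_eq_preimage (h : IsDiffeo L S R) (U : Set (Eu d)) : S '' U = R ⁻¹' U := by
  ext y
  constructor
  · rintro ⟨x, hx, rfl⟩
    rwa [mem_preimage, h.left_inv]
  · intro hy
    exact ⟨R y, hy, h.right_inv y⟩

theorem image_domain (h : IsDiffeo L S R) (hLD : L ⊆ D) : S '' D = D := by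
  ext y
  constructor
  · rintro ⟨x, hx, rfl⟩
    by_cases hxL : x ∈ L
    · exact hLD (h.map_mem hxL)
    · rwa [h.eq_of_notMem x hxL]
  · intro hy
    by_cases hyL : y ∈ L
    · refine ⟨R y, ?_, h.right_inv y⟩
      by_contra hR
      have hRL : R y ∉ L := fun h' => hR (hLD h')
      have := h.eq_of_notMem _ hRL
      rw [h.right_inv] at this
      rw [← this] at hRL
      exact hRL hyL
    · exact ⟨y, hy, h.eq_of_notMem y hyL⟩

theorem isOpen_image (h : IsDiffeo L S R) (hΩ : IsOpen Ω) : IsOpen (S '' Ω) := by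
  rw [h.image_eq_preimage]
  exact hΩ.preimage h.smooth_inv.continuous

theorem image_subset_domain (h : IsDiffeo L S R) (hLD : L ⊆ D) (hΩD : Ω ⊆ D) : S '' Ω ⊆ D := by
  rw [← h.image_domain hLD]
  exact image_mono hΩD

theorem diff_image (h : IsDiffeo L S R) (hLD : L ⊆ D) : D \ S '' Ω = S '' (D \ Ω) := by
  rw [image_sdiff h.injective, h.image_domain hLD]

theorem isCompact_diff_image (h : IsDiffeo L S R) (hLD : L ⊆ D) (hK : IsCompact (D \ Ω)) :
    IsCompact (D \ S '' Ω) := by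
  rw [h.diff_image hLD]
  exact hK.image h.smooth.continuous

theorem test_comp (h : IsDiffeo L S R) {ψ : Eu d → ℝ} (hψ : IsTest (S '' Ω) ψ) :
    IsTest Ω (fun x => ψ (S x)) := by
  refine IsTest.of_eq_zero (hψ.smooth.comp h.smooth)
    (hψ.compact.isCompact.image h.smooth_inv.continuous) ?_ fun x hx => ?_
  · rintro _ ⟨y, hy, rfl⟩
    have := hψ.supp hy
    rwa [h.image_eq_preimage] at this
  · refine image_eq_zero_of_notMem_tsupport fun h' => hx ⟨S x, h', h.left_inv x⟩

theorem test_comp_inv (h : IsDiffeo L S R) {ψ : Eu d → ℝ} (hψ : IsTest Ω ψ) :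
    IsTest (S '' Ω) (fun x => ψ (R x)) := by
  refine IsTest.of_eq_zero (hψ.smooth.comp h.smooth_inv)
    (hψ.compact.isCompact.image h.smooth.continuous) (image_mono hψ.supp) fun x hx => ?_
  exact image_eq_zero_of_notMem_tsupport fun h' => hx ⟨R x, h', h.right_inv x⟩

theorem isUnit_fderiv (h : IsDiffeo L S R) (x : Eu d) : IsUnit (fderiv ℝ S x) := by
  have h1 : HasFDerivAt S (fderiv ℝ S x) x := (h.smooth.differentiable (by simp) x).hasFDerivAt
  have h2 : HasFDerivAt R (fderiv ℝ R (S x)) (S x) :=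
    (h.smooth_inv.differentiable (by simp) _).hasFDerivAt
  have h3 : HasFDerivAt S (fderiv ℝ S x) (R (S x)) := by rw [h.left_inv]; exact h1
  have e1 : (fderiv ℝ R (S x)).comp (fderiv ℝ S x) = ContinuousLinearMap.id ℝ (Eu d) := by
    refine (h2.comp x h1).unique ?_
    have : R ∘ S = id := funext h.left_inv
    rw [this]
    exact hasFDerivAt_id x
  have e2 : (fderiv ℝ S x).comp (fderiv ℝ R (S x)) = ContinuousLinearMap.id ℝ (Eu d) := by
    refine (h3.comp (S x) h2).unique ?_
    have : S ∘ R = id := funext h.right_inv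
    rw [this]
    exact hasFDerivAt_id _
  exact ⟨⟨fderiv ℝ S x, fderiv ℝ R (S x), e2, e1⟩, rfl⟩

theorem gradient_comp (h : IsDiffeo L S R) {f : Eu d → ℝ} (hf : ContDiff ℝ ∞ f) (x : Eu d) :
    gradient (fun y => f (S y)) x = star (fderiv ℝ S x) (gradient f (S x)) := by
  refine ext_inner_right ℝ fun v => ?_
  rw [inner_gradient_left, ContinuousLinearMap.star_eq_adjoint,
    ContinuousLinearMap.adjoint_inner_left, inner_gradient_left]
  have h1 : HasFDerivAt S (fderiv ℝ S x) x := (h.smooth.differentiable (by simp) x).hasFDerivAt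
  have h2 : HasFDerivAt f (fderiv ℝ f (S x)) (S x) := (hf.differentiable (by simp) _).hasFDerivAt
  have h3 : HasFDerivAt (fun y => f (S y)) ((fderiv ℝ f (S x)).comp (fderiv ℝ S x)) x :=
    h2.comp x h1
  rw [h3.fderiv]
  rfl

/-- By the chain rule ∇(f ∘ S) = DSᵀ (∇f ∘ S), and the factors DS⁻ᵀ in the pullback matrix undo the
transposes. What remains is the integrand of the change of variables formula. -/
theorem inner_pullMatrix_gradient (h : IsDiffeo L S R) {f₁ f₂ : Eu d → ℝ} (hf₁ : ContDiff ℝ ∞ f₁)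
    (hf₂ : ContDiff ℝ ∞ f₂) (x : Eu d) :
    inner ℝ (pullMatrix (fderiv ℝ S x) (gradient (fun y => f₁ (S y)) x))
        (gradient (fun y => f₂ (S y)) x)
      = |(fderiv ℝ S x).det| * inner ℝ (gradient f₁ (S x)) (gradient f₂ (S x)) := by
  have key : ∀ v : Eu d, star (Ring.inverse (fderiv ℝ S x)) (star (fderiv ℝ S x) v) = v := by
    intro v
    rw [← mul_apply_eq_comp, ← star_mul, Ring.mul_inverse_cancel _ (h.isUnit_fderiv x), star_one]
    rfl
  rw [inner_pullMatrix, h.gradient_comp hf₁, h.gradient_comp hf₂, key, key,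
    abs_of_pos (h.det_pos x)]

theorem integral_gradient (h : IsDiffeo L S R) (hDo : IsOpen D) (hLD : L ⊆ D) {f₁ f₂ : Eu d → ℝ}
    (hf₁ : ContDiff ℝ ∞ f₁) (hf₂ : ContDiff ℝ ∞ f₂) :
    ∫ x in D, inner ℝ (gradient f₁ x) (gradient f₂ x)
      = ∫ x in D, inner ℝ (pullMatrix (fderiv ℝ S x) (gradient (fun y => f₁ (S y)) x))
        (gradient (fun y => f₂ (S y)) x) := by
  have h1 := integral_image_eq_integral_abs_det_fderiv_smul volume hDo.measurableSet
    (fun x _ => (h.smooth.differentiable (by simp) x).hasFDerivAt.hasFDerivWithinAt)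
    h.injective.injOn (fun x => inner ℝ (gradient f₁ x) (gradient f₂ x))
  rw [h.image_domain hLD] at h1
  rw [h1]
  refine integral_congr_ae (Eventually.of_forall fun x => ?_)
  simp only [h.inner_pullMatrix_gradient hf₁ hf₂, smul_eq_mul]

theorem volume_image (h : IsDiffeo L S R) (hΩ : IsOpen Ω) :
    volume.real (S '' Ω) = ∫ x in Ω, (fderiv ℝ S x).det := by
  have h1 := integral_image_eq_integral_abs_det_fderiv_smul volume hΩ.measurableSet
    (fun x _ => (h.smooth.differentiable (by simp) x).hasFDerivAt.hasFDerivWithinAt)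
    h.injective.injOn (fun _ => (1 : ℝ))
  rw [setIntegral_const, smul_eq_mul, mul_one] at h1
  rw [h1]
  refine integral_congr_ae (Eventually.of_forall fun x => ?_)
  simp only [smul_eq_mul, mul_one, abs_of_pos (h.det_pos x)]

end IsDiffeo

section Transport

variable {A : L2 d →L[ℝ] L2 d}

/-- The change of variables in the Dirichlet integral, phrased for L² classes so that limits can be
taken on both sides. -/
theorem inner_pull (h : IsDiffeo L S R) (hDo : IsOpen D) (hLD : L ⊆ D)
    (hA : ∀ f : L2 d, A f =ᵐ[volume] fun x => pullMatrix (fderiv ℝ S x) (f x))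
    {f₁ f₂ : Eu d → ℝ} (hf₁ : ContDiff ℝ ∞ f₁) (hf₂ : ContDiff ℝ ∞ f₂) {α₁ α₂ β₁ β₂ : L2 d}
    (h₁ : α₁ =ᵐ[volume] D.indicator (gradient f₁)) (h₂ : α₂ =ᵐ[volume] D.indicator (gradient f₂))
    (k₁ : β₁ =ᵐ[volume] D.indicator (gradient fun y => f₁ (S y)))
    (k₂ : β₂ =ᵐ[volume] D.indicator (gradient fun y => f₂ (S y))) :
    inner ℝ α₁ α₂ = inner ℝ (A β₁) β₂ := by
  have e1 : A β₁ =ᵐ[volume] fun x =>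
      pullMatrix (fderiv ℝ S x) (D.indicator (gradient fun y => f₁ (S y)) x) := by
    filter_upwards [hA β₁, k₁] with x h1 h2
    rw [h1, h2]
  rw [inner_L2_eq h₁ h₂, inner_L2_eq e1 k₂]
  have h3 := h.integral_gradient hDo hLD hf₁ hf₂
  rw [← integral_indicator hDo.measurableSet, ← integral_indicator hDo.measurableSet] at h3
  refine Eq.trans (integral_congr_ae (Eventually.of_forall fun x => ?_))
    (h3.trans (integral_congr_ae (Eventually.of_forall fun x => ?_)))
  · by_cases hx : x ∈ D
    · simp only [indicator_of_mem hx]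
    · simp only [indicator_of_notMem hx, inner_zero_left]
  · by_cases hx : x ∈ D
    · simp only [indicator_of_mem hx]
    · simp only [indicator_of_notMem hx, inner_zero_right]

theorem coeFn_liftGrad_add_testGrad (hDo : IsOpen D) (hDb : Bornology.IsBounded D) {g : Eu d → ℝ}
    (hg : ContDiff ℝ ∞ g) (hΩD : Ω ⊆ D) {ψ : Eu d → ℝ} (hψ : IsTest Ω ψ) :
    liftGrad hDo hDb hg + testGrad hψ =ᵐ[volume] D.indicator (gradient fun y => g y + ψ y) := by
  filter_upwards [Lp.coeFn_add (liftGrad hDo hDb hg) (testGrad hψ), coeFn_liftGrad hDo hDb hg,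
    coeFn_testGrad hψ] with x e1 e2 e3
  rw [e1, Pi.add_apply, e2, e3]
  by_cases hx : x ∈ D
  · rw [indicator_of_mem hx, indicator_of_mem hx,
      gradient_add' (hg.differentiable (by simp) x) (hψ.differentiable x)]
  · rw [indicator_of_notMem hx, indicator_of_notMem hx, zero_add]
    exact gradient_eq_zero_of_notMem fun h => hx (hΩD (hψ.supp h))

theorem coeFn_testGrad_indicator (hΩD : Ω ⊆ D) {ψ : Eu d → ℝ} (hψ : IsTest Ω ψ) :
    testGrad hψ =ᵐ[volume] D.indicator (gradient ψ) := by
  filter_upwards [coeFn_testGrad hψ] with x e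
  by_cases hx : x ∈ D
  · rw [e, indicator_of_mem hx]
  · rw [e, indicator_of_notMem hx]
    exact gradient_eq_zero_of_notMem fun h => hx (hΩD (hψ.supp h))

/-- Coercivity near the identity; it converts energies on S(Ω) into bounds for norms on Ω. -/
theorem half_norm_sq_le {H : Type*} [NormedAddCommGroup H] [InnerProductSpace ℝ H]
    {A : H →L[ℝ] H} (hA : ‖A - 1‖ ≤ 1 / 2) (x : H) : ‖x‖ ^ 2 ≤ 2 * inner ℝ (A x) x := by
  have h1 : inner ℝ (A x) x = ‖x‖ ^ 2 + inner ℝ ((A - 1) x) x := by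
    rw [← real_inner_self_eq_norm_sq, ← inner_add_left]
    congr 1
    simp
  have h2 := (abs_le.1 (abs_real_inner_le_norm ((A - 1) x) x)).1
  have h3 : ‖(A - 1) x‖ ≤ 1 / 2 * ‖x‖ := (A - 1).le_of_opNorm_le hA x
  nlinarith [norm_nonneg x]

/-- Pulling back the state of `S(Ω)` to `Ω`. -/
theorem exists_pullback (h : IsDiffeo L S R) (hDo : IsOpen D) (hDb : Bornology.IsBounded D)
    (hLD : L ⊆ D) (hΩD : Ω ⊆ D)
    (hA : ∀ f : L2 d, A f =ᵐ[volume] fun x => pullMatrix (fderiv ℝ S x) (f x))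
    (hA1 : ‖A - 1‖ ≤ 1 / 2) (hu : IsUnit (compression (gradSpace Ω) A)) {g : Eu d → ℝ}
    (hg : ContDiff ℝ ∞ g) (hgS : ∀ x, g (S x) = g x) :
    ∃ (ψ : ℕ → Eu d → ℝ) (hψ : ∀ n, IsTest (S '' Ω) (ψ n)),
      Tendsto (fun n => liftGrad hDo hDb hg + testGrad (hψ n)) atTop
        (𝓝 (harmonicPart (S '' Ω) (liftGrad hDo hDb hg))) ∧
      Tendsto (fun n => liftGrad hDo hDb hg + testGrad (h.test_comp (hψ n))) atTop
        (𝓝 (pertSol (gradSpace Ω) (liftGrad hDo hDb hg) A)) := by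
  have hΩD' : S '' Ω ⊆ D := h.image_subset_domain hLD hΩD
  obtain ⟨ψ, hψ, hlim⟩ := mem_gradSpace_iff_seq.1
    (harmonicPart_sub_mem (S '' Ω) (liftGrad hDo hDb hg))
  have hsub : ∀ {U : Set (Eu d)} {ψ χ : Eu d → ℝ} (hψ : IsTest U ψ) (hχ : IsTest U χ),
      testGrad hψ - testGrad hχ = testGrad (hψ.sub hχ) := by
    intro U ψ χ hψ hχ
    apply Lp.ext
    filter_upwards [coeFn_testGrad (hψ.sub hχ), coeFn_testGrad hψ,
      coeFn_testGrad hχ, Lp.coeFn_sub (testGrad hψ) (testGrad hχ)] with x h1 h2 h3 h4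
    rw [h1, h4, Pi.sub_apply, h2, h3, gradient_sub' (hψ.differentiable x) (hχ.differentiable x)]
  -- The energy of a difference of pullbacks, weighted by A, is the energy of the original
  -- difference on S(Ω); coercivity of A then gives the Cauchy property.
  have hc : CauchySeq fun n => testGrad (h.test_comp (hψ n)) := by
    rw [Metric.cauchySeq_iff']
    intro ε hε
    obtain ⟨N, hN⟩ := Metric.cauchySeq_iff'.1 hlim.cauchySeq (ε / 2) (by positivity)
    refine ⟨N, fun n hn => ?_⟩
    have h1 := hN n hn
    rw [dist_eq_norm, hsub] at h1 ⊢
    set χ := (hψ n).sub (hψ N)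
    have e : testGrad ((h.test_comp (hψ n)).sub (h.test_comp (hψ N)))
        = testGrad (h.test_comp χ) := rfl
    rw [e]
    have h2 := inner_pull h hDo hLD hA χ.smooth χ.smooth (coeFn_testGrad_indicator hΩD' χ)
      (coeFn_testGrad_indicator hΩD' χ) (coeFn_testGrad_indicator hΩD (h.test_comp χ))
      (coeFn_testGrad_indicator hΩD (h.test_comp χ))
    rw [real_inner_self_eq_norm_sq] at h2
    have h3 := half_norm_sq_le hA1 (testGrad (h.test_comp χ))
    rw [← h2] at h3
    have h4 : ‖testGrad (h.test_comp χ)‖ ^ 2 < ε ^ 2 := by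
      nlinarith [norm_nonneg (testGrad χ)]
    exact lt_of_pow_lt_pow_left₀ 2 hε.le h4
  obtain ⟨w, hw⟩ := cauchySeq_tendsto_of_complete hc
  have hwV : w ∈ gradSpace Ω := mem_gradSpace_iff_seq.2 ⟨_, _, hw⟩
  have hl1 : Tendsto (fun n => liftGrad hDo hDb hg + testGrad (hψ n)) atTop
      (𝓝 (harmonicPart (S '' Ω) (liftGrad hDo hDb hg))) := by
    have := hlim.const_add (liftGrad hDo hDb hg)
    rwa [add_sub_cancel] at this
  have hl2 : Tendsto (fun n => liftGrad hDo hDb hg + testGrad (h.test_comp (hψ n))) atTop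
      (𝓝 (liftGrad hDo hDb hg + w)) := hw.const_add _
  refine ⟨ψ, hψ, hl1, ?_⟩
  -- A test function χ on Ω corresponds to χ ∘ R on S(Ω), which is orthogonal to the state there;
  -- passing to the limit in the change of variables yields the weak equation with A. The invariance
  -- g ∘ S = g keeps the same lifting on both sides.
  have hsol : liftGrad hDo hDb hg + w = pertSol (gradSpace Ω) (liftGrad hDo hDb hg) A := by
    refine eq_pertSol hu (by simpa using hwV) fun v hv => ?_
    refine inner_eq_zero_of_test (fun χ hχ => ?_) hv
    have hχ' := h.test_comp_inv hχ
    have e1 : ∀ n, inner ℝ (liftGrad hDo hDb hg + testGrad (hψ n)) (testGrad hχ')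
        = inner ℝ (A (liftGrad hDo hDb hg + testGrad (h.test_comp (hψ n)))) (testGrad hχ) := by
      intro n
      refine inner_pull h hDo hLD hA (hg.add (hψ n).smooth) hχ'.smooth
        (coeFn_liftGrad_add_testGrad hDo hDb hg hΩD' (hψ n))
        (coeFn_testGrad_indicator hΩD' hχ') ?_ ?_
      · simp only [hgS]
        exact coeFn_liftGrad_add_testGrad hDo hDb hg hΩD (h.test_comp (hψ n))
      · simp only [h.left_inv]
        exact coeFn_testGrad_indicator hΩD hχ
    have l1 := hl1.inner (𝕜 := ℝ) (tendsto_const_nhds (x := testGrad hχ'))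
    have l2 := ((A.continuous.tendsto _).comp hl2).inner (𝕜 := ℝ)
      (tendsto_const_nhds (x := testGrad hχ))
    rw [inner_harmonicPart _ (testGrad_mem hχ')] at l1
    exact tendsto_nhds_unique (l2.congr fun n => (e1 n).symm) l1
  rwa [← hsol]

/-- Liftings vanishing on L are invariant under S and remain admissible liftings for S(Ω). All
dependence on S thus sits in the operator A. -/
theorem heat_image {φ ϕ : Eu d → ℝ} (h : IsDiffeo L S R) (hd : 0 < d) (hDo : IsOpen D)
    (hDb : Bornology.IsBounded D) (hLD : L ⊆ D) (hΩo : IsOpen Ω) (hΩD : Ω ⊆ D)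
    (hK : IsCompact (D \ Ω)) (hφ : ContDiff ℝ ∞ φ) (hϕ : ContDiff ℝ ∞ ϕ)
    (hA : ∀ f : L2 d, A f =ᵐ[volume] fun x => pullMatrix (fderiv ℝ S x) (f x))
    (hA1 : ‖A - 1‖ ≤ 1 / 2) (hu : IsUnit (compression (gradSpace Ω) A)) {g k : Eu d → ℝ}
    (hg : ContDiff ℝ ∞ g) (hk : ContDiff ℝ ∞ k)
    (hgφ : ∀ x ∈ frontier D, g x = φ x) (hkϕ : ∀ x ∈ frontier D, k x = ϕ x)
    (hg0 : ∀ x ∈ D \ Ω, g x = 0) (hk0 : ∀ x ∈ D \ Ω, k x = 0)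
    (hgL : ∀ x ∈ L, g x = 0) (hkL : ∀ x ∈ L, k x = 0) :
    heat D φ ϕ (S '' Ω)
      = pertEnergy (gradSpace Ω) (liftGrad hDo hDb hg) (liftGrad hDo hDb hk) A := by
  have hinv : ∀ {f : Eu d → ℝ}, (∀ x ∈ L, f x = 0) → ∀ x, f (S x) = f x := by
    intro f hf x
    by_cases hx : x ∈ L
    · rw [hf x hx, hf _ (h.map_mem hx)]
    · rw [h.eq_of_notMem x hx]
  have hz : ∀ {f : Eu d → ℝ}, (∀ x ∈ L, f x = 0) → (∀ x ∈ D \ Ω, f x = 0) →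
      ∀ x ∈ D \ S '' Ω, f x = 0 := by
    intro f hf hf0 x hx
    rw [h.diff_image hLD] at hx
    obtain ⟨y, hy, rfl⟩ := hx
    rw [hinv hf, hf0 y hy]
  have hΩD' : S '' Ω ⊆ D := h.image_subset_domain hLD hΩD
  rw [heat_eq_inner hd hDo hDb (h.isOpen_image hΩo) hΩD' (h.isCompact_diff_image hLD hK) hφ hϕ
    hg hk hgφ hkϕ (hz hgL hg0) (hz hkL hk0)]
  obtain ⟨ψ, hψ, l1, l2⟩ := exists_pullback h hDo hDb hLD hΩD hA hA1 hu hg (hinv hgL)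
  obtain ⟨χ, hχ, m1, m2⟩ := exists_pullback h hDo hDb hLD hΩD hA hA1 hu hk (hinv hkL)
  have e1 : ∀ n, inner ℝ (liftGrad hDo hDb hg + testGrad (hψ n))
      (liftGrad hDo hDb hk + testGrad (hχ n))
      = inner ℝ (A (liftGrad hDo hDb hg + testGrad (h.test_comp (hψ n))))
        (liftGrad hDo hDb hk + testGrad (h.test_comp (hχ n))) := by
    intro n
    refine inner_pull h hDo hLD hA (hg.add (hψ n).smooth) (hk.add (hχ n).smooth)
      (coeFn_liftGrad_add_testGrad hDo hDb hg hΩD' (hψ n))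
      (coeFn_liftGrad_add_testGrad hDo hDb hk hΩD' (hχ n)) ?_ ?_
    · simp only [hinv hgL]
      exact coeFn_liftGrad_add_testGrad hDo hDb hg hΩD (h.test_comp (hψ n))
    · simp only [hinv hkL]
      exact coeFn_liftGrad_add_testGrad hDo hDb hk hΩD (h.test_comp (hχ n))
  have n1 := l1.inner (𝕜 := ℝ) m1
  have n2 := ((A.continuous.tendsto _).comp l2).inner (𝕜 := ℝ) m2
  exact tendsto_nhds_unique n1 (n2.congr fun n => (e1 n).symm)

end Transport

end Diffeo

end HeatShape

namespace HeatShape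

/-! ### Families of deformations and smoothness of heat and volume -/

section PullField

variable {d : ℕ}

/-- A bump function around the identity matrix. -/
noncomputable def matrixBump (d : ℕ) : ContDiffBump (1 : Eu d →L[ℝ] Eu d) :=
  ⟨1 / 4, 1 / 2, by norm_num, by norm_num⟩

theorem isUnit_of_norm_sub_one {R : Type*} [NormedRing R] [CompleteSpace R] {B : R}
    (h : ‖B - 1‖ < 1) : IsUnit B := by
  have h1 := isUnit_one_sub_of_norm_lt_one (x := 1 - B) (by rwa [norm_sub_rev])
  rwa [sub_sub_cancel] at h1

theorem contDiffAt_pullMatrix {B : Eu d →L[ℝ] Eu d} (hB : IsUnit B) :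
    ContDiffAt ℝ ∞ (pullMatrix (d := d)) B := by
  obtain ⟨u, rfl⟩ := hB
  have h1 : ContDiffAt ℝ ∞ (Ring.inverse : (Eu d →L[ℝ] Eu d) → (Eu d →L[ℝ] Eu d)) u :=
    contDiffAt_ringInverse ℝ u
  have h2 : ContDiffAt ℝ ∞ (fun B : Eu d →L[ℝ] Eu d => star (Ring.inverse B)) u :=
    (starL' ℝ : (Eu d →L[ℝ] Eu d) ≃L[ℝ] (Eu d →L[ℝ] Eu d)).contDiff.contDiffAt.comp _ h1
  exact contDiff_det.contDiffAt.smul (h1.mul h2)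

/-- A smooth matrix function equal to `pullMatrix - 1` near the identity. -/
noncomputable def pullDefect (B : Eu d →L[ℝ] Eu d) : Eu d →L[ℝ] Eu d :=
  matrixBump d B • (pullMatrix B - 1)

/-- Inversion is smooth only on invertible matrices, whereas `contDiff_curryOn` is stated for
globally smooth functions. Matrices at distance less than 1 from the identity are invertible, and
farther away the bump, supported in the ball of radius 1/2, vanishes locally. -/
theorem contDiff_pullDefect : ContDiff ℝ ∞ (pullDefect (d := d)) := by
  rw [contDiff_iff_contDiffAt]
  intro B
  by_cases hB : ‖B - 1‖ < 1
  · exact (matrixBump d).contDiff.contDiffAt.smul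
      ((contDiffAt_pullMatrix (isUnit_of_norm_sub_one hB)).sub contDiffAt_const)
  · have h1 : pullDefect (d := d) =ᶠ[𝓝 B] fun _ => 0 := by
      have hU : (Metric.closedBall (1 : Eu d →L[ℝ] Eu d) (1 / 2))ᶜ ∈ 𝓝 B := by
        refine Metric.isClosed_closedBall.isOpen_compl.mem_nhds ?_
        rw [mem_compl_iff, mem_closedBall_iff_norm]
        linarith
      filter_upwards [hU] with A hA
      have : (1 / 2 : ℝ) ≤ dist A 1 := by
        rw [mem_compl_iff, Metric.mem_closedBall] at hA
        linarith
      rw [pullDefect, (matrixBump d).zero_of_le_dist this]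
      exact zero_smul ℝ (pullMatrix A - 1)
    exact contDiffAt_const.congr_of_eventuallyEq h1

theorem pullDefect_eq {B : Eu d →L[ℝ] Eu d} (hB : ‖B - 1‖ ≤ 1 / 4) :
    pullDefect B = pullMatrix B - 1 := by
  rw [pullDefect, (matrixBump d).one_of_mem_closedBall (mem_closedBall_iff_norm.2 hB), one_smul]

theorem pullDefect_one : pullDefect (1 : Eu d →L[ℝ] Eu d) = 0 := by
  rw [pullDefect, pullMatrix_one, sub_self, smul_zero]

theorem inner_pullDefect_symm (B : Eu d →L[ℝ] Eu d) (x y : Eu d) :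
    inner ℝ (pullDefect B x) y = inner ℝ x (pullDefect B y) := by
  simp only [pullDefect, smul_apply, sub_apply, inner_smul_left, inner_smul_right, inner_sub_left,
    inner_sub_right, inner_pullMatrix_symm]
  rfl

end PullField

section Deformation

variable {d : ℕ} {P : Type} [NormedAddCommGroup P] [NormedSpace ℝ P] {L D Ω : Set (Eu d)}
  {T : P × Eu d → Eu d}

/-- A smooth family of deformations of the identity, equal to the identity outside `L`. -/
structure IsDeformation (L : Set (Eu d)) (T : P × Eu d → Eu d) : Prop where
  smooth : ContDiff ℝ ∞ T
  at_zero : ∀ x, T (0, x) = x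
  eq_of_notMem : ∀ p, ∀ x ∉ L, T (p, x) = x

namespace IsDeformation

theorem fderiv_slice (h : IsDeformation L T) (p : P) (x : Eu d) :
    fderiv ℝ (fun y => T (p, y)) x = spaceDeriv T (p, x) :=
  (hasFDerivAt_slice h.smooth p x).fderiv

theorem spaceDeriv_zero (h : IsDeformation L T) (x : Eu d) : spaceDeriv T (0, x) = 1 := by
  rw [← h.fderiv_slice]
  simp only [h.at_zero]
  exact fderiv_id

theorem spaceDeriv_of_notMem (h : IsDeformation L T) (hL : IsClosed L) (p : P) {x : Eu d}
    (hx : x ∉ L) : spaceDeriv T (p, x) = 1 := by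
  rw [← h.fderiv_slice]
  have h1 : (fun y => T (p, y)) =ᶠ[𝓝 x] id := by
    filter_upwards [hL.isOpen_compl.mem_nhds hx] with y hy
    exact h.eq_of_notMem p y hy
  rw [h1.fderiv_eq]
  exact fderiv_id

theorem eventually_spaceDeriv [CompactSpace L] (h : IsDeformation L T)
    {U : Set (Eu d →L[ℝ] Eu d)} (hU : U ∈ 𝓝 1) : ∀ᶠ p in 𝓝 0, ∀ x, spaceDeriv T (p, x) ∈ U := by
  obtain ⟨ε, hε, hb⟩ := Metric.mem_nhds_iff.1 hU
  have hc := (continuous_curryOn (L := L) (contDiff_spaceDeriv h.smooth).continuous).tendsto 0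
  rw [ContinuousMap.tendsto_iff_tendstoUniformly, Metric.tendstoUniformly_iff] at hc
  filter_upwards [hc ε hε] with p hp x
  by_cases hx : x ∈ L
  · apply hb
    have h1 := hp ⟨x, hx⟩
    change dist (spaceDeriv T (0, x)) (spaceDeriv T (p, x)) < ε at h1
    rw [h.spaceDeriv_zero, dist_comm] at h1
    exact h1
  · rw [h.spaceDeriv_of_notMem (isCompact_of_compactSpace (L := L)).isClosed p hx]
    exact mem_of_mem_nhds hU

/-- S - id is a contraction, being 1/4-Lipschitz, so S is a global homeomorphism; its differential
is invertible everywhere, so the inverse is smooth. -/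
theorem exists_isDiffeo (h : IsDeformation L T) {p : P}
    (hp : ∀ x, ‖spaceDeriv T (p, x) - 1‖ ≤ 1 / 4) (hdet : ∀ x, 0 < (spaceDeriv T (p, x)).det) :
    ∃ R, IsDiffeo L (fun x => T (p, x)) R := by
  set S : Eu d → Eu d := fun x => T (p, x) with hS
  have hSs : ContDiff ℝ ∞ S := h.smooth.comp (contDiff_const.prodMk contDiff_id)
  have hd : ∀ x, HasFDerivAt S (spaceDeriv T (p, x)) x := hasFDerivAt_slice h.smooth p
  have hlip : LipschitzWith (1 / 4) fun x => S x - x := by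
    refine lipschitzWith_of_nnnorm_fderiv_le (𝕜 := ℝ)
      (fun x => ((hd x).sub (hasFDerivAt_id x)).differentiableAt) fun x => ?_
    have h1 : fderiv ℝ (fun x => S x - x) x = spaceDeriv T (p, x) - 1 :=
      ((hd x).sub (hasFDerivAt_id x)).fderiv
    rw [h1, ← NNReal.coe_le_coe, coe_nnnorm]
    exact (hp x).trans (by norm_num)
  have happ : ApproximatesLinearOn S
      ((ContinuousLinearEquiv.refl ℝ (Eu d) : Eu d ≃L[ℝ] Eu d) : Eu d →L[ℝ] Eu d) univ
      (1 / 4) := by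
    rw [ApproximatesLinearOn.approximatesLinearOn_iff_lipschitzOnWith, lipschitzOnWith_univ]
    exact hlip
  have hc : Subsingleton (Eu d) ∨ (1 / 4 : NNReal) <
      ‖((ContinuousLinearEquiv.refl ℝ (Eu d)).symm : Eu d →L[ℝ] Eu d)‖₊⁻¹ := by
    rcases subsingleton_or_nontrivial (Eu d) with hs | hn
    · exact Or.inl hs
    · right
      have : ‖((ContinuousLinearEquiv.refl ℝ (Eu d)).symm : Eu d →L[ℝ] Eu d)‖₊ = 1 := by
        rw [← NNReal.coe_inj]
        exact ContinuousLinearMap.norm_id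
      rw [this, ← NNReal.coe_lt_coe]
      norm_num
  set Θ := happ.toHomeomorph S hc with hΘ
  have hΘS : ∀ x, Θ x = S x := fun x => rfl
  have hunit : ∀ x, IsUnit (spaceDeriv T (p, x)) := fun x =>
    isUnit_of_norm_sub_one ((hp x).trans_lt (by norm_num))
  have hinv : ContDiff ℝ ∞ (Θ.symm : Eu d → Eu d) := by
    refine Homeomorph.contDiff_symm Θ
      (f₀' := fun x => ContinuousLinearEquiv.unitsEquiv ℝ (Eu d) (hunit x).unit) (fun x => ?_) hSs
    exact hd x
  exact ⟨Θ.symm, hSs, hinv, fun x => Θ.symm_apply_apply x, fun x => Θ.apply_symm_apply x,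
    h.eq_of_notMem p, fun x => by rw [(hd x).fderiv]; exact hdet x⟩

theorem eventually_isDiffeo [CompactSpace L] (h : IsDeformation L T) :
    ∀ᶠ p in 𝓝 0, (∃ R, IsDiffeo L (fun x => T (p, x)) R) ∧
      ∀ x, ‖spaceDeriv T (p, x) - 1‖ ≤ 1 / 4 := by
  have h1 : {B : Eu d →L[ℝ] Eu d | ‖B - 1‖ ≤ 1 / 4} ∈ 𝓝 1 := by
    filter_upwards [Metric.closedBall_mem_nhds (1 : Eu d →L[ℝ] Eu d)
      (by norm_num : (0 : ℝ) < 1 / 4)] with B hB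
    exact mem_closedBall_iff_norm.1 hB
  have h2 : {B : Eu d →L[ℝ] Eu d | 0 < B.det} ∈ 𝓝 1 := by
    refine contDiff_det.continuous.continuousAt.eventually_const_lt ?_
    exact (one_pos : (0 : ℝ) < 1).trans_eq det_one'.symm
  filter_upwards [h.eventually_spaceDeriv h1, h.eventually_spaceDeriv h2] with p hp1 hp2
  exact ⟨h.exists_isDiffeo hp1 hp2, hp1⟩

theorem contDiff_defect (h : IsDeformation L T) :
    ContDiff ℝ ∞ fun q => pullDefect (spaceDeriv T q) :=
  contDiff_pullDefect.comp (contDiff_spaceDeriv h.smooth)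

theorem contDiff_detDefect (h : IsDeformation L T) :
    ContDiff ℝ ∞ fun q => (spaceDeriv T q).det - 1 :=
  (contDiff_det.comp (contDiff_spaceDeriv h.smooth)).sub contDiff_const

variable [CompactSpace L]

/-- The operator of multiplication by the matrix field of the pulled back Dirichlet energy. -/
noncomputable def pullOp (h : IsDeformation L T) (p : P) : L2 d →L[ℝ] L2 d :=
  1 + mulOp L (curryOn L h.contDiff_defect.continuous p)

/-- The defect of the Jacobian determinant. -/
noncomputable def detField (h : IsDeformation L T) (p : P) : C(L, ℝ) :=
  curryOn L h.contDiff_detDefect.continuous p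

theorem contDiff_pullOp (h : IsDeformation L T) : ContDiff ℝ ∞ h.pullOp :=
  contDiff_const.add ((contDiff_curryOn h.contDiff_defect).continuousLinearMap_comp (mulOp L))

theorem contDiff_detField (h : IsDeformation L T) : ContDiff ℝ ∞ h.detField :=
  contDiff_curryOn h.contDiff_detDefect

theorem extendZero_defect (h : IsDeformation L T) (p : P) :
    extendZero (curryOn L h.contDiff_defect.continuous p)
      = fun x => pullDefect (spaceDeriv T (p, x)) := by
  refine extendZero_eq (fun x => rfl) fun x hx => ?_
  rw [h.spaceDeriv_of_notMem (isCompact_of_compactSpace (L := L)).isClosed p hx, pullDefect_one]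

theorem extendZero_detField (h : IsDeformation L T) (p : P) :
    extendZero (h.detField p) = fun x => (spaceDeriv T (p, x)).det - 1 := by
  refine extendZero_eq (fun x => rfl) fun x hx => ?_
  rw [h.spaceDeriv_of_notMem (isCompact_of_compactSpace (L := L)).isClosed p hx, det_one', sub_self]

theorem coeFn_pullOp (h : IsDeformation L T) (p : P) (f : L2 d) :
    h.pullOp p f =ᵐ[volume] fun x => f x + pullDefect (spaceDeriv T (p, x)) (f x) := by
  have e : h.pullOp p f = f + mulOp L (curryOn L h.contDiff_defect.continuous p) f := rfl
  rw [e]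
  filter_upwards [Lp.coeFn_add f (mulOp L (curryOn L h.contDiff_defect.continuous p) f),
    coeFn_mulOp (curryOn L h.contDiff_defect.continuous p) f] with x e1 e2
  rw [e1, Pi.add_apply, e2, h.extendZero_defect]

theorem pullOp_zero (h : IsDeformation L T) : h.pullOp 0 = 1 := by
  ext1 f
  apply Lp.ext
  filter_upwards [h.coeFn_pullOp 0 f] with x e
  rw [e, h.spaceDeriv_zero, pullDefect_one, zero_apply, add_zero]
  rfl

theorem inner_pullOp_symm (h : IsDeformation L T) (p : P) (f g : L2 d) :
    inner ℝ (h.pullOp p f) g = inner ℝ f (h.pullOp p g) := by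
  rw [inner_L2_eq (h.coeFn_pullOp p f) (EventuallyEq.refl _ g),
    inner_L2_eq (EventuallyEq.refl _ f) (h.coeFn_pullOp p g)]
  refine integral_congr_ae (Eventually.of_forall fun x => ?_)
  simp only [inner_add_left, inner_add_right, inner_pullDefect_symm]

theorem eventually_volume (h : IsDeformation L T) (hΩo : IsOpen Ω) (hΩ : volume Ω ≠ ⊤) :
    ∀ᶠ p in 𝓝 0, volume.real ((fun x => T (p, x)) '' Ω)
      = volume.real Ω + integralOn L Ω (h.detField p) := by
  filter_upwards [h.eventually_isDiffeo] with p ⟨⟨R, hR⟩, _⟩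
  rw [hR.volume_image hΩo, integralOn_apply]
  have e1 : ∀ x, (fderiv ℝ (fun x => T (p, x)) x).det = 1 + extendZero (h.detField p) x := by
    intro x
    rw [h.extendZero_detField, h.fderiv_slice]
    ring
  simp only [e1]
  have h1 : IntegrableOn (fun _ => (1 : ℝ)) Ω volume := integrableOn_const hΩ
  have h2 : IntegrableOn (extendZero (h.detField p)) Ω volume :=
    (integrable_extendZero _).integrableOn
  refine (integral_add h1 h2).trans ?_
  rw [setIntegral_const, smul_eq_mul, mul_one]

/-- The elements a and b do not depend on p: they come from liftings that vanish on L as well as on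
D \ Ω, which every deformation of the family leaves invariant. -/
theorem eventually_heat {φ ϕ : Eu d → ℝ} (h : IsDeformation L T) (hd : 0 < d) (hDo : IsOpen D)
    (hDb : Bornology.IsBounded D) (hLD : L ⊆ D) (hΩo : IsOpen Ω) (hΩD : Ω ⊆ D)
    (hK : IsCompact (D \ Ω)) (hφ : ContDiff ℝ ∞ φ) (hϕ : ContDiff ℝ ∞ ϕ) :
    ∃ a b : L2 d, D.indicator (stateGrad D φ Ω) =ᵐ[volume] harmonicPart Ω a ∧
      D.indicator (stateGrad D ϕ Ω) =ᵐ[volume] harmonicPart Ω b ∧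
      (∀ᵐ x, x ∉ Ω → harmonicPart Ω a x = 0) ∧ (∀ᵐ x, x ∉ Ω → harmonicPart Ω b x = 0) ∧
      ∀ᶠ p in 𝓝 0, heat D φ ϕ ((fun x => T (p, x)) '' Ω)
        = pertEnergy (gradSpace Ω) a b (h.pullOp p) := by
  have hL : IsCompact L := isCompact_of_compactSpace
  have hKL : IsCompact (D \ Ω ∪ L) := hK.union hL
  have hKLD : D \ Ω ∪ L ⊆ D := union_subset sdiff_subset hLD
  have hfr : ∀ {C : Set (Eu d)}, C ⊆ D → ∀ x ∈ frontier D, x ∉ C := fun hC x hx hxC => by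
    rw [hDo.frontier_eq] at hx
    exact hx.2 (hC hxC)
  obtain ⟨g, hg, ⟨C, -, hC, hgC⟩, hg0, -⟩ := exists_lifting hDo hDb hKL hKLD hφ
  obtain ⟨k, hk, ⟨C', -, hC', hkC⟩, hk0, -⟩ := exists_lifting hDo hDb hKL hKLD hϕ
  have hg0' := hg0.self_of_nhdsSet
  have hk0' := hk0.self_of_nhdsSet
  have hg1 : ∀ x ∈ D \ Ω, g x = 0 := fun x hx => hg0' x (Or.inl hx)
  have hk1 : ∀ x ∈ D \ Ω, k x = 0 := fun x hx => hk0' x (Or.inl hx)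
  have hgφ : ∀ x ∈ frontier D, g x = φ x := fun x hx => hgC x (hfr hC x hx)
  have hkϕ : ∀ x ∈ frontier D, k x = ϕ x := fun x hx => hkC x (hfr hC' x hx)
  refine ⟨liftGrad hDo hDb hg, liftGrad hDo hDb hk,
    stateGrad_ae_eq hd hDo hDb hΩo hΩD hK hφ hg hgφ hg1,
    stateGrad_ae_eq hd hDo hDb hΩo hΩD hK hϕ hk hkϕ hk1,
    harmonicPart_ae_zero hDo hDb hg hg1, harmonicPart_ae_zero hDo hDb hk hk1, ?_⟩
  have hcont : ContinuousAt h.pullOp 0 := h.contDiff_pullOp.continuous.continuousAt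
  have hu : ∀ᶠ p in 𝓝 0, IsUnit (compression (gradSpace Ω) (h.pullOp p)) := by
    refine hcont.eventually (p := fun A => IsUnit (compression (gradSpace Ω) A)) ?_
    rw [h.pullOp_zero]
    exact eventually_isUnit_compression (gradSpace Ω)
  have hn : ∀ᶠ p in 𝓝 0, ‖h.pullOp p - 1‖ ≤ 1 / 2 := by
    refine hcont.eventually (p := fun A => ‖A - 1‖ ≤ 1 / 2) ?_
    rw [h.pullOp_zero]
    filter_upwards [Metric.closedBall_mem_nhds (1 : L2 d →L[ℝ] L2 d)
      (by norm_num : (0 : ℝ) < 1 / 2)] with B hB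
    exact mem_closedBall_iff_norm.1 hB
  filter_upwards [h.eventually_isDiffeo, hu, hn] with p ⟨⟨R, hR⟩, hp⟩ hup hnp
  refine heat_image hR hd hDo hDb hLD hΩo hΩD hK hφ hϕ (fun f => ?_) hnp hup hg hk hgφ hkϕ hg1 hk1
    (fun x hx => hg0' x (Or.inr hx)) fun x hx => hk0' x (Or.inr hx)
  filter_upwards [h.coeFn_pullOp p f] with x e
  rw [e, h.fderiv_slice, pullDefect_eq (hp x), sub_apply, one_apply_eq_self, add_sub_cancel]

theorem contDiffAt_heat {φ ϕ : Eu d → ℝ} (h : IsDeformation L T) (hd : 0 < d) (hDo : IsOpen D)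
    (hDb : Bornology.IsBounded D) (hLD : L ⊆ D) (hΩo : IsOpen Ω) (hΩD : Ω ⊆ D)
    (hK : IsCompact (D \ Ω)) (hφ : ContDiff ℝ ∞ φ) (hϕ : ContDiff ℝ ∞ ϕ) :
    ContDiffAt ℝ ∞ (fun p => heat D φ ϕ ((fun x => T (p, x)) '' Ω)) 0 := by
  obtain ⟨a, b, -, -, -, -, he⟩ := h.eventually_heat hd hDo hDb hLD hΩo hΩD hK hφ hϕ
  refine ContDiffAt.congr_of_eventuallyEq ?_ he
  refine ContDiffAt.comp (g := pertEnergy (gradSpace Ω) a b) 0 ?_ h.contDiff_pullOp.contDiffAt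
  rw [h.pullOp_zero]
  exact contDiffAt_pertEnergy a b

theorem contDiffAt_volume (h : IsDeformation L T) (hΩo : IsOpen Ω) (hΩ : volume Ω ≠ ⊤) :
    ContDiffAt ℝ ∞ (fun p => volume.real ((fun x => T (p, x)) '' Ω)) 0 :=
  ContDiffAt.congr_of_eventuallyEq (contDiffAt_const.add
    ((integralOn L Ω).contDiff.comp h.contDiff_detField).contDiffAt) (h.eventually_volume hΩo hΩ)

end IsDeformation

end Deformation

end HeatShape

namespace HeatShape

/-! ### Identification of the derivatives with δA, δ²A and the divergence terms -/

section Fields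

variable {d : ℕ} {η : Eu d → Eu d}

theorem deltaA_eq (η : Eu d → Eu d) (x : Eu d) :
    deltaA η x = -jac η x - star (jac η x) + traceL d (jac η x) • 1 := rfl

theorem hasFDerivAt_jac (hη : ContDiff ℝ ∞ η) (x : Eu d) :
    HasFDerivAt (jac η) (fderiv ℝ (jac η) x) x :=
  ((hη.fderiv_right (m := ∞) (by simp)).differentiable (by simp) x).hasFDerivAt

theorem along_jacT_add_jac (hη : ContDiff ℝ ∞ η) (x : Eu d) :
    along η (fun y => jacT η y + jac η y) x = star (along η (jac η) x) + along η (jac η) x := by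
  have h1 := hasFDerivAt_jac hη x
  have h2 : HasFDerivAt (fun y => jacT η y) (((starL' ℝ : (Eu d →L[ℝ] Eu d) ≃L[ℝ]
      (Eu d →L[ℝ] Eu d)) : (Eu d →L[ℝ] Eu d) →L[ℝ] (Eu d →L[ℝ] Eu d)).comp
      (fderiv ℝ (jac η) x)) x :=
    (starL' ℝ : (Eu d →L[ℝ] Eu d) ≃L[ℝ] (Eu d →L[ℝ] Eu d)).hasFDerivAt.comp x h1
  have h3 := (h2.add h1).fderiv
  rw [along, along]
  exact congrArg (fun F => F (η x)) h3

theorem along_diverg (hη : ContDiff ℝ ∞ η) (x : Eu d) :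
    along η (diverg η) x = traceL d (along η (jac η) x) := by
  have h1 := ((traceL d).hasFDerivAt.comp x (hasFDerivAt_jac hη x)).fderiv
  exact congrArg (fun F => F (η x)) h1

/-- The factor 2 turns the coefficient δ²A of a Taylor expansion into a second derivative, in the
form that `pullMatrix_jets` produces. The identity is checked in an abstract star algebra, where
only ring and star manipulations remain. -/
theorem two_smul_delta2A (hη : ContDiff ℝ ∞ η) (x : Eu d) :
    (2 : ℝ) • delta2A η x = jac η x * star (jac η x) + jac η x * star (jac η x)
      + (jac η x * jac η x - along η (jac η) x) + star (jac η x * jac η x - along η (jac η) x)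
      - (2 * traceL d (jac η x)) • (jac η x + star (jac η x))
      + (traceL d (jac η x) ^ 2 + traceL d (along η (jac η) x)) • 1 := by
  have e : ∀ (R : Type) [Ring R] [StarRing R] [Algebra ℝ R] (j m : R) (τ σ : ℝ),
      (2 : ℝ) • (j * star j + (1 / 2 : ℝ) • (star j) ^ 2 + (1 / 2 : ℝ) • j ^ 2
        - (1 / 2 : ℝ) • (star m + m) - τ • (star j + j) + ((τ ^ 2 + σ) / 2) • (1 : R))
      = j * star j + j * star j + (j * j - m) + star (j * j - m) - (2 * τ) • (j + star j)
        + (τ ^ 2 + σ) • (1 : R) := by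
    intro R _ _ _ j m τ σ
    simp only [smul_add, smul_sub, smul_smul, pow_two, star_sub, star_mul]
    norm_num
    rw [two_smul, mul_div_cancel₀ _ (two_ne_zero' ℝ)]
    abel
  rw [delta2A, along_jacT_add_jac hη, along_diverg hη]
  exact e (Eu d →L[ℝ] Eu d) (jac η x) (along η (jac η) x) (traceL d (jac η x)) (traceL d (along η (jac η) x))

theorem star_deltaA (η : Eu d → Eu d) (x : Eu d) : star (deltaA η x) = deltaA η x := by
  have e : ∀ (R : Type) [Ring R] [StarRing R] [Algebra ℝ R] [StarModule ℝ R] (j : R) (τ : ℝ),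
      star (-j - star j + τ • (1 : R)) = -j - star j + τ • (1 : R) := by
    intro R _ _ _ _ j τ
    rw [star_add, star_sub, star_neg, star_star, star_smul, star_one, star_trivial τ]
    abel
  exact e (Eu d →L[ℝ] Eu d) (jac η x) (traceL d (jac η x))

theorem star_two_smul_delta2A (hη : ContDiff ℝ ∞ η) (x : Eu d) :
    star ((2 : ℝ) • delta2A η x) = (2 : ℝ) • delta2A η x := by
  have e : ∀ (R : Type) [Ring R] [StarRing R] [Algebra ℝ R] [StarModule ℝ R] (j n : R) (τ σ : ℝ),
      star (j * star j + j * star j + n + star n - τ • (j + star j) + σ • (1 : R))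
        = j * star j + j * star j + n + star n - τ • (j + star j) + σ • (1 : R) := by
    intro R _ _ _ _ j n τ σ
    simp only [star_add, star_sub, star_mul, star_smul, star_star, star_one, star_trivial]
    rw [add_assoc, add_comm (star n) n, ← add_assoc, add_comm (star j) j]
  rw [two_smul_delta2A hη]
  exact e (Eu d →L[ℝ] Eu d) _ _ _ _

theorem inner_apply_of_star {A : Eu d →L[ℝ] Eu d} (hA : star A = A) (x y : Eu d) :
    inner ℝ (A x) y = inner ℝ x (A y) := by
  rw [← ContinuousLinearMap.adjoint_inner_right, ← ContinuousLinearMap.star_eq_adjoint, hA]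

theorem inner_deltaA (η : Eu d → Eu d) (x y z : Eu d) :
    inner ℝ (deltaA η x y) z = inner ℝ y (deltaA η x z) :=
  inner_apply_of_star (star_deltaA η x) y z

theorem inner_delta2A (hη : ContDiff ℝ ∞ η) (x y z : Eu d) :
    inner ℝ (((2 : ℝ) • delta2A η x) y) z = 2 * inner ℝ y (delta2A η x z) := by
  rw [inner_apply_of_star (star_two_smul_delta2A hη x), smul_apply, inner_smul_right]

/-- The differential of the acceleration (Dη)η of the flow. Symmetry of the second derivative of η
rewrites D²η(·, η) as the derivative of Dη in the direction η. -/
theorem fderiv_along_self (hη : ContDiff ℝ ∞ η) (x : Eu d) :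
    fderiv ℝ (fun y => fderiv ℝ η y (η y)) x = along η (jac η) x + jac η x * jac η x := by
  have h1 := hasFDerivAt_jac hη x
  have h2 : HasFDerivAt η (fderiv ℝ η x) x := (hη.differentiable (by simp) x).hasFDerivAt
  have h3 := (h1.clm_apply h2).fderiv
  have hs : IsSymmSndFDerivAt ℝ η x := (hη.contDiffAt (x := x)).isSymmSndFDerivAt (by
    rw [minSmoothness_of_isRCLikeNormedField]
    exact WithTop.coe_le_coe.2 (le_top : (2 : ℕ∞) ≤ ⊤))
  refine h3.trans ?_
  ext1 v
  have h4 : fderiv ℝ (fderiv ℝ η) x v (η x) = fderiv ℝ (fderiv ℝ η) x (η x) v := hs v (η x)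
  change fderiv ℝ η x (fderiv ℝ η x v) + fderiv ℝ (fderiv ℝ η) x v (η x)
    = fderiv ℝ (fderiv ℝ η) x (η x) v + fderiv ℝ η x (fderiv ℝ η x v)
  rw [h4, add_comm]

end Fields

section CurveOfFields

variable {d : ℕ} {L : Set (Eu d)} [CompactSpace L] {F : Type} [NormedAddCommGroup F]
  [NormedSpace ℝ F]

theorem extendZero_deriv {c : ℝ → C(L, F)} (hc : ContDiff ℝ ∞ c) (t : ℝ) (x : Eu d) :
    extendZero (deriv c t : C(L, F)) x = deriv (fun s => extendZero (c s) x) t := by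
  by_cases hx : x ∈ L
  · have h1 : HasDerivAt c (deriv c t) t := (hc.differentiable (by simp) t).hasDerivAt
    have h2 := (ContinuousMap.evalCLM ℝ (⟨x, hx⟩ : L)).hasFDerivAt.comp_hasDerivAt t h1
    simp only [extendZero_mem _ hx]
    exact h2.deriv.symm
  · simp only [extendZero_notMem _ hx, deriv_const]

theorem extendZero_deriv_deriv {c : ℝ → C(L, F)} (hc : ContDiff ℝ ∞ c) (t : ℝ) (x : Eu d) :
    extendZero (deriv (deriv c) t : C(L, F)) x = deriv (deriv fun s => extendZero (c s) x) t := by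
  have h1 : ContDiff ℝ ∞ (deriv c) := ContDiff.iterate_deriv 1 hc
  rw [extendZero_deriv h1]
  congr 1
  funext s
  exact extendZero_deriv hc s x

end CurveOfFields

namespace IsDeformation

variable {d : ℕ} {L D Ω : Set (Eu d)} {T : ℝ × Eu d → Eu d} {η : Eu d → Eu d}

theorem spaceDeriv_timeDeriv (h : IsDeformation L T) (h1 : ∀ x, timeDeriv T (0, x) = η x)
    (x : Eu d) : spaceDeriv (timeDeriv T) (0, x) = jac η x := by
  have h2 := (hasFDerivAt_slice (contDiff_timeDeriv h.smooth) 0 x).fderiv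
  simp only [h1] at h2
  exact h2.symm

theorem spaceDeriv_timeDeriv_timeDeriv (h : IsDeformation L T) (hη : ContDiff ℝ ∞ η)
    (h2 : ∀ x, timeDeriv (timeDeriv T) (0, x) = fderiv ℝ η x (η x)) (x : Eu d) :
    spaceDeriv (timeDeriv (timeDeriv T)) (0, x) = along η (jac η) x + jac η x * jac η x := by
  have h3 := (hasFDerivAt_slice (contDiff_timeDeriv (contDiff_timeDeriv h.smooth)) 0 x).fderiv
  simp only [h2] at h3
  rw [← fderiv_along_self hη]
  exact h3.symm

/-- Only the velocity η and the acceleration (Dη)η at time zero are prescribed, so this covers both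
the true flow and its second order expansion. -/
theorem defect_jets (h : IsDeformation L T) (hη : ContDiff ℝ ∞ η)
    (h1 : ∀ x, timeDeriv T (0, x) = η x)
    (h2 : ∀ x, timeDeriv (timeDeriv T) (0, x) = fderiv ℝ η x (η x)) (x : Eu d) :
    deriv (fun s => pullDefect (spaceDeriv T (s, x))) 0 = deltaA η x ∧
    deriv (deriv fun s => pullDefect (spaceDeriv T (s, x))) 0 = (2 : ℝ) • delta2A η x := by
  have hj := pullMatrix_jets (b := fun s => spaceDeriv T (s, x))
    (b₁ := fun s => spaceDeriv (timeDeriv T) (s, x)) (h.spaceDeriv_zero x)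
    (Eventually.of_forall fun t => hasDerivAt_spaceDeriv h.smooth t x)
    (h.spaceDeriv_timeDeriv h1 x)
    (hasDerivAt_spaceDeriv (contDiff_timeDeriv h.smooth) 0 x)
  rw [h.spaceDeriv_timeDeriv_timeDeriv hη h2] at hj
  have hc : ContinuousAt (fun s => spaceDeriv T (s, x)) 0 :=
    (hasDerivAt_spaceDeriv h.smooth 0 x).continuousAt
  have he : (fun s => pullDefect (spaceDeriv T (s, x))) =ᶠ[𝓝 0]
      fun s => pullMatrix (spaceDeriv T (s, x)) - 1 := by
    have hb : Metric.closedBall (1 : Eu d →L[ℝ] Eu d) (1 / 4) ∈ 𝓝 (spaceDeriv T (0, x)) := by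
      rw [h.spaceDeriv_zero]
      exact Metric.closedBall_mem_nhds _ (by norm_num)
    filter_upwards [hc hb] with s hs
    exact pullDefect_eq (mem_closedBall_iff_norm.1 hs)
  constructor
  · rw [he.deriv_eq, (hj.1.sub_const 1).deriv, deltaA_eq]
  · rw [he.deriv.deriv_eq]
    have e1 : (deriv fun s => pullMatrix (spaceDeriv T (s, x)) - 1)
        = deriv fun s => pullMatrix (spaceDeriv T (s, x)) := by
      funext s
      exact deriv_sub_const _
    rw [e1, hj.2.deriv, two_smul_delta2A hη, map_add]
    -- The second time derivative of the Jacobian matrix is (η·∇)Dη + (Dη)². Its square term removes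
    -- one of the two (Dη)² here, and its trace cancels -tr((Dη)²) in the determinant.
    have e2 : jac η x * jac η x + jac η x * jac η x
        - (along η (jac η) x + jac η x * jac η x) = jac η x * jac η x - along η (jac η) x := by
      abel
    have e3 : ∀ a b c : ℝ, a - b + (c + b) = a + c := fun a b c => by ring
    rw [e2, e3]

theorem det_defect_jets (h : IsDeformation L T) (hη : ContDiff ℝ ∞ η)
    (h1 : ∀ x, timeDeriv T (0, x) = η x)
    (h2 : ∀ x, timeDeriv (timeDeriv T) (0, x) = fderiv ℝ η x (η x)) (x : Eu d) :
    deriv (fun s => (spaceDeriv T (s, x)).det - 1) 0 = diverg η x ∧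
    deriv (deriv fun s => (spaceDeriv T (s, x)).det - 1) 0
      = diverg η x ^ 2 + along η (diverg η) x := by
  have hj := det_jets (b := fun s => spaceDeriv T (s, x))
    (b₁ := fun s => spaceDeriv (timeDeriv T) (s, x)) (h.spaceDeriv_zero x)
    (Eventually.of_forall fun t => hasDerivAt_spaceDeriv h.smooth t x)
    (h.spaceDeriv_timeDeriv h1 x)
    (hasDerivAt_spaceDeriv (contDiff_timeDeriv h.smooth) 0 x)
  rw [h.spaceDeriv_timeDeriv_timeDeriv hη h2] at hj
  constructor
  · rw [(hj.1.sub_const 1).deriv]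
    rfl
  · have e1 : (deriv fun s => (spaceDeriv T (s, x)).det - 1)
        = deriv fun s => (spaceDeriv T (s, x)).det := by
      funext s
      exact deriv_sub_const _
    rw [e1, hj.2.deriv, along_diverg hη, map_add]
    have e3 : ∀ a b c : ℝ, a - b + (c + b) = a + c := fun a b c => by ring
    rw [e3]
    rfl

variable [CompactSpace L]

theorem deriv_pullOp (h : IsDeformation L T) (t : ℝ) :
    deriv h.pullOp t = mulOp L (deriv (curryOn L h.contDiff_defect.continuous) t) := by
  have h1 := ((contDiff_curryOn (L := L) h.contDiff_defect).differentiable (by simp) t).hasDerivAt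
  exact (((mulOp L).hasFDerivAt.comp_hasDerivAt t h1).const_add 1).deriv

theorem deriv_deriv_pullOp (h : IsDeformation L T) (t : ℝ) :
    deriv (deriv h.pullOp) t
      = mulOp L (deriv (deriv (curryOn L h.contDiff_defect.continuous)) t) := by
  have h0 : ContDiff ℝ ∞ (deriv (curryOn L h.contDiff_defect.continuous)) :=
    ContDiff.iterate_deriv 1 (contDiff_curryOn h.contDiff_defect)
  have h1 := (h0.differentiable (by simp) t).hasDerivAt
  rw [funext h.deriv_pullOp]
  exact ((mulOp L).hasFDerivAt.comp_hasDerivAt t h1).deriv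

theorem coeFn_deriv_pullOp (h : IsDeformation L T) (hη : ContDiff ℝ ∞ η)
    (h1 : ∀ x, timeDeriv T (0, x) = η x)
    (h2 : ∀ x, timeDeriv (timeDeriv T) (0, x) = fderiv ℝ η x (η x)) (f : L2 d) :
    deriv h.pullOp 0 f =ᵐ[volume] fun x => deltaA η x (f x) := by
  rw [h.deriv_pullOp]
  filter_upwards [coeFn_mulOp (deriv (curryOn L h.contDiff_defect.continuous) 0) f] with x e
  rw [e, extendZero_deriv (contDiff_curryOn h.contDiff_defect)]
  simp only [h.extendZero_defect]
  rw [(h.defect_jets hη h1 h2 x).1]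

theorem coeFn_deriv_deriv_pullOp (h : IsDeformation L T) (hη : ContDiff ℝ ∞ η)
    (h1 : ∀ x, timeDeriv T (0, x) = η x)
    (h2 : ∀ x, timeDeriv (timeDeriv T) (0, x) = fderiv ℝ η x (η x)) (f : L2 d) :
    deriv (deriv h.pullOp) 0 f =ᵐ[volume] fun x => ((2 : ℝ) • delta2A η x) (f x) := by
  rw [h.deriv_deriv_pullOp]
  filter_upwards [coeFn_mulOp (deriv (deriv (curryOn L h.contDiff_defect.continuous)) 0) f]
    with x e
  rw [e, extendZero_deriv_deriv (contDiff_curryOn h.contDiff_defect)]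
  simp only [h.extendZero_defect]
  rw [(h.defect_jets hη h1 h2 x).2]

/-- First and second derivatives of the volume along a deformation. -/
theorem volume_jets (h : IsDeformation L T) (hη : ContDiff ℝ ∞ η)
    (h1 : ∀ x, timeDeriv T (0, x) = η x)
    (h2 : ∀ x, timeDeriv (timeDeriv T) (0, x) = fderiv ℝ η x (η x)) (hΩo : IsOpen Ω)
    (hΩ : volume Ω ≠ ⊤) :
    HasDerivAt (fun t => volume.real ((fun x => T (t, x)) '' Ω)) (deltaVol Ω η) 0 ∧
    HasDerivAt (deriv fun t => volume.real ((fun x => T (t, x)) '' Ω)) (delta2Vol Ω η) 0 := by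
  have he := h.eventually_volume hΩo hΩ
  have hD : ContDiff ℝ ∞ (deriv h.detField) := ContDiff.iterate_deriv 1 h.contDiff_detField
  have d1 : ∀ t, HasDerivAt (fun t => volume.real Ω + integralOn L Ω (h.detField t))
      (integralOn L Ω (deriv h.detField t)) t := fun t =>
    ((integralOn L Ω).hasFDerivAt.comp_hasDerivAt t
      (h.contDiff_detField.differentiable (by simp) t).hasDerivAt).const_add _
  have d2 : HasDerivAt (fun t => integralOn L Ω (deriv h.detField t))
      (integralOn L Ω (deriv (deriv h.detField) 0)) 0 :=
    (integralOn L Ω).hasFDerivAt.comp_hasDerivAt 0 (hD.differentiable (by simp) 0).hasDerivAt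
  have e1 : integralOn L Ω (deriv h.detField 0) = deltaVol Ω η := by
    rw [integralOn_apply, deltaVol]
    refine integral_congr_ae (Eventually.of_forall fun x => ?_)
    simp only [extendZero_deriv h.contDiff_detField, h.extendZero_detField]
    exact (h.det_defect_jets hη h1 h2 x).1
  have e2 : integralOn L Ω (deriv (deriv h.detField) 0) = delta2Vol Ω η := by
    rw [integralOn_apply, delta2Vol]
    refine integral_congr_ae (Eventually.of_forall fun x => ?_)
    simp only [extendZero_deriv_deriv h.contDiff_detField, h.extendZero_detField]
    exact (h.det_defect_jets hη h1 h2 x).2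
  rw [e2] at d2
  constructor
  · have := (d1 0).congr_of_eventuallyEq he
    rwa [e1] at this
  · refine d2.congr_of_eventuallyEq ?_
    refine (EventuallyEq.deriv he).trans (Eventually.of_forall fun t => ?_)
    exact (d1 t).deriv

theorem pertSol_one (a : L2 d) : pertSol (gradSpace Ω) a 1 = harmonicPart Ω a := by
  rw [pertSol, compression_one, Ring.inverse_one]
  rfl

/-- First and second derivatives of the heat functional along a deformation. -/
theorem heat_jets {φ ϕ : Eu d → ℝ} (h : IsDeformation L T) (hη : ContDiff ℝ ∞ η)
    (h1 : ∀ x, timeDeriv T (0, x) = η x)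
    (h2 : ∀ x, timeDeriv (timeDeriv T) (0, x) = fderiv ℝ η x (η x)) (hd : 0 < d) (hDo : IsOpen D)
    (hDb : Bornology.IsBounded D) (hLD : L ⊆ D) (hΩo : IsOpen Ω) (hΩD : Ω ⊆ D)
    (hK : IsCompact (D \ Ω)) (hφ : ContDiff ℝ ∞ φ) (hϕ : ContDiff ℝ ∞ ϕ) :
    HasDerivAt (fun t => heat D φ ϕ ((fun x => T (t, x)) '' Ω)) (deltaHeat D φ ϕ Ω η) 0 ∧
    HasDerivAt (deriv fun t => heat D φ ϕ ((fun x => T (t, x)) '' Ω))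
      (delta2Heat D φ ϕ Ω η) 0 := by
  obtain ⟨a, b, ha, hb, ha0, hb0, he⟩ := h.eventually_heat hd hDo hDb hLD hΩo hΩD hK hφ hϕ
  obtain ⟨j1, j2⟩ := pertEnergy_curve (gradSpace Ω) h.contDiff_pullOp.contDiffAt h.pullOp_zero
    (Eventually.of_forall h.inner_pullOp_symm) a b
  rw [pertSol_one, pertSol_one] at j1 j2
  have A1 := h.coeFn_deriv_pullOp hη h1 h2
  have A2 := h.coeFn_deriv_deriv_pullOp hη h1 h2
  set u := harmonicPart Ω a
  set v := harmonicPart Ω b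
  have hstate : ∀ {f : Eu d → ℝ} {w : L2 d}, D.indicator (stateGrad D f Ω) =ᵐ[volume] w →
      ∀ᵐ x, x ∈ Ω → stateGrad D f Ω x = w x := by
    intro f w hw
    filter_upwards [hw] with x hx hxΩ
    rw [← hx, indicator_of_mem (hΩD hxΩ)]
  -- This identifies A'u with the field 1_Ω (δA)∇u_Ω, so that minus its projection is ∇(δu).
  have hX : ∀ {f : Eu d → ℝ} {w : L2 d}, D.indicator (stateGrad D f Ω) =ᵐ[volume] w →
      (∀ᵐ x, x ∉ Ω → w x = 0) →
      deriv h.pullOp 0 w =ᵐ[volume] Ω.indicator fun x => deltaA η x (stateGrad D f Ω x) := by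
    intro f w hw hw0
    filter_upwards [A1 w, hstate hw, hw0] with x e1 e2 e3
    rw [e1]
    by_cases hx : x ∈ Ω
    · rw [indicator_of_mem hx, e2 hx]
    · rw [indicator_of_notMem hx, e3 hx, map_zero]
  have hΩb : Bornology.IsBounded Ω := hDb.subset hΩD
  have hδu := dirichletSol_ae_eq hd hΩb hΩo (hX ha ha0)
  have hδv := dirichletSol_ae_eq hd hΩb hΩo (hX hb hb0)
  have hwhole : ∀ {F G : Eu d → ℝ}, (∀ᵐ x, x ∈ Ω → F x = G x) → (∀ᵐ x, x ∉ Ω → G x = 0) →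
      ∫ x in Ω, F x = ∫ x, G x := by
    intro F G h3 h4
    rw [← integral_indicator hΩo.measurableSet]
    refine integral_congr_ae ?_
    filter_upwards [h3, h4] with x e3 e4
    by_cases hx : x ∈ Ω
    · rw [indicator_of_mem hx, e3 hx]
    · rw [indicator_of_notMem hx, e4 hx]
  have E1 : inner ℝ (deriv h.pullOp 0 u) v = deltaHeat D φ ϕ Ω η := by
    rw [inner_L2_eq (A1 u) (EventuallyEq.refl _ v), deltaHeat]
    symm
    refine hwhole ?_ ?_
    · filter_upwards [hstate ha, hstate hb] with x e1 e2 hx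
      rw [e1 hx, e2 hx, inner_deltaA]
    · filter_upwards [hb0] with x e hx
      rw [e hx, inner_zero_right]
  have E2 : inner ℝ (deriv (deriv h.pullOp) 0 u) v
      - 2 * inner ℝ ((gradSpace Ω).starProjection (deriv h.pullOp 0 u))
        ((gradSpace Ω).starProjection (deriv h.pullOp 0 v)) = delta2Heat D φ ϕ Ω η := by
    set p : L2 d := -(gradSpace Ω).starProjection (deriv h.pullOp 0 u)
    set q : L2 d := -(gradSpace Ω).starProjection (deriv h.pullOp 0 v)
    have e0 : inner ℝ ((gradSpace Ω).starProjection (deriv h.pullOp 0 u))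
        ((gradSpace Ω).starProjection (deriv h.pullOp 0 v)) = inner ℝ p q := by
      rw [inner_neg_neg]
    have hq0 : ∀ᵐ x, x ∉ Ω → q x = 0 :=
      ae_zero_of_mem_gradSpace (neg_mem (Submodule.starProjection_apply_mem _ _))
    have i1 : Integrable (fun x => inner ℝ (((2 : ℝ) • delta2A η x) (u x)) (v x)) := by
      refine (L2.integrable_inner (𝕜 := ℝ) (deriv (deriv h.pullOp) 0 u) v).congr ?_
      filter_upwards [A2 u] with x e
      rw [e]
    have i2 : Integrable (fun x => inner ℝ (p x) (q x)) := L2.integrable_inner (𝕜 := ℝ) p q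
    rw [e0, inner_L2_eq (A2 u) (EventuallyEq.refl _ v),
      inner_L2_eq (EventuallyEq.refl _ p) (EventuallyEq.refl _ q), delta2Heat,
      ← integral_const_mul, ← integral_const_mul, ← integral_sub i1 (i2.const_mul 2)]
    symm
    refine hwhole ?_ ?_
    · filter_upwards [hstate ha, hstate hb, hδu, hδv] with x e1 e2 e3 e4 hx
      rw [e1 hx, e2 hx, deltaStateGrad, deltaStateGrad, e3, e4, inner_delta2A hη]
      ring
    · filter_upwards [hb0, hq0] with x e e' hx
      rw [e hx, e' hx, inner_zero_right, inner_zero_right]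
      ring
  rw [E1] at j1
  rw [E2] at j2
  exact ⟨j1.congr_of_eventuallyEq he, j2.congr_of_eventuallyEq (EventuallyEq.deriv he)⟩

end IsDeformation

end HeatShape

/-! ### Variations along flows and two-parameter deformations -/

namespace HeatShape

/-- A configuration: a bounded open box `D`, smooth data and an open set `Ω` with compact
complement in `D`. -/
structure IsConfig {d : ℕ} (D : Set (Eu d)) (φ ϕ : Eu d → ℝ) (Ω : Set (Eu d)) : Prop where
  dim_pos : 0 < d
  isOpen_box : IsOpen D
  bounded_box : Bornology.IsBounded D
  smooth_left : ContDiff ℝ ∞ φ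
  smooth_right : ContDiff ℝ ∞ ϕ
  isOpen : IsOpen Ω
  subset : Ω ⊆ D
  compact_compl : IsCompact (D \ Ω)

section Jets

variable {d : ℕ} {L D Ω : Set (Eu d)} {φ ϕ : Eu d → ℝ} {θ ξ η : Eu d → Eu d}

theorem IsConfig.volume_ne_top (hC : IsConfig D φ ϕ Ω) : volume Ω ≠ ⊤ :=
  (hC.bounded_box.subset hC.subset).measure_lt_top.ne

namespace IsDeformation

theorem timeDeriv_eq_of_hasDerivAt {F : Type} [NormedAddCommGroup F] [NormedSpace ℝ F]
    {T G : ℝ × Eu d → F} (hT : ContDiff ℝ ∞ T)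
    (h : ∀ t x, HasDerivAt (fun s => T (s, x)) (G (t, x)) t) : timeDeriv T = G := by
  funext ⟨t, x⟩
  exact (hasDerivAt_time hT t x).unique (h t x)

variable [CompactSpace L] {T : ℝ × Eu d → Eu d}

theorem heatPen_jets (h : IsDeformation L T) (hη : ContDiff ℝ ∞ η)
    (h1 : ∀ x, timeDeriv T (0, x) = η x)
    (h2 : ∀ x, timeDeriv (timeDeriv T) (0, x) = fderiv ℝ η x (η x)) (hC : IsConfig D φ ϕ Ω)
    (hLD : L ⊆ D) (Λ : ℝ) :
    (∀ᶠ t in 𝓝 0, DifferentiableAt ℝ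
      (fun t => heatPen D φ ϕ Λ ((fun x => T (t, x)) '' Ω)) t) ∧
    HasDerivAt (fun t => heatPen D φ ϕ Λ ((fun x => T (t, x)) '' Ω))
      (deltaHeatPen D φ ϕ Λ Ω η) 0 ∧
    HasDerivAt (deriv fun t => heatPen D φ ϕ Λ ((fun x => T (t, x)) '' Ω))
      (delta2HeatPen D φ ϕ Λ Ω η) 0 := by
  have v := h.volume_jets hη h1 h2 hC.isOpen hC.volume_ne_top
  have f := h.heat_jets hη h1 h2 hC.dim_pos hC.isOpen_box hC.bounded_box hLD hC.isOpen hC.subset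
    hC.compact_compl hC.smooth_left hC.smooth_right
  have v' := eventually_hasDerivAt_of_contDiffAt (h.contDiffAt_volume hC.isOpen hC.volume_ne_top)
  have f' := eventually_hasDerivAt_of_contDiffAt (h.contDiffAt_heat hC.dim_pos hC.isOpen_box
    hC.bounded_box hLD hC.isOpen hC.subset hC.compact_compl hC.smooth_left hC.smooth_right)
  refine ⟨?_, f.1.add (v.1.const_mul Λ), (f.2.add (v.2.const_mul Λ)).congr_of_eventuallyEq ?_⟩
  · filter_upwards [v', f'] with t a b
    exact (b.add (a.const_mul Λ)).differentiableAt
  · filter_upwards [v', f'] with t a b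
    exact (b.add (a.const_mul Λ)).deriv

end IsDeformation

section FlowOfField

variable {Φ : ℝ → Eu d → Eu d}

/-- Points outside the support of η are stationary, by uniqueness for the Lipschitz field η. -/
theorem IsFlow.isDeformation (hΦ : IsFlow η Φ) (hη : IsTest D η) :
    IsDeformation (tsupport η) fun q : ℝ × Eu d => Φ q.1 q.2 := by
  refine ⟨hΦ.smooth, hΦ.init, fun t x hx => ?_⟩
  obtain ⟨K, hK⟩ := hη.smooth.lipschitzWith_of_hasCompactSupport hη.compact (by simp)
  have h0 : η x = 0 := image_eq_zero_of_notMem_tsupport hx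
  have := ODE_solution_unique_univ (v := fun _ => η) (s := fun _ => univ) (K := K) (t₀ := 0)
    (f := fun t => Φ t x) (g := fun _ => x) (fun _ => hK.lipschitzOnWith)
    (fun t => ⟨hΦ.ode t x, mem_univ _⟩)
    (fun t => ⟨by rw [h0]; exact hasDerivAt_const t x, mem_univ _⟩) (hΦ.init x)
  exact congrFun this t

theorem IsFlow.timeDeriv_eq (hΦ : IsFlow η Φ) :
    timeDeriv (fun q : ℝ × Eu d => Φ q.1 q.2) = fun q => η (Φ q.1 q.2) :=
  IsDeformation.timeDeriv_eq_of_hasDerivAt hΦ.smooth hΦ.ode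

theorem IsFlow.heatPen_jets (hΦ : IsFlow η Φ) (hη : IsTest D η) (hC : IsConfig D φ ϕ Ω) (Λ : ℝ) :
    (∀ᶠ t in 𝓝 0, DifferentiableAt ℝ (fun t => heatPen D φ ϕ Λ (Φ t '' Ω)) t) ∧
    HasDerivAt (fun t => heatPen D φ ϕ Λ (Φ t '' Ω)) (deltaHeatPen D φ ϕ Λ Ω η) 0 ∧
    HasDerivAt (deriv fun t => heatPen D φ ϕ Λ (Φ t '' Ω)) (delta2HeatPen D φ ϕ Λ Ω η) 0 := by
  have : CompactSpace (tsupport η) := isCompact_iff_compactSpace.1 hη.compact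
  refine (hΦ.isDeformation hη).heatPen_jets hη.smooth (fun x => ?_) (fun x => ?_) hC hη.supp Λ
  · rw [hΦ.timeDeriv_eq]
    exact congrArg η (hΦ.init x)
  · rw [hΦ.timeDeriv_eq]
    have hs : ContDiff ℝ ∞ fun q : ℝ × Eu d => η (Φ q.1 q.2) := hη.smooth.comp hΦ.smooth
    have h1 := hasDerivAt_time hs 0 x
    have h2 : HasFDerivAt η (fderiv ℝ η (Φ 0 x)) (Φ 0 x) :=
      (hη.smooth.differentiable (by simp) _).hasFDerivAt
    have h3 := h1.unique (h2.comp_hasDerivAt 0 (hΦ.ode 0 x))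
    rw [hΦ.init] at h3
    exact h3

end FlowOfField

/-- The second order expansion of the flow of `θ`, minus the identity. -/
noncomputable def flowExpansion (θ : Eu d → Eu d) (q : ℝ × Eu d) : Eu d :=
  q.1 • θ q.2 + (q.1 ^ 2 / 2) • fderiv ℝ θ q.2 (θ q.2)

/-- A two parameter deformation generated by two vector fields. -/
noncomputable def deform (θ ξ : Eu d → Eu d) (q : (ℝ × ℝ) × Eu d) : Eu d :=
  q.2 + flowExpansion θ (q.1.1, q.2) + flowExpansion ξ (q.1.2, q.2)

theorem contDiff_flowExpansion (hθ : ContDiff ℝ ∞ θ) : ContDiff ℝ ∞ (flowExpansion θ) := by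
  have h1 : ContDiff ℝ ∞ fun q : ℝ × Eu d => θ q.2 := hθ.comp contDiff_snd
  have h2 : ContDiff ℝ ∞ fun q : ℝ × Eu d => fderiv ℝ θ q.2 :=
    (hθ.fderiv_right (m := ∞) (by simp)).comp contDiff_snd
  exact (contDiff_fst.smul h1).add (((contDiff_fst.pow 2).div_const 2).smul (h2.clm_apply h1))

theorem flowExpansion_zero (θ : Eu d → Eu d) (x : Eu d) : flowExpansion θ (0, x) = 0 := by
  simp [flowExpansion]

theorem flowExpansion_of_notMem (t : ℝ) {x : Eu d} (hx : x ∉ tsupport θ) :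
    flowExpansion θ (t, x) = 0 := by
  simp [flowExpansion, image_eq_zero_of_notMem_tsupport hx]

theorem isDeformation_deform (hθ : ContDiff ℝ ∞ θ) (hξ : ContDiff ℝ ∞ ξ) :
    IsDeformation (tsupport θ ∪ tsupport ξ) (deform θ ξ) := by
  refine ⟨?_, fun x => ?_, fun p x hx => ?_⟩
  · have h1 : ContDiff ℝ ∞ fun q : (ℝ × ℝ) × Eu d => (q.1.1, q.2) := by fun_prop
    have h2 : ContDiff ℝ ∞ fun q : (ℝ × ℝ) × Eu d => (q.1.2, q.2) := by fun_prop
    exact (contDiff_snd.add ((contDiff_flowExpansion hθ).comp h1)).add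
      ((contDiff_flowExpansion hξ).comp h2)
  · simp [deform, flowExpansion_zero]
  · rw [mem_union, not_or] at hx
    simp [deform, flowExpansion_of_notMem _ hx.1, flowExpansion_of_notMem _ hx.2]

theorem isDeformation_flowExpansion (hθ : ContDiff ℝ ∞ θ) :
    IsDeformation (tsupport θ) fun q : ℝ × Eu d => q.2 + flowExpansion θ q := by
  refine ⟨contDiff_snd.add (contDiff_flowExpansion hθ), fun x => ?_, fun p x hx => ?_⟩
  · simp [flowExpansion_zero]
  · simp [flowExpansion_of_notMem _ hx]

theorem timeDeriv_flowExpansion (hθ : ContDiff ℝ ∞ θ) :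
    timeDeriv (fun q : ℝ × Eu d => q.2 + flowExpansion θ q)
      = fun q => θ q.2 + q.1 • fderiv ℝ θ q.2 (θ q.2) := by
  refine IsDeformation.timeDeriv_eq_of_hasDerivAt
    (contDiff_snd.add (contDiff_flowExpansion hθ)) fun t x => ?_
  have h1 : HasDerivAt (fun s : ℝ => s • θ x) ((1 : ℝ) • θ x) t := (hasDerivAt_id t).smul_const _
  have h2 : HasDerivAt (fun s : ℝ => s ^ 2 / 2) t t := by
    refine ((hasDerivAt_pow 2 t).div_const 2).congr_deriv ?_
    simp
  have h3 := (h1.add (h2.smul_const (fderiv ℝ θ x (θ x)))).const_add x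
  rw [one_smul] at h3
  exact h3

theorem timeDeriv_timeDeriv_flowExpansion (hθ : ContDiff ℝ ∞ θ) :
    timeDeriv (timeDeriv fun q : ℝ × Eu d => q.2 + flowExpansion θ q)
      = fun q => fderiv ℝ θ q.2 (θ q.2) := by
  refine IsDeformation.timeDeriv_eq_of_hasDerivAt
    (contDiff_timeDeriv (isDeformation_flowExpansion hθ).smooth) fun t x => ?_
  rw [timeDeriv_flowExpansion hθ]
  have h1 : HasDerivAt (fun s : ℝ => s • fderiv ℝ θ x (θ x)) ((1 : ℝ) • fderiv ℝ θ x (θ x)) t :=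
    (hasDerivAt_id t).smul_const _
  rw [one_smul] at h1
  exact h1.const_add (θ x)

/-- The polynomial deformation has the same velocity and acceleration at time zero as the flow,
hence the same first and second variations. Being explicit, it extends at once to two parameters
without composing flows. -/
theorem heatPen_flowExpansion (hθ : IsTest D θ) (hC : IsConfig D φ ϕ Ω) (Λ : ℝ) :
    HasDerivAt (fun t => heatPen D φ ϕ Λ ((fun x => x + flowExpansion θ (t, x)) '' Ω))
      (deltaHeatPen D φ ϕ Λ Ω θ) 0 ∧
    HasDerivAt (deriv fun t => heatPen D φ ϕ Λ ((fun x => x + flowExpansion θ (t, x)) '' Ω))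
      (delta2HeatPen D φ ϕ Λ Ω θ) 0 := by
  have : CompactSpace (tsupport θ) := isCompact_iff_compactSpace.1 hθ.compact
  refine ((isDeformation_flowExpansion hθ.smooth).heatPen_jets hθ.smooth (fun x => ?_)
    (fun x => ?_) hC hθ.supp Λ).2
  · simp [timeDeriv_flowExpansion hθ.smooth]
  · rw [timeDeriv_timeDeriv_flowExpansion hθ.smooth]

theorem volume_flowExpansion (hθ : IsTest D θ) (hΩo : IsOpen Ω) (hΩ : volume Ω ≠ ⊤) :
    HasDerivAt (fun t => volume.real ((fun x => x + flowExpansion θ (t, x)) '' Ω))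
      (deltaVol Ω θ) 0 := by
  have : CompactSpace (tsupport θ) := isCompact_iff_compactSpace.1 hθ.compact
  refine ((isDeformation_flowExpansion hθ.smooth).volume_jets hθ.smooth (fun x => ?_)
    (fun x => ?_) hΩo hΩ).1
  · simp [timeDeriv_flowExpansion hθ.smooth]
  · rw [timeDeriv_timeDeriv_flowExpansion hθ.smooth]

theorem deform_left (t : ℝ) : (fun x => deform θ ξ ((t, 0), x))
    = fun x => x + flowExpansion θ (t, x) := by
  funext x
  simp [deform, flowExpansion_zero]

theorem deform_right (s : ℝ) : (fun x => deform θ ξ ((0, s), x))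
    = fun x => x + flowExpansion ξ (s, x) := by
  funext x
  simp [deform, flowExpansion_zero]

/-- The penalized functional along a two parameter deformation. -/
noncomputable def deformedPen (D : Set (Eu d)) (φ ϕ : Eu d → ℝ) (Λ : ℝ) (Ω : Set (Eu d))
    (θ ξ : Eu d → Eu d) (p : ℝ × ℝ) : ℝ :=
  heatPen D φ ϕ Λ ((fun x => deform θ ξ (p, x)) '' Ω)

/-- The volume along a two parameter deformation. -/
noncomputable def deformedVol (Ω : Set (Eu d)) (θ ξ : Eu d → Eu d) (p : ℝ × ℝ) : ℝ :=
  volume.real ((fun x => deform θ ξ (p, x)) '' Ω)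

theorem compactSpace_union (hθ : IsTest D θ) (hξ : IsTest D ξ) :
    CompactSpace ↥(tsupport θ ∪ tsupport ξ) :=
  isCompact_iff_compactSpace.1 (hθ.compact.isCompact.union hξ.compact)

theorem contDiffAt_deformedVol (hθ : IsTest D θ) (hξ : IsTest D ξ) (hC : IsConfig D φ ϕ Ω) :
    ContDiffAt ℝ ∞ (deformedVol Ω θ ξ) 0 := by
  have := compactSpace_union hθ hξ
  exact (isDeformation_deform hθ.smooth hξ.smooth).contDiffAt_volume hC.isOpen hC.volume_ne_top

theorem contDiffAt_deformedPen (hθ : IsTest D θ) (hξ : IsTest D ξ) (hC : IsConfig D φ ϕ Ω)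
    (Λ : ℝ) : ContDiffAt ℝ ∞ (deformedPen D φ ϕ Λ Ω θ ξ) 0 := by
  have := compactSpace_union hθ hξ
  exact ((isDeformation_deform hθ.smooth hξ.smooth).contDiffAt_heat hC.dim_pos hC.isOpen_box
    hC.bounded_box (union_subset hθ.supp hξ.supp) hC.isOpen hC.subset hC.compact_compl
    hC.smooth_left hC.smooth_right).add
    (contDiffAt_const.mul (contDiffAt_deformedVol hθ hξ hC))

theorem deform_image_zero (θ ξ : Eu d → Eu d) (Ω : Set (Eu d)) :
    (fun x => deform θ ξ (0, x)) '' Ω = Ω := by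
  have : (fun x => deform θ ξ (0, x)) = id := by
    funext x
    simp [deform, flowExpansion_zero]
  rw [this, image_id]

/-- Small deformations of `Ω` are open subsets of `D` with compact complement. -/
theorem eventually_deform_image (hθ : IsTest D θ) (hξ : IsTest D ξ) (hC : IsConfig D φ ϕ Ω) :
    ∀ᶠ p in 𝓝 0, IsOpen ((fun x => deform θ ξ (p, x)) '' Ω) ∧
      (fun x => deform θ ξ (p, x)) '' Ω ⊆ D ∧
      IsCompact (D \ (fun x => deform θ ξ (p, x)) '' Ω) := by
  have := compactSpace_union hθ hξ
  have hLD : tsupport θ ∪ tsupport ξ ⊆ D := union_subset hθ.supp hξ.supp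
  filter_upwards [(isDeformation_deform hθ.smooth hξ.smooth).eventually_isDiffeo]
    with p ⟨⟨R, hR⟩, _⟩
  exact ⟨hR.isOpen_image hC.isOpen, hR.image_subset_domain hLD hC.subset,
    hR.isCompact_diff_image hLD hC.compact_compl⟩

/-- The integral over `D` of the divergence of a test field vanishes. -/
theorem deltaVol_box (hθ : IsTest D θ) (hDo : IsOpen D) (hD : volume D ≠ ⊤) :
    deltaVol D θ = 0 := by
  have : CompactSpace (tsupport θ) := isCompact_iff_compactSpace.1 hθ.compact
  have h1 := volume_flowExpansion hθ hDo hD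
  refine h1.unique ((hasDerivAt_const (0 : ℝ) (volume.real D)).congr_of_eventuallyEq ?_)
  -- Small deformations supported in D map D onto itself, so the volume is constant in t and the
  -- derivative is zero.
  filter_upwards [(isDeformation_flowExpansion hθ.smooth).eventually_isDiffeo] with t ⟨⟨R, hR⟩, _⟩
  rw [hR.image_domain hθ.supp]

theorem diverg_eq (θ : Eu d → Eu d) (x : Eu d) : diverg θ x = traceL d (fderiv ℝ θ x) := rfl

theorem integrable_diverg (hθ : IsTest D θ) : Integrable (diverg θ) := by
  have h1 : Continuous (diverg θ) := by
    have : Continuous fun x => traceL d (fderiv ℝ θ x) :=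
      (traceL d).continuous.comp (hθ.smooth.continuous_fderiv (by simp))
    exact this
  refine h1.integrable_of_hasCompactSupport (HasCompactSupport.intro hθ.compact fun x hx => ?_)
  have h2 : θ =ᶠ[𝓝 x] fun _ => 0 := by
    filter_upwards [(isClosed_tsupport θ).isOpen_compl.mem_nhds hx] with y hy
    exact image_eq_zero_of_notMem_tsupport hy
  rw [diverg_eq, h2.fderiv_eq, fderiv_const_apply, map_zero]

theorem deltaVol_sub_smul (hθ : IsTest D θ) (hξ : IsTest D ξ) (c : ℝ) :
    deltaVol Ω (fun x => θ x - c • ξ x) = deltaVol Ω θ - c * deltaVol Ω ξ := by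
  rw [deltaVol, deltaVol, deltaVol, ← integral_const_mul,
    ← integral_sub (integrable_diverg hθ).integrableOn
      ((integrable_diverg hξ).integrableOn.const_mul c)]
  refine integral_congr_ae (Eventually.of_forall fun x => ?_)
  have h1 : HasFDerivAt (fun x => θ x - c • ξ x) (fderiv ℝ θ x - c • fderiv ℝ ξ x) x :=
    (hθ.smooth.differentiable (by simp) x).hasFDerivAt.sub
      ((hξ.smooth.differentiable (by simp) x).hasFDerivAt.const_smul c)
  simp only [diverg_eq, h1.fderiv, map_sub, map_smul, smul_eq_mul]

/-- A test field with `∫_Ω div ξ < 0`. -/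
theorem exists_deltaVol_neg (hC : IsConfig D φ ϕ Ω) (hK : volume.real Ω < volume.real D) :
    ∃ ξ, IsTest D ξ ∧ deltaVol Ω ξ < 0 := by
  obtain ⟨χ, hχ, h1, -⟩ := exists_cutoff hC.isOpen_box hC.bounded_box hC.compact_compl
    (sdiff_subset : D \ Ω ⊆ D)
  -- Near D \ Ω this is the identity field, with divergence d. As the integral of div ξ over D is
  -- zero, its integral over Ω is -d |D \ Ω| < 0.
  set ξ : Eu d → Eu d := fun x => χ x • x with hξd
  have hξ : IsTest D ξ := by
    refine IsTest.of_eq_zero (hχ.smooth.smul contDiff_id) hχ.compact.isCompact hχ.supp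
      fun x hx => ?_
    simp [hξd, image_eq_zero_of_notMem_tsupport hx]
  refine ⟨ξ, hξ, ?_⟩
  have hDf : volume D ≠ ⊤ := hC.bounded_box.measure_lt_top.ne
  have h2 := deltaVol_box hξ hC.isOpen_box hDf
  have h3 : ∀ x ∈ D \ Ω, diverg ξ x = d := by
    intro x hx
    have h4 : ξ =ᶠ[𝓝 x] id := by
      filter_upwards [(eventually_nhdsSet_iff_forall.1 h1) x hx] with y hy
      simp [hξd, hy]
    rw [diverg, h4.fderiv_eq, fderiv_id]
    have := LinearMap.trace_id ℝ (Eu d)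
    rw [finrank_euclideanSpace_fin] at this
    exact this
  have hmeas : MeasurableSet (D \ Ω) := hC.isOpen_box.measurableSet.diff hC.isOpen.measurableSet
  have h5 : ∫ x in D, diverg ξ x = (∫ x in D \ Ω, diverg ξ x) + ∫ x in Ω, diverg ξ x := by
    rw [← setIntegral_union disjoint_sdiff_left hC.isOpen.measurableSet
      (integrable_diverg hξ).integrableOn (integrable_diverg hξ).integrableOn,
      sdiff_union_of_subset hC.subset]
  have h6 : ∫ x in D \ Ω, diverg ξ x = volume.real (D \ Ω) * d := by
    rw [setIntegral_congr_fun hmeas h3, setIntegral_const, smul_eq_mul]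
  have h7 : volume.real (D \ Ω) = volume.real D - volume.real Ω :=
    measureReal_sdiff hC.subset hC.isOpen.measurableSet hDf
  have h8 : (0 : ℝ) < d := Nat.cast_pos.2 hC.dim_pos
  rw [deltaVol] at h2 ⊢
  rw [h5, h6, h7] at h2
  nlinarith

end Jets

end HeatShape

namespace HeatShape

/-! ### Constrained minimization in the plane -/

section PlaneCalculus

variable {V G : ℝ × ℝ → ℝ}

theorem fderiv_one_zero {f : ℝ × ℝ → ℝ} (hf : DifferentiableAt ℝ f 0) {a : ℝ}
    (h : HasDerivAt (fun t => f (t, 0)) a 0) : fderiv ℝ f 0 (1, 0) = a := by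
  have h1 : HasDerivAt (fun t : ℝ => ((t, 0) : ℝ × ℝ)) (1, 0) 0 :=
    (hasDerivAt_id 0).prodMk (hasDerivAt_const 0 0)
  exact (HasFDerivAt.comp_hasDerivAt (l := f) (f := fun t : ℝ => ((t, 0) : ℝ × ℝ)) 0 hf.hasFDerivAt h1).unique h

theorem fderiv_zero_one {f : ℝ × ℝ → ℝ} (hf : DifferentiableAt ℝ f 0) {a : ℝ}
    (h : HasDerivAt (fun t => f (0, t)) a 0) : fderiv ℝ f 0 (0, 1) = a := by
  have h1 : HasDerivAt (fun t : ℝ => ((0, t) : ℝ × ℝ)) (0, 1) 0 :=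
    (hasDerivAt_const 0 0).prodMk (hasDerivAt_id 0)
  exact (HasFDerivAt.comp_hasDerivAt (l := f) (f := fun t : ℝ => ((0, t) : ℝ × ℝ)) 0 hf.hasFDerivAt h1).unique h

/-- First order condition for a minimum under one constraint in the plane. -/
theorem mul_eq_mul_of_min (hV : ContDiffAt ℝ ∞ V 0) (hG : ContDiffAt ℝ ∞ G 0) {a b c e : ℝ}
    (ha : HasDerivAt (fun t => V (t, 0)) a 0) (hb : HasDerivAt (fun t => V (0, t)) b 0)
    (hc : HasDerivAt (fun t => G (t, 0)) c 0) (he : HasDerivAt (fun t => G (0, t)) e 0)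
    (hmin : ∀ᶠ p in 𝓝 0, V p = V 0 → G 0 ≤ G p) : a * e = b * c := by
  have hext : IsLocalExtrOn G {p | V p = V 0} 0 :=
    Or.inl (eventually_nhdsWithin_iff.2 hmin)
  obtain ⟨α, β, hne, h0⟩ := hext.exists_multipliers_of_hasStrictFDerivAt_1d
    (hV.hasStrictFDerivAt (by simp)) (hG.hasStrictFDerivAt (by simp))
  have h1 := congrArg (fun F => F ((1, 0) : ℝ × ℝ)) h0
  have h2 := congrArg (fun F => F ((0, 1) : ℝ × ℝ)) h0
  simp only [add_apply, smul_apply, smul_eq_mul, zero_apply,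
    fderiv_one_zero (hV.differentiableAt (by simp)) ha, fderiv_one_zero (hG.differentiableAt (by simp)) hc,
    fderiv_zero_one (hV.differentiableAt (by simp)) hb,
    fderiv_zero_one (hG.differentiableAt (by simp)) he] at h1 h2
  by_cases hα : α = 0
  · have hβ : β ≠ 0 := fun h => hne (by rw [hα, h]; rfl)
    subst hα
    have hc0 : c = 0 := by simpa [hβ] using h1
    have he0 : e = 0 := by simpa [hβ] using h2
    rw [hc0, he0, mul_zero, mul_zero]
  · refine mul_left_cancel₀ hα ?_
    linear_combination e * h1 - c * h2

/-- The second derivative along a curve at a critical point only depends on the velocity. -/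
theorem hasDerivAt_deriv_comp_of_critical {X : Type*} [NormedAddCommGroup X] [NormedSpace ℝ X]
    {G : X → ℝ} {p : ℝ → X} {x : X} (hG : ContDiffAt ℝ ∞ G x) (h0 : fderiv ℝ G x = 0)
    (hp : ContDiffAt ℝ ∞ p 0) (hp0 : p 0 = x) {v : X} (hv : deriv p 0 = v) :
    HasDerivAt (deriv fun t => G (p t)) (fderiv ℝ (fderiv ℝ G) x v v) 0 := by
  have h1 : ∀ᶠ y in 𝓝 x, DifferentiableAt ℝ G y := by
    have h1 : ContDiffAt ℝ 1 G x := hG.of_le (by exact_mod_cast le_top)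
    filter_upwards [h1.eventually (by simp)] with y hy
    exact hy.differentiableAt (by simp)
  rw [← hp0] at h1
  -- Differentiating this once more, the term with the acceleration of p is multiplied by DG(x) = 0.
  have h2 : (deriv fun t => G (p t)) =ᶠ[𝓝 0] fun t => fderiv ℝ G (p t) (deriv p t) := by
    filter_upwards [hp.continuousAt.eventually h1, eventually_hasDerivAt_of_contDiffAt hp]
      with t h3 h4
    exact (h3.hasFDerivAt.comp_hasDerivAt t h4).deriv
  refine HasDerivAt.congr_of_eventuallyEq ?_ h2
  have hd : HasFDerivAt (fderiv ℝ G) (fderiv ℝ (fderiv ℝ G) x) (p 0) := by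
    rw [hp0]
    exact ((hG.fderiv_right (m := ∞) (by simp)).differentiableAt (by simp)).hasFDerivAt
  have h3 := hd.comp_hasDerivAt 0 (hp.differentiableAt (by simp)).hasDerivAt
  have h4 := h3.clm_apply (eventually_hasDerivAt_of_contDiffAt (contDiffAt_deriv hp)).self_of_nhds
  refine h4.congr_deriv ?_
  simp only [Function.comp, hp0, h0, hv, zero_apply, add_zero]

/-- If q were negative, the second derivative test would make 0 a local maximum as well; g would be
locally constant and q zero. -/
theorem deriv_deriv_nonneg_of_isLocalMin {g : ℝ → ℝ} {q : ℝ} (hg : ContinuousAt g 0)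
    (hmin : IsLocalMin g 0) (hq : HasDerivAt (deriv g) q 0) : 0 ≤ q := by
  by_contra! hneg
  have hmax : IsLocalMax g 0 :=
    isLocalMax_of_deriv_deriv_neg (by rwa [hq.deriv]) hmin.deriv_eq_zero hg
  have h1 : g =ᶠ[𝓝 0] fun _ => g 0 := by
    filter_upwards [hmin, hmax] with t h2 h3
    exact le_antisymm h3 h2
  have h2 : deriv g =ᶠ[𝓝 0] fun _ => 0 := h1.deriv.trans (by simp)
  have h3 := hq.unique ((hasDerivAt_const (0 : ℝ) (0 : ℝ)).congr_of_eventuallyEq h2)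
  exact hneg.ne h3

/-- A level curve with horizontal tangent. -/
theorem exists_level_curve (hV : ContDiffAt ℝ ∞ V 0) {b : ℝ} (hb0 : b ≠ 0)
    (ha : HasDerivAt (fun t => V (t, 0)) 0 0) (hb : HasDerivAt (fun t => V (0, t)) b 0) :
    ∃ p : ℝ → ℝ × ℝ, ContDiffAt ℝ ∞ p 0 ∧ p 0 = 0 ∧ deriv p 0 = (1, 0) ∧
      ∀ᶠ t in 𝓝 0, V (p t) = V 0 := by
  have hVd := hV.differentiableAt (by simp)
  have hV' : fderiv ℝ V 0 = b • ContinuousLinearMap.snd ℝ ℝ ℝ := by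
    ext
    · simp [fderiv_one_zero hVd ha]
    · simp [fderiv_zero_one hVd hb]
  -- Straightening the level sets of V: since ∂₂V = b ≠ 0, Ψ is locally invertible, and the curve is
  -- the inverse image of the horizontal line at height V(0). Its velocity is (1, 0) because ∂₁V =
  -- 0.
  let Ψ : ℝ × ℝ → ℝ × ℝ := fun p => (p.1, V p)
  have hΨ : ContDiffAt ℝ ∞ Ψ 0 := contDiffAt_fst.prodMk hV
  let Ψ' : (ℝ × ℝ) ≃L[ℝ] (ℝ × ℝ) := (ContinuousLinearEquiv.refl ℝ ℝ).prodCongr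
    (ContinuousLinearEquiv.unitsEquivAut ℝ (Units.mk0 b hb0))
  have hd : HasFDerivAt Ψ (Ψ' : ℝ × ℝ →L[ℝ] ℝ × ℝ) 0 := by
    have h1 := (hasFDerivAt_fst (𝕜 := ℝ) (p := (0 : ℝ × ℝ))).prodMk hVd.hasFDerivAt
    refine h1.congr_fderiv ?_
    rw [hV']
    ext <;> simp [Ψ']
  have hΨ0 : Ψ 0 = (0, V 0) := rfl
  let R := hΨ.localInverse hd (by simp)
  have hR : ContDiffAt ℝ ∞ R (0, V 0) := hΨ.to_localInverse hd (by simp)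
  have hline : ContDiff ℝ ∞ fun t : ℝ => ((t, V 0) : ℝ × ℝ) := contDiff_id.prodMk contDiff_const
  have hp : ContDiffAt ℝ ∞ (fun t => R (t, V 0)) 0 :=
    ContDiffAt.comp (g := R) 0 hR hline.contDiffAt
  have hp0 : R (0, V 0) = 0 := hΨ.localInverse_apply_image hd (by simp)
  have hinv : ∀ᶠ t in 𝓝 (0 : ℝ), Ψ (R (t, V 0)) = (t, V 0) :=
    hline.continuous.continuousAt.eventually
      ((hΨ.hasStrictFDerivAt' hd (by simp)).eventually_right_inverse)
  have hdp : HasDerivAt (fun t => R (t, V 0)) (deriv (fun t => R (t, V 0)) 0) 0 :=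
    (hp.differentiableAt (by simp)).hasDerivAt
  have hd0 : HasFDerivAt Ψ (Ψ' : ℝ × ℝ →L[ℝ] ℝ × ℝ) (R (0, V 0)) := by rw [hp0]; exact hd
  have h1 := hd0.comp_hasDerivAt 0 hdp
  have h2 : HasDerivAt (fun t : ℝ => ((t, V 0) : ℝ × ℝ)) (1, 0) 0 :=
    (hasDerivAt_id 0).prodMk (hasDerivAt_const 0 _)
  have h3 : Ψ' (deriv (fun t => R (t, V 0)) 0) = (1, 0) :=
    h1.unique (h2.congr_of_eventuallyEq hinv)
  refine ⟨fun t => R (t, V 0), hp, hp0, ?_, ?_⟩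
  · apply Ψ'.injective
    rw [h3]
    simp [Ψ']
  · filter_upwards [hinv] with t ht
    exact congrArg Prod.snd ht

/-- Second order condition for a minimum under one constraint in the plane. -/
theorem second_deriv_nonneg_of_min (hV : ContDiffAt ℝ ∞ V 0) (hG : ContDiffAt ℝ ∞ G 0) {b q : ℝ}
    (hb0 : b ≠ 0) (ha : HasDerivAt (fun t => V (t, 0)) 0 0)
    (hb : HasDerivAt (fun t => V (0, t)) b 0) (hc : HasDerivAt (fun t => G (t, 0)) 0 0)
    (he : HasDerivAt (fun t => G (0, t)) 0 0) (hq : HasDerivAt (deriv fun t => G (t, 0)) q 0)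
    (hmin : ∀ᶠ p in 𝓝 0, V p = V 0 → G 0 ≤ G p) : 0 ≤ q := by
  have hGd := hG.differentiableAt (by simp)
  have hG' : fderiv ℝ G 0 = 0 := by
    ext
    · simp [fderiv_one_zero hGd hc]
    · simp [fderiv_zero_one hGd he]
  obtain ⟨p, hp, hp0, hp', hlevel⟩ := exists_level_curve hV hb0 ha hb
  have h1 := hasDerivAt_deriv_comp_of_critical hG hG' hp hp0 hp'
  have h2 : HasDerivAt (fun t : ℝ => ((t, 0) : ℝ × ℝ)) (1, 0) 0 :=
    (hasDerivAt_id 0).prodMk (hasDerivAt_const 0 0)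
  have h3 := hasDerivAt_deriv_comp_of_critical hG hG' (p := fun t : ℝ => ((t, 0) : ℝ × ℝ))
    (contDiff_id.prodMk contDiff_const).contDiffAt rfl h2.deriv
  -- The level curve and the first axis have the same velocity at the critical point 0, so the
  -- second derivative along the level curve is q.
  rw [h3.unique hq] at h1
  refine deriv_deriv_nonneg_of_isLocalMin (g := fun t => G (p t)) ?_ ?_ h1
  · exact ContinuousAt.comp (g := G) (by rw [hp0]; exact hG.continuousAt) hp.continuousAt
  · have h4 : Tendsto p (𝓝 0) (𝓝 0) := by
      have := hp.continuousAt
      rwa [ContinuousAt, hp0] at this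
    filter_upwards [h4 hmin, hlevel] with t h5 h6
    rw [hp0]
    exact h5 h6

end PlaneCalculus

/-! ### Optimality conditions for the minimizer and the sign of the multiplier -/

section Minimizer

variable {d : ℕ} {D Ω : Set (Eu d)} {φ ϕ : Eu d → ℝ} {θ ξ η : Eu d → Eu d} {m : ℝ}

theorem hasDerivAt_deformedVol_left (hθ : IsTest D θ) (hC : IsConfig D φ ϕ Ω) :
    HasDerivAt (fun t => deformedVol Ω θ ξ (t, 0)) (deltaVol Ω θ) 0 := by
  simp only [deformedVol, deform_left]
  exact volume_flowExpansion hθ hC.isOpen hC.volume_ne_top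

theorem hasDerivAt_deformedVol_right (hξ : IsTest D ξ) (hC : IsConfig D φ ϕ Ω) :
    HasDerivAt (fun t => deformedVol Ω θ ξ (0, t)) (deltaVol Ω ξ) 0 := by
  simp only [deformedVol, deform_right]
  exact volume_flowExpansion hξ hC.isOpen hC.volume_ne_top

theorem hasDerivAt_deformedPen_left (hθ : IsTest D θ) (hC : IsConfig D φ ϕ Ω) (Λ : ℝ) :
    HasDerivAt (fun t => deformedPen D φ ϕ Λ Ω θ ξ (t, 0)) (deltaHeatPen D φ ϕ Λ Ω θ) 0 ∧
    HasDerivAt (deriv fun t => deformedPen D φ ϕ Λ Ω θ ξ (t, 0))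
      (delta2HeatPen D φ ϕ Λ Ω θ) 0 := by
  simp only [deformedPen, deform_left]
  exact heatPen_flowExpansion hθ hC Λ

theorem hasDerivAt_deformedPen_right (hξ : IsTest D ξ) (hC : IsConfig D φ ϕ Ω) (Λ : ℝ) :
    HasDerivAt (fun t => deformedPen D φ ϕ Λ Ω θ ξ (0, t)) (deltaHeatPen D φ ϕ Λ Ω ξ) 0 := by
  simp only [deformedPen, deform_right]
  exact (heatPen_flowExpansion hξ hC Λ).1

/-- On a level set of the volume the penalty is constant, so minimality for 𝓕 is minimality for 𝓕_Λ,
whatever Λ. -/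
theorem IsMinimizer.eventually_le (hΩ : IsMinimizer D φ ϕ m Ω) (hC : IsConfig D φ ϕ Ω)
    (hθ : IsTest D θ) (hξ : IsTest D ξ) (Λ : ℝ) :
    ∀ᶠ p in 𝓝 0, deformedVol Ω θ ξ p = deformedVol Ω θ ξ 0 →
      deformedPen D φ ϕ Λ Ω θ ξ 0 ≤ deformedPen D φ ϕ Λ Ω θ ξ p := by
  filter_upwards [eventually_deform_image hθ hξ hC] with p ⟨h1, h2, h3⟩ hv
  simp only [deformedVol, deformedPen, deform_image_zero, heatPen] at hv ⊢
  have := hΩ.2 _ ⟨h1, h2, hv.trans hΩ.1.measure_eq, h3⟩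
  rw [hv]
  linarith

theorem IsMinimizer.lagrange (hΩ : IsMinimizer D φ ϕ m Ω) (hC : IsConfig D φ ϕ Ω)
    (hθ : IsTest D θ) (hξ : IsTest D ξ) (Λ : ℝ) :
    deltaVol Ω θ * deltaHeatPen D φ ϕ Λ Ω ξ = deltaVol Ω ξ * deltaHeatPen D φ ϕ Λ Ω θ :=
  mul_eq_mul_of_min (contDiffAt_deformedVol hθ hξ hC) (contDiffAt_deformedPen hθ hξ hC Λ)
    (hasDerivAt_deformedVol_left hθ hC) (hasDerivAt_deformedVol_right hξ hC)
    (hasDerivAt_deformedPen_left hθ hC Λ).1 (hasDerivAt_deformedPen_right hξ hC Λ)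
    (hΩ.eventually_le hC hθ hξ Λ)

/-- The field ξ only serves to restore the volume at second order along θ. It does not appear in the
conclusion because 𝓕_Λ is critical in its direction too. -/
theorem IsMinimizer.delta2HeatPen_nonneg (hΩ : IsMinimizer D φ ϕ m Ω) (hC : IsConfig D φ ϕ Ω)
    {Λ : ℝ} (hΛ : ∀ η, IsTest D η → deltaHeatPen D φ ϕ Λ Ω η = 0) (hθ : IsTest D θ)
    (hθ0 : deltaVol Ω θ = 0) (hξ : IsTest D ξ) (hξ0 : deltaVol Ω ξ ≠ 0) :
    0 ≤ delta2HeatPen D φ ϕ Λ Ω θ := by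
  have hV := hasDerivAt_deformedVol_left (ξ := ξ) hθ hC
  have hF := hasDerivAt_deformedPen_left (ξ := ξ) hθ hC Λ
  have hF' := hasDerivAt_deformedPen_right (θ := θ) hξ hC Λ
  rw [hθ0] at hV
  rw [hΛ θ hθ] at hF
  rw [hΛ ξ hξ] at hF'
  exact second_deriv_nonneg_of_min (contDiffAt_deformedVol hθ hξ hC)
    (contDiffAt_deformedPen hθ hξ hC Λ) hξ0 hV (hasDerivAt_deformedVol_right hξ hC) hF.1 hF' hF.2
    (hΩ.eventually_le hC hθ hξ Λ)

/-- An open set can be enlarged by adding a ball, so as to have any larger volume. -/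
theorem exists_enlargement {U : Set (Eu d)} (hd : 0 < d) (hDo : IsOpen D)
    (hDb : Bornology.IsBounded D) (hUo : IsOpen U) (hUD : U ⊆ D) (hK : IsCompact (D \ U))
    (hUm : volume.real U ≤ m) (hmD : m ≤ volume.real D) :
    ∃ W, U ⊆ W ∧ Admissible D m W := by
  have : Nonempty (Fin d) := ⟨⟨0, hd⟩⟩
  let B : ℝ → Set (Eu d) := fun r => Metric.ball 0 r
  let f : ℝ → ℝ := fun r => volume.real (U ∪ B r ∩ D)
  have hfin : ∀ {S : Set (Eu d)}, S ⊆ D → volume S ≠ ⊤ := fun h =>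
    (hDb.subset h).measure_lt_top.ne
  have hBfin : ∀ r, volume (B r) ≠ ⊤ := fun r => measure_ball_lt_top.ne
  have hWD : ∀ r, U ∪ B r ∩ D ⊆ D := fun r => union_subset hUD inter_subset_right
  have hBv : ∀ r, 0 ≤ r → volume.real (B r) = r ^ d * volume.real (B 1) := by
    intro r hr
    have h1 := Measure.addHaar_ball (volume : Measure (Eu d)) 0 hr
    rw [finrank_euclideanSpace_fin] at h1
    rw [measureReal_def, h1, ENNReal.toReal_mul, ENNReal.toReal_ofReal (by positivity)]
    rfl
  have hmono : ∀ {r s}, r ≤ s → f r ≤ f s := fun {r s} h =>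
    measureReal_mono (union_subset_union_right _ (inter_subset_inter_left _
      (Metric.ball_subset_ball h))) (hfin (hWD s))
  -- The volume gained is at most that of the annulus, so f inherits continuity from the volume of
  -- balls; the intermediate value theorem then provides the radius.
  have hstep : ∀ {r s}, r ≤ s → f s - f r ≤ volume.real (B s) - volume.real (B r) := by
    intro r s h
    have h1 : U ∪ B s ∩ D ⊆ (U ∪ B r ∩ D) ∪ (B s \ B r) := by
      rintro x (hx | ⟨hx, hxD⟩)
      · exact Or.inl (Or.inl hx)
      · by_cases hxr : x ∈ B r
        · exact Or.inl (Or.inr ⟨hxr, hxD⟩)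
        · exact Or.inr ⟨hx, hxr⟩
    have h2 : volume (B s \ B r) ≠ ⊤ := ne_top_of_le_ne_top (hBfin s) (measure_mono sdiff_subset)
    have h3 : f s ≤ f r + volume.real (B s \ B r) :=
      (measureReal_mono h1 (measure_union_ne_top (hfin (hWD r)) h2)).trans
        (measureReal_union_le _ _)
    have h4 : volume.real (B s \ B r) = volume.real (B s) - volume.real (B r) :=
      measureReal_sdiff (Metric.ball_subset_ball h) Metric.isOpen_ball.measurableSet (hBfin s)
    linarith
  have hcont : ContinuousOn f (Ici 0) := by
    have hb : ContinuousOn (fun r => volume.real (B r)) (Ici 0) := by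
      refine ContinuousOn.congr (f := fun r => r ^ d * volume.real (B 1)) ?_ fun r hr => hBv r hr
      fun_prop
    intro r hr
    rw [ContinuousWithinAt, tendsto_iff_dist_tendsto_zero]
    have h0 := tendsto_iff_dist_tendsto_zero.1 (hb r hr)
    refine squeeze_zero (fun _ => dist_nonneg) (fun s => ?_) h0
    rw [Real.dist_eq, Real.dist_eq]
    rcases le_total r s with h | h
    · rw [abs_of_nonneg (sub_nonneg.2 (hmono h))]
      exact (hstep h).trans (le_abs_self _)
    · rw [abs_sub_comm, abs_of_nonneg (sub_nonneg.2 (hmono h)), abs_sub_comm]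
      exact (hstep h).trans (le_abs_self _)
  obtain ⟨ρ, hρ⟩ := hDb.subset_ball (0 : Eu d)
  have hf0 : f 0 = volume.real U := by simp [f, B]
  have hfρ : f (max ρ 0) = volume.real D := by
    have : U ∪ B (max ρ 0) ∩ D = D := by
      rw [inter_eq_right.2 (hρ.trans (Metric.ball_subset_ball (le_max_left _ _)))]
      exact union_eq_right.2 hUD
    simp only [f, this]
  obtain ⟨r, -, hr⟩ := intermediate_value_Icc (le_max_right ρ 0)
    (hcont.mono Icc_subset_Ici_self) ⟨hf0.trans_le hUm, hmD.trans_eq hfρ.symm⟩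
  refine ⟨U ∪ B r ∩ D, subset_union_left, hUo.union (Metric.isOpen_ball.inter hDo), hWD r, hr, ?_⟩
  have : D \ (U ∪ B r ∩ D) = (D \ U) ∩ (B r)ᶜ := by
    ext x
    simp only [Set.mem_sdiff, mem_union, mem_inter_iff, mem_compl_iff]
    tauto
  rw [this]
  exact hK.inter_right Metric.isOpen_ball.isClosed_compl

/-- A minimizer cannot be improved by sets of smaller volume. -/
theorem IsMinimizer.heat_le {c : ℝ} (hΩ : IsMinimizer D φ ϕ m Ω) (hC : IsConfig D φ ϕ Ω)
    (hmD : m < volume.real D) (hc : 0 < c) (hφc : ∀ x ∈ frontier D, c ≤ φ x)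
    (hϕc : ∀ x ∈ frontier D, c ≤ ϕ x) {U : Set (Eu d)} (hUo : IsOpen U) (hUD : U ⊆ D)
    (hK : IsCompact (D \ U)) (hUm : volume.real U ≤ m) : heat D φ ϕ Ω ≤ heat D φ ϕ U := by
  obtain ⟨W, hUW, hW⟩ := exists_enlargement hC.dim_pos hC.isOpen_box hC.bounded_box hUo hUD hK hUm
    hmD.le
  exact (hΩ.2 W hW).trans (heat_antitone hC.dim_pos hC.isOpen_box hC.bounded_box hC.smooth_left
    hC.smooth_right hc hφc hϕc hUo hUD hK hW.isOpen hW.subset hW.compact_compl hUW)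

/-- Otherwise a short deformation along ξ would lower both the volume and the heat, against
`IsMinimizer.heat_le`. The value Λ = 0 reduces 𝓕_Λ to 𝓕. -/
theorem IsMinimizer.deltaHeat_nonneg {c : ℝ} (hΩ : IsMinimizer D φ ϕ m Ω) (hC : IsConfig D φ ϕ Ω)
    (hmD : m < volume.real D) (hc : 0 < c) (hφc : ∀ x ∈ frontier D, c ≤ φ x)
    (hϕc : ∀ x ∈ frontier D, c ≤ ϕ x) (hξ : IsTest D ξ) (hξ0 : deltaVol Ω ξ < 0) :
    0 ≤ deltaHeatPen D φ ϕ 0 Ω ξ := by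
  have h1 := hasDerivAt_deformedVol_left (ξ := ξ) hξ hC
  have h2 := (hasDerivAt_deformedPen_left (ξ := ξ) hξ hC 0).1
  have hz : Tendsto (fun t : ℝ => ((t, 0) : ℝ × ℝ)) (𝓝 0) (𝓝 0) := by
    have : Continuous fun t : ℝ => ((t, 0) : ℝ × ℝ) := by fun_prop
    exact this.tendsto 0
  have hadm := hz (eventually_deform_image hξ hξ hC)
  by_contra! hneg
  have hlt : ∀ {f : ℝ → ℝ} {a : ℝ}, HasDerivAt f a 0 → a < 0 → ∀ᶠ t in 𝓝[>] (0 : ℝ), f t < f 0 := by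
    intro f a hf ha
    have h3 := (hasDerivAt_iff_tendsto_slope.1 hf).mono_left
      (nhdsWithin_mono (0 : ℝ) fun t (ht : 0 < t) => ht.ne')
    filter_upwards [h3.eventually_lt_const ha, self_mem_nhdsWithin] with t h4 (h5 : 0 < t)
    rw [slope_def_field, sub_zero] at h4
    have := (div_lt_iff₀ h5).1 h4
    linarith
  obtain ⟨t, hv, hp, h3, h4, h5⟩ := ((hlt h1 hξ0).and ((hlt h2 hneg).and
    (nhdsWithin_le_nhds hadm))).exists
  have hz0 : ((0, 0) : ℝ × ℝ) = 0 := rfl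
  simp only [deformedVol, deformedPen, hz0, deform_image_zero, heatPen, zero_mul, add_zero]
    at hv hp
  rw [hΩ.1.measure_eq] at hv
  exact absurd (hΩ.heat_le hC hmD hc hφc hϕc h3 h4 h5 hv.le) (not_le.2 hp)

/-- In dimension zero the space is a point, so a domain of positive volume is all of D,
contradicting m < |D|. -/
theorem IsMinimizer.dim_pos (hΩ : IsMinimizer D φ ϕ m Ω) (hm : 0 < m) (hmD : m < volume.real D) :
    0 < d := by
  rcases Nat.eq_zero_or_pos d with rfl | h
  · exfalso
    have h1 : Ω.Nonempty := by
      rw [nonempty_iff_ne_empty]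
      rintro rfl
      have := hΩ.1.measure_eq
      simp at this
      exact hm.ne this
    have h2 : Ω = univ := Subsingleton.eq_univ_of_nonempty h1
    have h3 : D = univ := univ_subset_iff.1 (h2 ▸ hΩ.1.subset)
    have := hΩ.1.measure_eq
    rw [h2, ← h3] at this
    exact hmD.ne' this
  · exact h

end Minimizer

end HeatShape

theorem theorem2p1 (d : ℕ) (D : Set (HeatShape.Eu d)) (hDo : IsOpen D)
    (hDb : Bornology.IsBounded D)
    (φ ϕ : HeatShape.Eu d → ℝ) (hφ : ContDiff ℝ ∞ φ) (hϕ : ContDiff ℝ ∞ ϕ)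
    (c C : ℝ) (hc : 0 < c)
    (hφb : ∀ x ∈ frontier D, c ≤ φ x ∧ φ x ≤ C)
    (hϕb : ∀ x ∈ frontier D, c ≤ ϕ x ∧ ϕ x ≤ C)
    (m : ℝ) (hm : 0 < m) (hmD : m < volume.real D)
    (Ω : Set (HeatShape.Eu d)) (hΩ : HeatShape.IsMinimizer D φ ϕ m Ω) :
    ∃ Λ : ℝ, 0 ≤ Λ ∧
      (∀ η : HeatShape.Eu d → HeatShape.Eu d, HeatShape.IsTest D η →
        HeatShape.HasFirstVariation (HeatShape.heatPen D φ ϕ Λ) Ω η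
          (HeatShape.deltaHeatPen D φ ϕ Λ Ω η) ∧
        HeatShape.deltaHeatPen D φ ϕ Λ Ω η = 0) ∧
      (∀ η ξ : HeatShape.Eu d → HeatShape.Eu d, HeatShape.IsTest D η → HeatShape.IsTest D ξ →
        Disjoint (tsupport η) (tsupport ξ) →
        (∫ x in Ω, HeatShape.diverg ξ x) ≠ 0 →
        HeatShape.HasSecondVariation (HeatShape.heatPen D φ ϕ Λ) Ω
          (HeatShape.corrected Ω η ξ)
          (HeatShape.delta2HeatPen D φ ϕ Λ Ω (HeatShape.corrected Ω η ξ)) ∧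
        0 ≤ HeatShape.delta2HeatPen D φ ϕ Λ Ω (HeatShape.corrected Ω η ξ)) := by
  have hd : 0 < d := hΩ.dim_pos hm hmD
  have hC : HeatShape.IsConfig D φ ϕ Ω := ⟨hd, hDo, hDb, hφ, hϕ, hΩ.1.isOpen, hΩ.1.subset,
    hΩ.1.compact_compl⟩
  obtain ⟨ξ₀, hξ₀, hneg⟩ := HeatShape.exists_deltaVol_neg hC (by rwa [hΩ.1.measure_eq])
  have hF₀ : 0 ≤ HeatShape.deltaHeatPen D φ ϕ 0 Ω ξ₀ := hΩ.deltaHeat_nonneg hC hmD hc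
    (fun x hx => (hφb x hx).1) (fun x hx => (hϕb x hx).1) hξ₀ hneg
  have hpen : ∀ (Λ : ℝ) (η : HeatShape.Eu d → HeatShape.Eu d),
      HeatShape.deltaHeatPen D φ ϕ Λ Ω η
        = HeatShape.deltaHeatPen D φ ϕ 0 Ω η + Λ * HeatShape.deltaVol Ω η := by
    intro Λ η
    simp only [HeatShape.deltaHeatPen, zero_mul, add_zero]
  -- The only value that makes 𝓕_Λ critical along ξ₀. The numerator is nonnegative by monotonicity
  -- and the denominator is positive. The Lagrange relation between ξ₀ and any η then propagates
  -- criticality to all fields.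
  set Λ : ℝ := HeatShape.deltaHeatPen D φ ϕ 0 Ω ξ₀ / -HeatShape.deltaVol Ω ξ₀ with hΛ
  have hcrit : ∀ η, HeatShape.IsTest D η → HeatShape.deltaHeatPen D φ ϕ Λ Ω η = 0 := by
    intro η hη
    have h1 := hΩ.lagrange hC hη hξ₀ 0
    rw [hpen, hΛ]
    field_simp [hneg.ne]
    linear_combination -h1
  refine ⟨Λ, div_nonneg hF₀ (neg_nonneg.2 hneg.le), fun η hη => ⟨fun Φ hΦ => ?_, hcrit η hη⟩,
    fun η ξ hη hξ _ hξ0 => ⟨fun Φ hΦ => ?_, ?_⟩⟩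
  · exact (hΦ.heatPen_jets hη hC Λ).2.1
  · have hθ : HeatShape.IsTest D (HeatShape.corrected Ω η ξ) := hη.sub (hξ.const_smul _)
    have h1 := hΦ.heatPen_jets hθ hC Λ
    exact ⟨h1.1, h1.2.2⟩
  · have hθ : HeatShape.IsTest D (HeatShape.corrected Ω η ξ) := hη.sub (hξ.const_smul _)
    have hθ0 : HeatShape.deltaVol Ω (HeatShape.corrected Ω η ξ) = 0 := by
      refine (HeatShape.deltaVol_sub_smul hη hξ _).trans ?_
      exact sub_eq_zero.2 (div_mul_cancel₀ _ hξ0).symm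
    -- The corrected field preserves the volume to first order, and ξ₀ is the direction that
    -- restores it at second order.
    exact hΩ.delta2HeatPen_nonneg hC hcrit hθ hθ0 hξ₀ hneg.ne
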